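/- Let $d\ge 1$, $D\ge 1$ be integers and $0\le\alpha\le d$. For $L\in\mathbb N$ let $\Gamma=\Gamma_L=\{1,\dots,L\}^d$ be the lattice with $N=L^d$ sites and open or periodic boundary conditions, $\|\mathbf r-\mathbf s\|_\Gamma=\big(\sum_{a=1}^d \mathrm{dist}(\mathbf r^a,\mathbf s^a)^2\big)^{1/2}$ with $\mathrm{dist}(x,y)=|x-y|$ (open) or $\min(|x-y|,L-|x-y|)$ (periodic), let $\|\mathbf r\|_\Gamma$ be the distance of $\mathbf r$ to $0$ in the same sense, and let $c_\alpha^N=\sum_{\mathbf r\in\Gamma}\|\mathbf r\|_\Gamma^{-\alpha}$ be the Kac factor (for $\alpha>0$ a term with $\|\mathbf r\|_\Gamma=0$ is omitted). Each site $j$, at position $\mathbf r_j$, carries a $D$-level system $\mathbb C^D$; superscripts $(j)$, $(jk)$ indicate the sites on which an operator acts. Consider the generator $\mathcal L_N[\cdot]=-i[H_N,\cdot]+\mathcal D_N[\cdot]$ with $$H_N=\sum_{k\in\Gamma}h_k^{(k)}+\frac1{2c_\alpha^N}\sum_{j\ne k}\frac{V_{jk}^{(jk)}}{\|\mathbf r_j-\mathbf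 r_k\|_\Gamma^\alpha},\qquad \mathcal D_N[\cdot]=\sum_\mu\sum_{j,k\in\Gamma}\gamma^\mu_{jk}\Big(L_\mu^{(j)}\cdot L_\mu^{(k)\dagger}-\tfrac12\{L_\mu^{(k)\dagger}L_\mu^{(j)},\cdot\}\Big),$$ $$\gamma^\mu_{jk}=\kappa^\mu_j\delta_{jk}+\frac{w^\mu_{jk}}{2c_\alpha^N[\delta_{jk}+(1-\delta_{jk})\|\mathbf r_j-\mathbf r_k\|_\Gamma^\alpha]},$$ where $\mu$ runs over a finite set. All parameters may depend on the sites and on $N$ (the $L_\mu$ are the same at all sites); the $h_k$ and $V_{jk}^{(jk)}+V_{kj}^{(jk)}$ (for $j\neq k$; the first tensor factor of $V_{kj}$ acts at $k$) are Hermitian, the $\kappa^\mu_j$ are real and the matrices $w^\mu$ are Hermitian. Assume that $e^{t\mathcal L_N}$ is completely positive for all $t\ge0$ and all $N$ (which holds, for instance, if all matrices $\gamma^\mu$ are positive semidefinite), and that the long-range couplings are bounded uniformly in $N$: there is $C$ such that for all $N$ and all $j,k\in\Gamma$ $$(1-\delta_{jk})\,2\|V_{jk}\|+\sum_\mu\big(|w^\mu_{jk}|+|w^\mu_{kj}|\big)\|L_\mu\|\,\|L_\mu^\dagger\|\le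 C .$$ Let the initial state be a product $\varrho_N=\bigotimes_{j\in\Gamma}\varrho_N^{(j)}$ of density matrices, and let $\varrho_{N,t}^{(\Lambda)}$ be the partial trace of $e^{t\mathcal L_N}[\varrho_N]$ over the sites outside $\Lambda\subseteq\Gamma$. Put $\mathcal L_j[\cdot]=-i[h_j,\cdot]+\sum_\mu\kappa_j^\mu\big(L_\mu\cdot L_\mu^\dagger-\frac12\{L_\mu^\dagger L_\mu,\cdot\}\big)$ and, for $j\ne k$, $$\mathcal L_{jk}[\cdot]=-\tfrac i2\big[V_{jk}^{(jk)}+V_{kj}^{(jk)},\cdot\big]+\sum_\mu\Big[\tfrac{w^\mu_{jk}}2\Big(L_\mu^{(j)}\cdot L_\mu^{(k)\dagger}-\tfrac12\{L_\mu^{(k)\dagger}L_\mu^{(j)},\cdot\}\Big)+\tfrac{w^\mu_{kj}}2\Big(L_\mu^{(k)}\cdot L_\mu^{(j)\dagger}-\tfrac12\{L_\mu^{(j)\dagger}L_\mu^{(k)},\cdot\}\Big)\Big].$$ Then for every $N$ the nonlinear mean-field system $$\dot{\tilde\varrho}^{(j)}_{N,t}=\mathcal L_j[\tilde\varrho^{(j)}_{N,t}]+\sum_{k\in\Gamma,\,k\ne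 j}\frac{\mathrm{tr}_2\big(\mathcal L_{jk}[\tilde\varrho^{(j)}_{N,t}\otimes\tilde\varrho^{(k)}_{N,t}]\big)}{c_\alpha^N\|\mathbf r_j-\mathbf r_k\|_\Gamma^\alpha},\qquad \tilde\varrho^{(j)}_{N,0}=\varrho^{(j)}_N\qquad(j\in\Gamma),$$ with $\mathrm{tr}_2$ the trace over the second tensor factor, has a solution for all $t\ge0$, and for every solution, every $t\ge0$ and every $n$, $$\lim_{N\to\infty}\Big\|\varrho^{(\Lambda)}_{N,t}-\bigotimes_{j\in\Lambda}\tilde\varrho^{(j)}_{N,t}\Big\|_{\mathrm{tr}}=0$$ for all $\Lambda=\Lambda_L\subseteq\Gamma_L$ with at most $n$ sites; in particular for a fixed finite set $\Lambda$ of sites. -/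

import Mathlib

open Filter Topology
open scoped Matrix Kronecker Nat ComplexOrder

noncomputable section

namespace LongRange

/-! ### The lattice -/

/-- Boundary conditions of the lattice: `free` means open boundaries. -/
inductive Boundary
  | free
  | periodic

/-- The sites of the `d`-dimensional lattice with `L ^ d` sites. The entry `i : Fin L` stands for
the coordinate value `i + 1 ∈ {1, …, L}`, see `coord`. -/
abbrev Site (d L : ℕ) : Type := Fin d → Fin L

/-- The `a`-th coordinate of a site, a number in `{1, …, L}`. -/
def coord {d L : ℕ} (r : Site d L) (a : Fin d) : ℝ := ((r a : ℕ) : ℝ) + 1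

/-- Distance of two coordinate values on a segment or a ring of length `L`. -/
def coordDist (bc : Boundary) (L : ℕ) (x y : ℝ) : ℝ :=
  match bc with
  | Boundary.free => |x - y|
  | Boundary.periodic => min |x - y| ((L : ℝ) - |x - y|)

/-- Euclidean distance of two sites, the boundary conditions being accounted for. -/
def siteDist (bc : Boundary) {d L : ℕ} (r s : Site d L) : ℝ :=
  √(∑ a, coordDist bc L (coord r a) (coord s a) ^ 2)

/-- Euclidean norm of the position of a site, that is, its distance to the origin `(0, …, 0)`. -/
def siteNorm (bc : Boundary) {d L : ℕ} (r : Site d L) : ℝ :=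
  √(∑ a, coordDist bc L (coord r a) 0 ^ 2)

/-- The Kac factor `∑ r, ‖r‖ ^ (-α)`. On the periodic lattice the site `(L, …, L)` is identified
with the origin and has norm `0`; since `0 ^ (-α) = 0` for `α > 0`, its singular term is omitted
(for `α = 0` it contributes `1`, so that the sum is the number of sites). -/
def kac (bc : Boundary) (α : ℝ) (d L : ℕ) : ℝ :=
  ∑ r : Site d L, siteNorm bc r ^ (-α)

/-! ### Operators on a tensor product of `D`-level systems

For a finite set `S` of sites, operators on `⨂_{j ∈ S} ℂ^D` are matrices in the product basis, which
is indexed by the configurations `S → Fin D`. -/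

/-- Operators on the Hilbert space of the `D`-level systems attached to `S`. -/
abbrev Op (S : Type*) (D : ℕ) : Type _ := Matrix (S → Fin D) (S → Fin D) ℂ

section Operators

variable {S : Type*} [Fintype S] [DecidableEq S] {D : ℕ}

/-- The single-site operator `A` acting on site `k`, and as the identity on all other sites. -/
def onSite (k : S) (A : Matrix (Fin D) (Fin D) ℂ) : Op S D :=
  fun σ τ => if ∀ i, i ≠ k → σ i = τ i then A (σ k) (τ k) else 0

/-- The two-site operator `V` acting on the sites `j ≠ k` (the first tensor factor at `j`, the
second one at `k`), and as the identity on all other sites. -/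
def onPair (j k : S) (V : Matrix (Fin D × Fin D) (Fin D × Fin D) ℂ) : Op S D :=
  fun σ τ => if ∀ i, i ≠ j → i ≠ k → σ i = τ i then V (σ j, σ k) (τ j, τ k) else 0

/-- The tensor product `⨂_{j ∈ S} ρ_j`. -/
def tensorState (ρ : S → Matrix (Fin D) (Fin D) ℂ) : Op S D :=
  fun σ τ => ∏ j, ρ j (σ j) (τ j)

/-- The configuration that is `σ` on `Λ` and `η` on the complement of `Λ`. -/
def glue (Λ : Finset S) (σ : Λ → Fin D) (η : {i // i ∉ Λ} → Fin D) : S → Fin D :=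
  fun i => if h : i ∈ Λ then σ ⟨i, h⟩ else η ⟨i, h⟩

/-- The reduced operator on `Λ`: the partial trace over all sites that are not in `Λ`. -/
def reduced (Λ : Finset S) (ρ : Op S D) : Op Λ D :=
  fun σ τ => ∑ η : {i // i ∉ Λ} → Fin D, ρ (glue Λ σ η) (glue Λ τ η)

end Operators

section Matrices

variable {n : Type*} [Fintype n] [DecidableEq n]

/-- The trace norm: the sum of the singular values. -/
def traceNorm (A : Matrix n n ℂ) : ℝ :=
  ∑ i, √((Matrix.isHermitian_conjTranspose_mul_self A).eigenvalues i)

/-- The operator norm with respect to the Euclidean norm. -/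
def opNorm (A : Matrix n n ℂ) : ℝ := ‖Matrix.toEuclideanCLM (n := n) (𝕜 := ℂ) A‖

/-- Density matrices. -/
def IsState (ρ : Matrix n n ℂ) : Prop := ρ.PosSemidef ∧ ρ.trace = 1

/-- The partial trace over the second factor of a tensor product. -/
def traceSecond {m : Type*} (X : Matrix (m × n) (m × n) ℂ) : Matrix m m ℂ :=
  fun a b => ∑ c, X (a, c) (b, c)

/-- The commutator map `X ↦ H X - X H`. -/
def commutator (H : Matrix n n ℂ) : Module.End ℂ (Matrix n n ℂ) :=
  LinearMap.mulLeft ℂ H - LinearMap.mulRight ℂ H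

/-- The map `X ↦ A X B† - (B† A X + X B† A) / 2`. -/
def dissipator (A B : Matrix n n ℂ) : Module.End ℂ (Matrix n n ℂ) :=
  LinearMap.mulLeft ℂ A * LinearMap.mulRight ℂ Bᴴ
    - (1 / 2 : ℂ) • (LinearMap.mulLeft ℂ (Bᴴ * A) + LinearMap.mulRight ℂ (Bᴴ * A))

/-- `evolve G t X` is `e^{tG}[X]`, given by the exponential series. -/
def evolve (G : Module.End ℂ (Matrix n n ℂ)) (t : ℝ) (X : Matrix n n ℂ) : Matrix n n ℂ :=
  ∑' m : ℕ, ((t : ℂ) ^ m / (m ! : ℂ)) • (G ^ m) X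

/-- Complete positivity: for every `m`, applying `Φ` to each block of a positive semidefinite
`m × m` block matrix yields a positive semidefinite matrix. -/
def IsCompletelyPositive (Φ : Matrix n n ℂ → Matrix n n ℂ) : Prop :=
  ∀ (m : ℕ) (X : Matrix (Fin m × n) (Fin m × n) ℂ), X.PosSemidef →
    Matrix.PosSemidef (Matrix.of fun p q : Fin m × n =>
      Φ (Matrix.of fun a b => X (p.1, a) (q.1, b)) p.2 q.2)

end Matrices

/-! ### The generator -/

/-- The (inhomogeneous) parameters of the model on a set `S` of sites; `ι` labels the dissipative
processes. The conditions say that the Hamiltonian is Hermitian (with the two-body terms of the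
ordered pairs `(j, k)` and `(k, j)` taken together) and that the rate matrices are Hermitian. -/
structure Model (S : Type*) (D : ℕ) (ι : Type*) where
  /-- single-site Hamiltonians -/
  h : S → Matrix (Fin D) (Fin D) ℂ
  /-- two-body operators; the first tensor factor of `V j k` belongs to `j`, the second to `k` -/
  V : S → S → Matrix (Fin D × Fin D) (Fin D × Fin D) ℂ
  /-- local dissipation rates -/
  κ : ι → S → ℝ
  /-- coefficients of the long-range dissipation -/
  w : ι → Matrix S S ℂ
  /-- jump operators -/
  jump : ι → Matrix (Fin D) (Fin D) ℂ
  h_herm : ∀ j, (h j).IsHermitian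
  V_herm : ∀ j k, j ≠ k → (V j k + (V k j).submatrix Prod.swap Prod.swap).IsHermitian
  w_herm : ∀ μ, (w μ).IsHermitian

namespace Model

variable {d L D : ℕ} {ι : Type*} [Fintype ι]

/-- The Hamiltonian. -/
def hamiltonian (M : Model (Site d L) D ι) (bc : Boundary) (α : ℝ) : Op (Site d L) D :=
  (∑ k, onSite k (M.h k))
    + ((1 / (2 * kac bc α d L) : ℝ) : ℂ) •
      ∑ j, ∑ k, if j = k then 0 else
        ((1 / siteDist bc j k ^ α : ℝ) : ℂ) • onPair j k (M.V j k)

/-- The matrix of the dissipation rates of the process `μ`. -/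
def rate (M : Model (Site d L) D ι) (bc : Boundary) (α : ℝ) (μ : ι) (j k : Site d L) : ℂ :=
  (if j = k then (M.κ μ j : ℂ) else 0)
    + M.w μ j k / ((2 * kac bc α d L * (if j = k then 1 else siteDist bc j k ^ α) : ℝ) : ℂ)

/-- The Lindblad generator of the many-body system. -/
def generator (M : Model (Site d L) D ι) (bc : Boundary) (α : ℝ) :
    Module.End ℂ (Op (Site d L) D) :=
  (-Complex.I) • commutator (M.hamiltonian bc α)
    + ∑ μ, ∑ j, ∑ k, M.rate bc α μ j k •
        dissipator (onSite j (M.jump μ)) (onSite k (M.jump μ))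

/-- The single-site map `𝓛_j`. -/
def siteGen {S : Type*} (M : Model S D ι) (j : S) : Module.End ℂ (Matrix (Fin D) (Fin D) ℂ) :=
  (-Complex.I) • commutator (M.h j) + ∑ μ, (M.κ μ j : ℂ) • dissipator (M.jump μ) (M.jump μ)

/-- The two-site map `𝓛_{jk}` for `j ≠ k`, acting on operators on the tensor product of the spaces
of `j` (first factor) and `k` (second factor). -/
def pairGen {S : Type*} (M : Model S D ι) (j k : S) :
    Module.End ℂ (Matrix (Fin D × Fin D) (Fin D × Fin D) ℂ) :=
  (-Complex.I / 2) • commutator (M.V j k + (M.V k j).submatrix Prod.swap Prod.swap)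
    + ∑ μ, ((M.w μ j k / 2) • dissipator (M.jump μ ⊗ₖ 1) (1 ⊗ₖ M.jump μ)
        + (M.w μ k j / 2) • dissipator (1 ⊗ₖ M.jump μ) (M.jump μ ⊗ₖ 1))

/-- The strength of the long-range couplings of the sites `j` and `k`. -/
def strength {S : Type*} [DecidableEq S] (M : Model S D ι) (j k : S) : ℝ :=
  (if j = k then 0 else 2 * opNorm (M.V j k))
    + (∑ μ, ‖M.w μ j k‖ * opNorm (M.jump μ) * opNorm (M.jump μ)ᴴ)
    + ∑ μ, ‖M.w μ k j‖ * opNorm (M.jump μ) * opNorm (M.jump μ)ᴴ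

/-- The right-hand side of the mean-field equation at site `j`. -/
def meanField (M : Model (Site d L) D ι) (bc : Boundary) (α : ℝ)
    (ρ : Site d L → Matrix (Fin D) (Fin D) ℂ) (j : Site d L) : Matrix (Fin D) (Fin D) ℂ :=
  M.siteGen j (ρ j)
    + ∑ k ∈ Finset.univ.erase j, ((1 / (kac bc α d L * siteDist bc j k ^ α) : ℝ) : ℂ) •
        traceSecond (M.pairGen j k (ρ j ⊗ₖ ρ k))

/-- `ρ` solves the mean-field equation for all times `t ≥ 0`, with the initial values `ρ₀`. -/
def IsMeanFieldSolution (M : Model (Site d L) D ι) (bc : Boundary) (α : ℝ)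
    (ρ₀ : Site d L → Matrix (Fin D) (Fin D) ℂ)
    (ρ : Site d L → ℝ → Matrix (Fin D) (Fin D) ℂ) : Prop :=
  (∀ j, ρ j 0 = ρ₀ j) ∧
    ∀ j, ∀ t : ℝ, 0 ≤ t →
      HasDerivWithinAt (ρ j) (M.meanField bc α (fun k => ρ k t) j) (Set.Ici 0) t

end Model

end LongRange

end

/-!
The reduced states of the many-body state `ϱ_t` obey a hierarchy in which the marginal on a set `Λ`
of sites is driven by the marginals on the sets `Λ ∪ {k}`. It is treated in the Heisenberg picture:
`marginalNorm Λ D X` is the norm of the functional `O ↦ tr (O X)` on the Hermitian observables `O`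
localized in `Λ` (those in `localAlg Λ D`). The argument rests on three facts.

* Positivity and trace preservation make the dual dynamics contractive in the operator norm on
  Hermitian observables, so that `‖O + h • heis G O‖ ≤ (1 + o(h)) * ‖O‖` (`exists_norm_add_heis_le`).
  Composing with a norm-one projection onto `localAlg Λ D` (`exists_condExp`) discards everything in
  `heis G O` that stays in `Λ`, however large it may be (the one-site terms are not bounded
  uniformly). What remains couples `Λ` to its complement, and the Kac normalization bounds it by
  `|Λ| * 4 * C * A`: see `MeanFieldScaling.exists_marginalNorm_le`.
* A product `σ_t` of mean-field solutions solves the many-body equation up to an error. The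
  couplings between `Λ` and its complement reproduce the mean field exactly, and the at most `|Λ|²`
  couplings inside `Λ` are of the order of one over the Kac factor
  (`norm_trace_coupledGen_sub_le`), which diverges for `α ≤ d` (`tendsto_kac`).
* The weighted supremum `max_Λ z ^ |Λ| * marginalNorm Λ D (ϱ_t - σ_t)` absorbs the factor `|Λ|` of
  the hierarchy, if the weight `z` decreases linearly in time
  (`MeanFieldScaling.marginalNorm_le_of_hierarchy`). This gives convergence on a time interval that
  does not depend on the size of the system, and at its end the same situation is present again.

The factors of `σ_t` are not assumed to be positive for `t > 0`; nothing but their trace is known.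
Their size is controlled by the same differential inequality, starting from the fact that at the
beginning of each interval the one-site marginals of `σ_t` are close to those of the state `ϱ_t`
(`MeanFieldScaling.entrySum_le_of_isNormalizedSolution`).

The mean-field equations have global solutions because the interaction with the other sites acts on
`ρ_j` by a commutator (`Model.traceSecond_pairGen`), which does not change `tr (ρ_j ^ 2)`. Hence
`∑ j, tr (ρ_j ^ 2)` grows at most exponentially, and solutions cannot blow up.
-/

noncomputable section

namespace LongRange

open scoped Matrix.Norms.L2Operator

/-! ### Matrices and their operator norm -/

section MatrixNorm

variable {n : Type*} [Fintype n] [DecidableEq n]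

lemma opNorm_eq (A : Matrix n n ℂ) : opNorm A = ‖A‖ := rfl

lemma norm_entry_le (A : Matrix n n ℂ) (i j : n) : ‖A i j‖ ≤ ‖A‖ := by
  have h := A.l2_opNorm_mulVec (EuclideanSpace.single j (1 : ℂ))
  have h2 := PiLp.norm_apply_le ((EuclideanSpace.equiv n ℂ).symm
    (A *ᵥ (EuclideanSpace.single j (1 : ℂ) : EuclideanSpace ℂ n))) i
  refine le_trans ?_ (h2.trans (h.trans ?_))
  · simp
  · simp

lemma norm_single_le (i j : n) (c : ℂ) : ‖Matrix.single i j c‖ ≤ ‖c‖ := by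
  have h := Matrix.l2_opNorm_conjTranspose_mul_self (Matrix.single i j c)
  rw [Matrix.conjTranspose_single, Matrix.single_mul_single_same,
    ← Matrix.diagonal_single, Matrix.l2_opNorm_diagonal] at h
  have h3 : ‖(Pi.single j (star c * c) : n → ℂ)‖ ≤ ‖c‖ * ‖c‖ := by
    refine (pi_norm_le_iff_of_nonneg (by positivity)).2 fun k => ?_
    by_cases hk : k = j
    · subst hk; simp
    · simp [Pi.single_eq_of_ne hk]; positivity
  rw [h] at h3
  exact abs_le_of_sq_le_sq' (by nlinarith) (norm_nonneg _) |>.2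

/-- The sum of the absolute values of the entries. -/
def entrySum (A : Matrix n n ℂ) : ℝ := ∑ i, ∑ j, ‖A i j‖

omit [DecidableEq n] in
lemma entrySum_nonneg (A : Matrix n n ℂ) : 0 ≤ entrySum A := by unfold entrySum; positivity

lemma norm_le_entrySum (A : Matrix n n ℂ) : ‖A‖ ≤ entrySum A := by
  conv_lhs => rw [Matrix.matrix_eq_sum_single A]
  refine (norm_sum_le _ _).trans (Finset.sum_le_sum fun i _ => ?_)
  exact (norm_sum_le _ _).trans (Finset.sum_le_sum fun j _ => norm_single_le _ _ _)

omit [DecidableEq n] in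
lemma entrySum_le_of_entry_le {A : Matrix n n ℂ} {c : ℝ} (h : ∀ i j, ‖A i j‖ ≤ c) :
    entrySum A ≤ (Fintype.card n : ℝ) ^ 2 * c := by
  calc entrySum A ≤ ∑ _i : n, ∑ _j : n, c :=
        Finset.sum_le_sum fun i _ => Finset.sum_le_sum fun j _ => h i j
    _ = _ := by simp; ring

lemma entrySum_le (A : Matrix n n ℂ) : entrySum A ≤ (Fintype.card n : ℝ) ^ 2 * ‖A‖ :=
  entrySum_le_of_entry_le (norm_entry_le A)

lemma norm_trace_le (A : Matrix n n ℂ) : ‖A.trace‖ ≤ (Fintype.card n : ℝ) * ‖A‖ := by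
  calc ‖A.trace‖ ≤ ∑ i, ‖A i i‖ := norm_sum_le _ _
    _ ≤ ∑ _i : n, ‖A‖ := Finset.sum_le_sum fun i _ => norm_entry_le A i i
    _ = _ := by simp

open scoped MatrixOrder in
lemma posSemidef_sub_of_norm_le {Y : Matrix n n ℂ} (hY : Y.IsHermitian) {c : ℝ} (h : ‖Y‖ ≤ c) :
    ((c : ℂ) • (1 : Matrix n n ℂ) - Y).PosSemidef := by
  have hs : IsSelfAdjoint Y := hY
  have h1 := hs.le_algebraMap_norm_self
  have h2 : ((‖Y‖ : ℂ) • (1 : Matrix n n ℂ) - Y).PosSemidef := by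
    have := Matrix.le_iff.1 h1
    rwa [Algebra.algebraMap_eq_smul_one] at this
  have h3 : (((c - ‖Y‖ : ℝ) : ℂ) • (1 : Matrix n n ℂ)).PosSemidef :=
    Matrix.PosSemidef.one.smul (by exact_mod_cast sub_nonneg.2 h)
  have := h3.add h2
  convert this using 1
  push_cast
  module

lemma posSemidef_add_of_norm_le {Y : Matrix n n ℂ} (hY : Y.IsHermitian) {c : ℝ} (h : ‖Y‖ ≤ c) :
    ((c : ℂ) • (1 : Matrix n n ℂ) + Y).PosSemidef := by
  simpa using posSemidef_sub_of_norm_le hY.neg (by simpa using h)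

open scoped MatrixOrder in
/-- A matrix `Y` with `-c ≤ Y ≤ c` has norm at most `c`: the product of the commuting nonnegative
matrices `c - Y` and `c + Y` is nonnegative, so `Y ^ 2 ≤ c ^ 2`. -/
lemma norm_le_of_posSemidef {Y : Matrix n n ℂ} {c : ℝ} (hc : 0 ≤ c)
    (h1 : ((c : ℂ) • (1 : Matrix n n ℂ) - Y).PosSemidef)
    (h2 : ((c : ℂ) • (1 : Matrix n n ℂ) + Y).PosSemidef) : ‖Y‖ ≤ c := by
  have hY : Yᴴ = Y := by
    have h3 := h2.isHermitian
    have h4 : ((c : ℂ) • (1 : Matrix n n ℂ)).IsHermitian := by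
      simp [Matrix.IsHermitian]
    have h5 := h3.sub h4
    rwa [add_sub_cancel_left] at h5
  have hcomm : Commute ((c : ℂ) • (1 : Matrix n n ℂ) - Y) ((c : ℂ) • (1 : Matrix n n ℂ) + Y) := by
    have h0 : Commute ((c : ℂ) • (1 : Matrix n n ℂ)) Y := (Commute.one_left Y).smul_left _
    exact ((Commute.refl _).add_right h0).sub_left (h0.symm.add_right (Commute.refl _))
  have h6 := hcomm.mul_nonneg h1.nonneg h2.nonneg
  have h7 : Yᴴ * Y ≤ algebraMap ℝ (Matrix n n ℂ) (c ^ 2) := by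
    rw [hY, ← sub_nonneg, Algebra.algebraMap_eq_smul_one]
    convert h6 using 1
    simp only [sub_mul, mul_add, smul_mul_assoc, one_mul, mul_smul_comm, mul_one]
    have : (c ^ 2 : ℝ) • (1 : Matrix n n ℂ) = (c : ℂ) • (c : ℂ) • (1 : Matrix n n ℂ) := by
      rw [smul_smul, ← sq]; norm_cast
    rw [this]; module
  have h8 := (CStarAlgebra.norm_le_iff_le_algebraMap (Yᴴ * Y) (sq_nonneg c)
    (Matrix.posSemidef_conjTranspose_mul_self Y).nonneg).2 h7
  rw [Matrix.l2_opNorm_conjTranspose_mul_self] at h8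
  exact abs_le_of_sq_le_sq' (by nlinarith) hc |>.2

open scoped MatrixOrder in
lemma trace_mul_nonneg {A B : Matrix n n ℂ} (hA : A.PosSemidef) (hB : B.PosSemidef) :
    0 ≤ (A * B).trace := by
  obtain ⟨C, rfl⟩ := CStarAlgebra.nonneg_iff_eq_star_mul_self.1 hB.nonneg
  rw [← mul_assoc, Matrix.trace_mul_comm, ← mul_assoc]
  exact (hA.mul_mul_conjTranspose_same C).trace_nonneg

omit [DecidableEq n] in
lemma star_trace_mul {A B : Matrix n n ℂ} (hA : A.IsHermitian) (hB : B.IsHermitian) :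
    star (A * B).trace = (A * B).trace := by
  rw [← Matrix.trace_conjTranspose, Matrix.conjTranspose_mul, hA.eq, hB.eq, Matrix.trace_mul_comm]

/-- Expectation values in a positive functional are bounded by the norm of the observable. -/
lemma norm_trace_mul_le {Y P : Matrix n n ℂ} (hY : Y.IsHermitian) (hP : P.PosSemidef) :
    ‖(Y * P).trace‖ ≤ ‖Y‖ * P.trace.re := by
  have h1 := trace_mul_nonneg (posSemidef_sub_of_norm_le hY le_rfl) hP
  have h2 := trace_mul_nonneg (posSemidef_add_of_norm_le hY le_rfl) hP
  have h0 : (Y * P).trace.im = 0 := Complex.conj_eq_iff_im.1 (star_trace_mul hY hP.isHermitian)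
  simp only [sub_mul, add_mul, Matrix.trace_sub, Matrix.trace_add, smul_mul_assoc, one_mul,
    Matrix.trace_smul, smul_eq_mul] at h1 h2
  have h1' := (Complex.le_def.1 h1).1
  have h2' := (Complex.le_def.1 h2).1
  simp at h1' h2'
  rw [← Complex.re_add_im (Y * P).trace, h0]
  simp only [Complex.ofReal_zero, zero_mul, add_zero, Complex.norm_real, Real.norm_eq_abs]
  exact abs_le.2 ⟨by linarith, by linarith⟩

/-- A Hermitian matrix is bounded by `c` if its expectation values in all vectors are. -/
lemma norm_le_of_forall_trace {Y : Matrix n n ℂ} (hY : Y.IsHermitian) {c : ℝ} (hc : 0 ≤ c)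
    (h : ∀ P : Matrix n n ℂ, P.PosSemidef → ‖(Y * P).trace‖ ≤ c * P.trace.re) : ‖Y‖ ≤ c := by
  have key : ∀ Z : Matrix n n ℂ, Z.IsHermitian →
      (∀ P : Matrix n n ℂ, P.PosSemidef → ‖(Z * P).trace‖ ≤ c * P.trace.re) →
      ((c : ℂ) • (1 : Matrix n n ℂ) - Z).PosSemidef := by
    intro Z hZ hb
    have h4 : ((c : ℂ) • (1 : Matrix n n ℂ)).IsHermitian := by simp [Matrix.IsHermitian]
    refine Matrix.PosSemidef.of_dotProduct_mulVec_nonneg (h4.sub hZ) fun x => ?_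
    have hx : star x ⬝ᵥ ((c : ℂ) • (1 : Matrix n n ℂ) - Z) *ᵥ x
        = (((c : ℂ) • (1 : Matrix n n ℂ) - Z) * Matrix.vecMulVec x (star x)).trace := by
      rw [Matrix.mul_vecMulVec, Matrix.trace_vecMulVec, dotProduct_comm]
    have hP := Matrix.posSemidef_vecMulVec_self_star x
    have h1 := hb _ hP
    rw [hx]
    have him := Complex.conj_eq_iff_im.1 (star_trace_mul (h4.sub hZ) hP.isHermitian)
    refine Complex.le_def.2 ⟨?_, by simpa using him.symm⟩
    have h2 := (Complex.abs_re_le_norm _).trans h1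
    rw [sub_mul, Matrix.trace_sub, smul_mul_assoc, one_mul, Matrix.trace_smul]
    simp only [smul_eq_mul, Complex.zero_re, Complex.sub_re, Complex.re_ofReal_mul]
    linarith [(abs_le.1 h2).2]
  refine norm_le_of_posSemidef hc (key Y hY h) ?_
  have := key (-Y) hY.neg fun P hP => by simpa using h P hP
  simpa using this

open scoped MatrixOrder in
lemma norm_le_trace_of_posSemidef {P : Matrix n n ℂ} (hP : P.PosSemidef) :
    ‖P‖ ≤ (Fintype.card n : ℝ) ^ 2 * P.trace.re := by
  refine (norm_le_entrySum P).trans (entrySum_le_of_entry_le fun i j => ?_)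
  obtain ⟨C, rfl⟩ := CStarAlgebra.nonneg_iff_eq_star_mul_self.1 hP.nonneg
  have ht : (star C * C).trace.re = ∑ l, ∑ k, ‖C k l‖ ^ 2 := by
    simp only [Matrix.trace, Matrix.diag_apply, Matrix.mul_apply, Matrix.star_apply,
      RCLike.star_def, ← Complex.normSq_eq_conj_mul_self, Complex.normSq_eq_norm_sq,
      Complex.re_sum, Complex.ofReal_re]
  have hcol : ∀ l, ∑ k, ‖C k l‖ ^ 2 ≤ (star C * C).trace.re := fun l => ht ▸
    Finset.single_le_sum (f := fun l => ∑ k, ‖C k l‖ ^ 2) (fun _ _ => by positivity)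
      (Finset.mem_univ l)
  calc ‖(star C * C) i j‖ ≤ ∑ k, ‖C k i‖ * ‖C k j‖ := by
        rw [Matrix.mul_apply]
        refine (norm_sum_le _ _).trans (Finset.sum_le_sum fun k _ => ?_)
        simp [Matrix.star_apply]
    _ ≤ ∑ k, (‖C k i‖ ^ 2 + ‖C k j‖ ^ 2) / 2 := Finset.sum_le_sum fun k _ => by
        nlinarith [sq_nonneg (‖C k i‖ - ‖C k j‖)]
    _ ≤ _ := by
        rw [← Finset.sum_div, Finset.sum_add_distrib]
        linarith [hcol i, hcol j]

end MatrixNorm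

/-! ### The evolution and the Heisenberg picture -/

section Exponential

variable {E : Type*} [NormedAddCommGroup E] [NormedSpace ℂ E] [FiniteDimensional ℂ E]

lemma tsum_pow_eq_exp (g : Module.End ℂ E) (t : ℝ) (x : E) :
    (∑' m : ℕ, ((t : ℂ) ^ m / (m ! : ℂ)) • (g ^ m) x)
      = NormedSpace.exp ((t : ℂ) • LinearMap.toContinuousLinearMap g) x := by
  have : CompleteSpace E := FiniteDimensional.complete ℂ E
  set gc := LinearMap.toContinuousLinearMap g with hgc
  have hpow : ∀ (m : ℕ) (y : E), (gc ^ m) y = (g ^ m) y := by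
    intro m
    induction m with
    | zero => intro y; simp
    | succ m ih =>
      intro y
      rw [pow_succ, pow_succ, mul_apply_eq_comp, Module.End.mul_apply, ih]
      rfl
  have h := (NormedSpace.exp_series_hasSum_exp' (𝕂 := ℂ) ((t : ℂ) • gc)).mapL
    (ContinuousLinearMap.apply ℂ E x)
  refine (tsum_congr fun m => ?_).trans h.tsum_eq
  simp only [smul_pow, ContinuousLinearMap.apply_apply, smul_apply, hpow, smul_smul]
  congr 1
  field_simp

lemma hasDerivAt_tsum_pow (g : Module.End ℂ E) (x : E) (t : ℝ) :
    HasDerivAt (fun s : ℝ => ∑' m : ℕ, ((s : ℂ) ^ m / (m ! : ℂ)) • (g ^ m) x)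
      (g (∑' m : ℕ, ((t : ℂ) ^ m / (m ! : ℂ)) • (g ^ m) x)) t := by
  have : CompleteSpace E := FiniteDimensional.complete ℂ E
  simp only [tsum_pow_eq_exp]
  have h := hasDerivAt_exp_smul_const' (𝕂 := ℂ) (LinearMap.toContinuousLinearMap g) (t : ℂ)
  have h2 := (ContinuousLinearMap.apply ℂ E x).hasFDerivAt.comp_hasDerivAt (t : ℂ) h
  have h3 := HasDerivAt.scomp (𝕜 := ℝ) (𝕜' := ℂ) (F := E) t h2 Complex.ofRealCLM.hasDerivAt
  simpa [Function.comp_def] using! h3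

lemma tsum_pow_zero (g : Module.End ℂ E) (x : E) :
    (∑' m : ℕ, (((0 : ℝ) : ℂ) ^ m / (m ! : ℂ)) • (g ^ m) x) = x := by
  rw [tsum_pow_eq_exp]; simp

lemma exists_norm_tsum_pow_sub_le (g : Module.End ℂ E) :
    ∃ ω : ℝ → ℝ, (∀ h, 0 ≤ ω h) ∧ ω =o[𝓝[≥] 0] (fun h => h) ∧ ∀ (h : ℝ) (x : E),
      ‖(∑' m : ℕ, ((h : ℂ) ^ m / (m ! : ℂ)) • (g ^ m) x) - x - (h : ℂ) • g x‖ ≤ ω h * ‖x‖ := by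
  have : CompleteSpace E := FiniteDimensional.complete ℂ E
  set gc := LinearMap.toContinuousLinearMap g with hgc
  refine ⟨fun h => ‖NormedSpace.exp ((h : ℂ) • gc) - 1 - (h : ℂ) • gc‖,
    fun h => norm_nonneg _, ?_, ?_⟩
  · have h := hasDerivAt_iff_isLittleO.1 (hasDerivAt_exp_smul_const (𝕂 := ℂ) gc (0 : ℂ))
    have h1 : Tendsto (fun r : ℝ => (r : ℂ)) (𝓝[≥] 0) (𝓝 0) :=
      (Complex.continuous_ofReal.tendsto' 0 0 (by simp)).mono_left nhdsWithin_le_nhds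
    have h2 := ((h.comp_tendsto h1).norm_left).norm_right
    simp only [zero_smul, NormedSpace.exp_zero, one_mul, sub_zero, Function.comp_def] at h2
    refine h2.trans_isBigO (Asymptotics.isBigO_of_le _ fun x => ?_)
    simp
  · intro h x
    rw [tsum_pow_eq_exp]
    exact (NormedSpace.exp ((h : ℂ) • gc) - 1 - (h : ℂ) • gc).le_opNorm x

end Exponential

section Heisenberg

variable {n : Type*} [Fintype n] [DecidableEq n]

/-- The adjoint of a linear map with respect to the trace pairing `(O, X) ↦ tr (O X)`: the
Heisenberg picture of `T`. -/
def heis (T : Module.End ℂ (Matrix n n ℂ)) : Module.End ℂ (Matrix n n ℂ) where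
  toFun O := Matrix.of fun a b => (O * T (Matrix.single b a 1)).trace
  map_add' O O' := by ext a b; simp [add_mul, Matrix.add_apply]
  map_smul' c O := by ext a b; simp [Matrix.smul_apply]

lemma trace_heis_mul (T : Module.End ℂ (Matrix n n ℂ)) (O X : Matrix n n ℂ) :
    (heis T O * X).trace = (O * T X).trace := by
  conv_rhs => rw [Matrix.matrix_eq_sum_single X]
  have h : ∀ i j, Matrix.single i j (X i j) = X i j • Matrix.single i j (1 : ℂ) := by
    intro i j; rw [Matrix.smul_single, smul_eq_mul, mul_one]
  simp only [h, map_sum, map_smul, Finset.mul_sum, mul_smul_comm, Matrix.trace_sum,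
    Matrix.trace_smul, smul_eq_mul]
  simp only [Matrix.trace, Matrix.diag, Matrix.mul_apply]
  rw [Finset.sum_comm]
  refine Finset.sum_congr rfl fun i _ => Finset.sum_congr rfl fun j _ => ?_
  rw [mul_comm]
  rfl

lemma heis_eq_of_forall {T : Module.End ℂ (Matrix n n ℂ)} {O Y : Matrix n n ℂ}
    (h : ∀ X, (Y * X).trace = (O * T X).trace) : heis T O = Y :=
  Matrix.ext_iff_trace_mul_right.2 fun X => by rw [trace_heis_mul, h]

lemma heis_add (T T' : Module.End ℂ (Matrix n n ℂ)) (O : Matrix n n ℂ) :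
    heis (T + T') O = heis T O + heis T' O :=
  heis_eq_of_forall fun X => by simp [add_mul, mul_add, trace_heis_mul]

lemma heis_smul (c : ℂ) (T : Module.End ℂ (Matrix n n ℂ)) (O : Matrix n n ℂ) :
    heis (c • T) O = c • heis T O :=
  heis_eq_of_forall fun X => by simp [trace_heis_mul]

lemma heis_sum {ι : Type*} (s : Finset ι) (T : ι → Module.End ℂ (Matrix n n ℂ))
    (O : Matrix n n ℂ) : heis (∑ i ∈ s, T i) O = ∑ i ∈ s, heis (T i) O :=
  heis_eq_of_forall fun X => by
    simp [Finset.sum_mul, Finset.mul_sum, Matrix.trace_sum, trace_heis_mul, LinearMap.sum_apply]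

lemma heis_commutator (H O : Matrix n n ℂ) : heis (commutator H) O = O * H - H * O :=
  heis_eq_of_forall fun X => by
    simp only [commutator, LinearMap.sub_apply, LinearMap.mulLeft_apply, LinearMap.mulRight_apply,
      sub_mul, mul_sub, Matrix.trace_sub]
    rw [mul_assoc O H X, mul_assoc H O X, Matrix.trace_mul_comm H (O * X), mul_assoc]

lemma heis_dissipator (A B O : Matrix n n ℂ) :
    heis (dissipator A B) O
      = Bᴴ * O * A - (1 / 2 : ℂ) • (O * (Bᴴ * A) + Bᴴ * A * O) :=
  heis_eq_of_forall fun X => by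
    simp only [dissipator, LinearMap.sub_apply, LinearMap.mulLeft_apply, LinearMap.mulRight_apply,
      sub_mul, mul_sub, Matrix.trace_sub, LinearMap.smul_apply, LinearMap.add_apply,
      Module.End.mul_apply, mul_smul_comm, smul_mul_assoc, Matrix.trace_smul, mul_add, add_mul,
      Matrix.trace_add]
    congr 1
    · rw [mul_assoc, mul_assoc, Matrix.trace_mul_comm]; simp only [mul_assoc]
    · congr 2
      · simp only [mul_assoc]
      · rw [mul_assoc (Bᴴ * A), Matrix.trace_mul_comm]; simp only [mul_assoc]

lemma isHermitian_heis_commutator {H O : Matrix n n ℂ} (hH : H.IsHermitian) (hO : O.IsHermitian)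
    (r : ℝ) : ((r * -Complex.I : ℂ) • heis (commutator H) O).IsHermitian := by
  rw [heis_commutator, Matrix.IsHermitian, Matrix.conjTranspose_smul, Matrix.conjTranspose_sub,
    Matrix.conjTranspose_mul, Matrix.conjTranspose_mul, hH.eq, hO.eq, ← neg_sub, smul_neg,
    ← neg_smul]
  simp

lemma conjTranspose_heis_dissipator (A B : Matrix n n ℂ) {O : Matrix n n ℂ}
    (hO : O.IsHermitian) : (heis (dissipator A B) O)ᴴ = heis (dissipator B A) O := by
  simp only [heis_dissipator, Matrix.conjTranspose_sub, Matrix.conjTranspose_mul,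
    Matrix.conjTranspose_smul, Matrix.conjTranspose_add, hO.eq, Matrix.conjTranspose_conjTranspose,
    mul_assoc]
  simp [add_comm]

lemma norm_commutator_le (H X : Matrix n n ℂ) : ‖commutator H X‖ ≤ 2 * ‖H‖ * ‖X‖ := by
  simp only [commutator, LinearMap.sub_apply, LinearMap.mulLeft_apply, LinearMap.mulRight_apply]
  refine (norm_sub_le _ _).trans ?_
  nlinarith [norm_mul_le H X, norm_mul_le X H]

lemma norm_heis_commutator_le (H O : Matrix n n ℂ) :
    ‖heis (commutator H) O‖ ≤ 2 * ‖H‖ * ‖O‖ := by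
  rw [heis_commutator]
  refine (norm_sub_le _ _).trans ?_
  nlinarith [norm_mul_le H O, norm_mul_le O H]

lemma norm_lindblad_le {A B C X : Matrix n n ℂ} {a : ℝ} (hAB : ‖A‖ * ‖B‖ ≤ a) (hC : ‖C‖ ≤ a) :
    ‖A * X * B - (1 / 2 : ℂ) • (C * X + X * C)‖ ≤ 2 * a * ‖X‖ := by
  have h1 : ‖A * X * B‖ ≤ a * ‖X‖ :=
    calc ‖A * X * B‖ ≤ ‖A‖ * ‖X‖ * ‖B‖ := (norm_mul_le _ _).trans (by gcongr; exact norm_mul_le _ _)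
      _ = ‖A‖ * ‖B‖ * ‖X‖ := by ring
      _ ≤ a * ‖X‖ := by gcongr
  have h2 : ‖C * X‖ ≤ a * ‖X‖ := (norm_mul_le _ _).trans (by gcongr)
  have h3 : ‖X * C‖ ≤ a * ‖X‖ := (norm_mul_le _ _).trans (by rw [mul_comm]; gcongr)
  refine (norm_sub_le _ _).trans ?_
  rw [norm_smul]
  have h4 := norm_add_le (C * X) (X * C)
  have h5 : ‖(1 / 2 : ℂ)‖ = 1 / 2 := by simp
  rw [h5]
  linarith

lemma norm_dissipator_le (A B X : Matrix n n ℂ) :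
    ‖dissipator A B X‖ ≤ 2 * (‖A‖ * ‖B‖) * ‖X‖ := by
  have hB : ‖Bᴴ‖ = ‖B‖ := Matrix.l2_opNorm_conjTranspose B
  have h := norm_lindblad_le (A := A) (B := Bᴴ) (C := Bᴴ * A) (X := X) (a := ‖A‖ * ‖B‖)
    (by rw [hB]) ((norm_mul_le _ _).trans (by rw [hB, mul_comm]))
  simpa only [dissipator, LinearMap.sub_apply, LinearMap.mulLeft_apply, LinearMap.mulRight_apply,
    LinearMap.smul_apply, LinearMap.add_apply, Module.End.mul_apply, mul_assoc] using h

lemma norm_heis_dissipator_le (A B O : Matrix n n ℂ) :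
    ‖heis (dissipator A B) O‖ ≤ 2 * (‖A‖ * ‖B‖) * ‖O‖ := by
  have hB : ‖Bᴴ‖ = ‖B‖ := Matrix.l2_opNorm_conjTranspose B
  have h := norm_lindblad_le (A := Bᴴ) (B := A) (C := Bᴴ * A) (X := O) (a := ‖A‖ * ‖B‖)
    (by rw [hB, mul_comm]) ((norm_mul_le _ _).trans (by rw [hB, mul_comm]))
  rwa [heis_dissipator, add_comm (O * (Bᴴ * A))]

lemma heis_commutator_of_commute {H O : Matrix n n ℂ} (h : Commute H O) :
    heis (commutator H) O = 0 := by
  rw [heis_commutator, h.eq, sub_self]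

lemma heis_dissipator_of_commute {A B O : Matrix n n ℂ} (hA : Commute A O) (hB : Commute Bᴴ O) :
    heis (dissipator A B) O = 0 := by
  rw [heis_dissipator, hB.eq, mul_assoc, mul_assoc, hA.eq, ← mul_assoc Bᴴ O A, hB.eq, mul_assoc]
  module

lemma trace_commutator (H X : Matrix n n ℂ) : (commutator H X).trace = 0 := by
  simp [commutator, Matrix.trace_mul_comm H X]

lemma trace_dissipator (A B X : Matrix n n ℂ) : (dissipator A B X).trace = 0 := by
  have := trace_heis_mul (dissipator A B) 1 X
  rw [heis_dissipator_of_commute (Commute.one_right _) (Commute.one_right _)] at this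
  simpa using this.symm

lemma hasDerivAt_evolve (G : Module.End ℂ (Matrix n n ℂ)) (X : Matrix n n ℂ) (t : ℝ) :
    HasDerivAt (fun s : ℝ => evolve G s X) (G (evolve G t X)) t :=
  hasDerivAt_tsum_pow (E := Matrix n n ℂ) G X t

lemma evolve_zero (G : Module.End ℂ (Matrix n n ℂ)) (X : Matrix n n ℂ) : evolve G 0 X = X :=
  tsum_pow_zero (E := Matrix n n ℂ) G X

lemma trace_evolve {G : Module.End ℂ (Matrix n n ℂ)} (hG : ∀ X, (G X).trace = 0) (t : ℝ)
    (X : Matrix n n ℂ) : (evolve G t X).trace = X.trace := by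
  have hd : ∀ s : ℝ, HasDerivAt (fun s : ℝ => (evolve G s X).trace) 0 s := by
    intro s
    have h := ((LinearMap.toContinuousLinearMap
      (Matrix.traceLinearMap n ℂ ℂ)).restrictScalars ℝ).hasFDerivAt.comp_hasDerivAt
      s (hasDerivAt_evolve G X s)
    simpa [hG, Function.comp_def] using h
  have := is_const_of_deriv_eq_zero (fun s => (hd s).differentiableAt) (fun s => (hd s).deriv) t 0
  simpa [evolve_zero] using this

omit [Fintype n] [DecidableEq n] in
lemma posSemidef_apply {Φ : Matrix n n ℂ → Matrix n n ℂ} (hΦ : IsCompletelyPositive Φ)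
    {X : Matrix n n ℂ} (hX : X.PosSemidef) : (Φ X).PosSemidef := by
  have h := hΦ 1 (X.submatrix Prod.snd Prod.snd) (hX.submatrix _)
  exact h.submatrix (fun a : n => ((0 : Fin 1), a))

/-- The generator `G` of a positive and trace preserving semigroup is dissipative in the Heisenberg
picture: on Hermitian matrices, the first-order approximation of the semigroup is a contraction up
to an error of higher order. -/
lemma exists_norm_add_heis_le {G : Module.End ℂ (Matrix n n ℂ)}
    (hpos : ∀ t : ℝ, 0 ≤ t → ∀ X : Matrix n n ℂ, X.PosSemidef → (evolve G t X).PosSemidef)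
    (htr : ∀ X, (G X).trace = 0)
    (hherm : ∀ O : Matrix n n ℂ, O.IsHermitian → (heis G O).IsHermitian) :
    ∃ ω : ℝ → ℝ, (∀ h, 0 ≤ ω h) ∧ ω =o[𝓝[≥] 0] (fun h => h) ∧
      ∀ h : ℝ, 0 ≤ h → ∀ O : Matrix n n ℂ, O.IsHermitian →
        ‖O + (h : ℂ) • heis G O‖ ≤ (1 + ω h) * ‖O‖ := by
  obtain ⟨ω, hω0, hωo, hω⟩ := exists_norm_tsum_pow_sub_le (E := Matrix n n ℂ) G
  set N : ℝ := (Fintype.card n : ℝ)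
  refine ⟨fun h => N ^ 3 * ω h, fun h => mul_nonneg (by positivity) (hω0 h),
    hωo.const_mul_left _, ?_⟩
  · intro h hh O hO
    have hY : (O + (h : ℂ) • heis G O).IsHermitian :=
      hO.add (by simp [Matrix.IsHermitian, Matrix.conjTranspose_smul, (hherm O hO).eq])
    have h0 := hω0 h
    refine norm_le_of_forall_trace hY (by positivity) fun P hP => ?_
    set R := evolve G h P - P - (h : ℂ) • G P with hR
    have hRn : ‖R‖ ≤ ω h * ‖P‖ := hω h P
    have hsplit : ((O + (h : ℂ) • heis G O) * P).trace
        = (O * evolve G h P).trace - (O * R).trace := by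
      have h1 : evolve G h P - R = P + (h : ℂ) • G P := by rw [hR]; abel
      rw [add_mul, smul_mul_assoc, Matrix.trace_add, Matrix.trace_smul, trace_heis_mul,
        ← Matrix.trace_sub, ← mul_sub, h1, mul_add, Matrix.trace_add, mul_smul_comm,
        Matrix.trace_smul]
    have h1 := norm_trace_mul_le hO (hpos h hh P hP)
    rw [trace_evolve htr] at h1
    have h2 : ‖(O * R).trace‖ ≤ N ^ 3 * ω h * ‖O‖ * P.trace.re := by
      calc _ ≤ N * ‖O * R‖ := norm_trace_le _
        _ ≤ N * (‖O‖ * (ω h * (N ^ 2 * P.trace.re))) := by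
          gcongr
          refine (norm_mul_le _ _).trans ?_
          gcongr
          exact hRn.trans (mul_le_mul_of_nonneg_left (norm_le_trace_of_posSemidef hP) h0)
        _ = _ := by ring
    rw [hsplit]
    refine (norm_sub_le _ _).trans ?_
    linarith

end Heisenberg

/-! ### Operators on one and two sites -/

section Sites

variable {S : Type*} [Fintype S] [DecidableEq S] {D : ℕ}

lemma sum_ite_agree_off_site {M : Type*} [AddCommMonoid M] (k : S) (σ : S → Fin D)
    (F : (S → Fin D) → M) :
    (∑ υ, if ∀ i, i ≠ k → σ i = υ i then F υ else 0) = ∑ a, F (Function.update σ k a) := by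
  rw [← Finset.sum_filter]
  refine (Finset.sum_nbij' (fun a => Function.update σ k a) (fun υ => υ k) ?_ ?_ ?_ ?_ ?_).symm
  · intro a _
    simp only [Finset.mem_filter, Finset.mem_univ, true_and]
    intro i hi
    rw [Function.update_of_ne hi]
  · intro υ _; simp
  · intro a _; simp
  · intro υ hυ
    simp only [Finset.mem_filter, Finset.mem_univ, true_and] at hυ
    funext i
    by_cases hi : i = k
    · subst hi; simp
    · rw [Function.update_of_ne hi, hυ i hi]
  · intro a _; rfl

lemma sum_ite_agree_off_pair {M : Type*} [AddCommMonoid M] {j k : S} (hjk : j ≠ k)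
    (σ : S → Fin D) (F : (S → Fin D) → M) :
    (∑ υ, if ∀ i, i ≠ j → i ≠ k → σ i = υ i then F υ else 0)
      = ∑ p : Fin D × Fin D, F (Function.update (Function.update σ j p.1) k p.2) := by
  rw [← Finset.sum_filter]
  refine (Finset.sum_nbij' (fun p => Function.update (Function.update σ j p.1) k p.2)
    (fun υ => (υ j, υ k)) ?_ ?_ ?_ ?_ ?_).symm
  · intro a _
    simp only [Finset.mem_filter, Finset.mem_univ, true_and]
    intro i hj hk
    rw [Function.update_of_ne hk, Function.update_of_ne hj]
  · intro υ _; simp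
  · intro a _; simp [hjk]
  · intro υ hυ
    simp only [Finset.mem_filter, Finset.mem_univ, true_and] at hυ
    funext i
    by_cases hk : i = k
    · subst hk; simp
    · rw [Function.update_of_ne hk]
      by_cases hj : i = j
      · subst hj; simp
      · rw [Function.update_of_ne hj, hυ i hj hk]
  · intro a _; rfl

lemma onSite_mul_apply (k : S) (A : Matrix (Fin D) (Fin D) ℂ) (X : Op S D) (σ τ : S → Fin D) :
    (onSite k A * X) σ τ = ∑ a, A (σ k) a * X (Function.update σ k a) τ := by
  rw [Matrix.mul_apply]
  simp only [onSite, ite_mul, zero_mul]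
  rw [sum_ite_agree_off_site k σ (fun υ => A (σ k) (υ k) * X υ τ)]
  simp

lemma mul_onSite_apply (k : S) (A : Matrix (Fin D) (Fin D) ℂ) (X : Op S D) (σ τ : S → Fin D) :
    (X * onSite k A) σ τ = ∑ a, X σ (Function.update τ k a) * A a (τ k) := by
  rw [Matrix.mul_apply]
  simp only [onSite, mul_ite, mul_zero]
  have h := sum_ite_agree_off_site k τ (fun υ => X σ υ * A (υ k) (τ k))
  simp only [Function.update_self] at h
  rw [← h]
  exact Finset.sum_congr rfl fun υ _ => if_congr
    (forall₂_congr fun i _ => eq_comm) rfl rfl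

lemma onPair_mul_apply {j k : S} (hjk : j ≠ k) (V : Matrix (Fin D × Fin D) (Fin D × Fin D) ℂ)
    (X : Op S D) (σ τ : S → Fin D) :
    (onPair j k V * X) σ τ
      = ∑ p, V (σ j, σ k) p * X (Function.update (Function.update σ j p.1) k p.2) τ := by
  rw [Matrix.mul_apply]
  simp only [onPair, ite_mul, zero_mul]
  rw [sum_ite_agree_off_pair hjk σ (fun υ => V (σ j, σ k) (υ j, υ k) * X υ τ)]
  simp [hjk]

lemma onSite_one (k : S) : onSite k (1 : Matrix (Fin D) (Fin D) ℂ) = 1 := by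
  ext σ τ
  simp only [onSite, Matrix.one_apply]
  by_cases h : σ = τ
  · subst h; simp
  · rw [if_neg h]
    split_ifs with h1 h2
    · exact absurd (funext fun i => by by_cases hi : i = k; exacts [hi ▸ h2, h1 i hi]) h
    · rfl
    · rfl

lemma onSite_mul (k : S) (A B : Matrix (Fin D) (Fin D) ℂ) :
    onSite k (A * B) = onSite k A * onSite k B := by
  ext σ τ
  rw [onSite_mul_apply]
  simp only [onSite, Matrix.mul_apply, Function.update_self]
  have : ∀ a, (∀ i, i ≠ k → Function.update σ k a i = τ i) ↔ ∀ i, i ≠ k → σ i = τ i := fun a =>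
    forall₂_congr fun i hi => by rw [Function.update_of_ne hi]
  simp only [this]
  split_ifs <;> simp

lemma onSite_add (k : S) (A B : Matrix (Fin D) (Fin D) ℂ) :
    onSite k (A + B) = onSite k A + onSite k B := by
  ext σ τ
  simp only [onSite, Matrix.add_apply]
  split_ifs <;> simp

lemma onSite_smul (k : S) (c : ℂ) (A : Matrix (Fin D) (Fin D) ℂ) :
    onSite k (c • A) = c • onSite k A := by
  ext σ τ
  simp only [onSite, Matrix.smul_apply]
  split_ifs <;> simp

lemma onSite_zero (k : S) : onSite k (0 : Matrix (Fin D) (Fin D) ℂ) = 0 := by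
  simpa using onSite_smul k 0 (0 : Matrix (Fin D) (Fin D) ℂ)

lemma conjTranspose_onSite (k : S) (A : Matrix (Fin D) (Fin D) ℂ) :
    (onSite k A)ᴴ = onSite k Aᴴ := by
  ext σ τ
  simp only [onSite, Matrix.conjTranspose_apply]
  rw [apply_ite star, star_zero]
  exact if_congr (forall₂_congr fun i _ => eq_comm) rfl rfl

/-- The embedding of the operators on the site `k`, as a homomorphism of star algebras. -/
def onSiteHom (k : S) : Matrix (Fin D) (Fin D) ℂ →⋆ₐ[ℂ] Op S D where
  toFun := onSite k
  map_one' := onSite_one k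
  map_mul' := onSite_mul k
  map_zero' := onSite_zero k
  map_add' := onSite_add k
  commutes' c := by rw [Algebra.algebraMap_eq_smul_one, onSite_smul, onSite_one,
    Algebra.algebraMap_eq_smul_one]
  map_star' A := (conjTranspose_onSite k A).symm

lemma norm_onSite_le (k : S) (A : Matrix (Fin D) (Fin D) ℂ) : ‖onSite k A‖ ≤ ‖A‖ :=
  NonUnitalStarAlgHom.norm_apply_le (onSiteHom (S := S) k) A

lemma onSite_mul_onSite {j k : S} (hjk : j ≠ k) (A B : Matrix (Fin D) (Fin D) ℂ) :
    onSite j A * onSite k B = onPair j k (A ⊗ₖ B) := by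
  ext σ τ
  rw [onSite_mul_apply]
  simp only [onSite, onPair, Matrix.kroneckerMap_apply, Function.update_of_ne hjk.symm]
  by_cases h : ∀ i, i ≠ j → i ≠ k → σ i = τ i
  · rw [if_pos h, Finset.sum_eq_single (τ j)]
    · rw [if_pos]
      intro i hi
      by_cases hij : i = j
      · subst hij; simp
      · rw [Function.update_of_ne hij, h i hij hi]
    · intro a _ ha
      rw [if_neg, mul_zero]
      intro h1
      exact ha (by simpa using h1 j hjk)
    · simp
  · rw [if_neg h]
    refine Finset.sum_eq_zero fun a _ => ?_
    rw [if_neg, mul_zero]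
    intro h1
    refine h fun i hj hk => ?_
    simpa [Function.update_of_ne hj] using h1 i hk

lemma onPair_swap (j k : S) (V : Matrix (Fin D × Fin D) (Fin D × Fin D) ℂ) :
    onPair j k (V.submatrix Prod.swap Prod.swap) = onPair k j V := by
  ext σ τ
  simp only [onPair, Matrix.submatrix_apply, Prod.swap_prod_mk]
  exact if_congr ⟨fun h i hk hj => h i hj hk, fun h i hj hk => h i hk hj⟩ rfl rfl

lemma commute_onSite {j k : S} (hjk : j ≠ k) (A B : Matrix (Fin D) (Fin D) ℂ) :
    Commute (onSite j A) (onSite k B) := by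
  rw [Commute, SemiconjBy, onSite_mul_onSite hjk, onSite_mul_onSite hjk.symm, ← onPair_swap j k]
  congr 1
  ext ⟨a, b⟩ ⟨c, d⟩
  simp [mul_comm]

lemma onPair_add (j k : S) (V W : Matrix (Fin D × Fin D) (Fin D × Fin D) ℂ) :
    onPair j k (V + W) = onPair j k V + onPair j k W := by
  ext σ τ
  simp only [onPair, Matrix.add_apply]
  split_ifs <;> simp

lemma onPair_smul (j k : S) (c : ℂ) (V : Matrix (Fin D × Fin D) (Fin D × Fin D) ℂ) :
    onPair j k (c • V) = c • onPair j k V := by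
  ext σ τ
  simp only [onPair, Matrix.smul_apply]
  split_ifs <;> simp

lemma onPair_mul {j k : S} (hjk : j ≠ k) (V W : Matrix (Fin D × Fin D) (Fin D × Fin D) ℂ) :
    onPair j k (V * W) = onPair j k V * onPair j k W := by
  ext σ τ
  rw [onPair_mul_apply hjk]
  simp only [onPair, Matrix.mul_apply, Function.update_self, Function.update_of_ne hjk]
  have : ∀ p : Fin D × Fin D, (∀ i, i ≠ j → i ≠ k →
      Function.update (Function.update σ j p.1) k p.2 i = τ i)
      ↔ ∀ i, i ≠ j → i ≠ k → σ i = τ i := fun p =>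
    forall₃_congr fun i hj hk => by rw [Function.update_of_ne hk, Function.update_of_ne hj]
  simp only [this]
  split_ifs <;> simp

lemma conjTranspose_onPair (j k : S) (V : Matrix (Fin D × Fin D) (Fin D × Fin D) ℂ) :
    (onPair j k V)ᴴ = onPair j k Vᴴ := by
  ext σ τ
  simp only [onPair, Matrix.conjTranspose_apply]
  rw [apply_ite star, star_zero]
  exact if_congr (forall₃_congr fun i _ _ => eq_comm) rfl rfl

lemma onPair_one {j k : S} (hjk : j ≠ k) :
    onPair j k (1 : Matrix (Fin D × Fin D) (Fin D × Fin D) ℂ) = 1 := by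
  rw [← Matrix.one_kronecker_one, ← onSite_mul_onSite hjk, onSite_one, onSite_one, one_mul]

lemma onPair_zero (j k : S) :
    onPair j k (0 : Matrix (Fin D × Fin D) (Fin D × Fin D) ℂ) = 0 := by
  simpa using onPair_smul j k 0 (0 : Matrix (Fin D × Fin D) (Fin D × Fin D) ℂ)

/-- The embedding of the operators on the sites `j ≠ k`, as a homomorphism of star algebras. -/
def onPairHom {j k : S} (hjk : j ≠ k) :
    Matrix (Fin D × Fin D) (Fin D × Fin D) ℂ →⋆ₐ[ℂ] Op S D where
  toFun := onPair j k
  map_one' := onPair_one hjk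
  map_mul' := onPair_mul hjk
  map_zero' := onPair_zero j k
  map_add' := onPair_add j k
  commutes' c := by rw [Algebra.algebraMap_eq_smul_one, onPair_smul, onPair_one hjk,
    Algebra.algebraMap_eq_smul_one]
  map_star' A := (conjTranspose_onPair j k A).symm

lemma norm_onPair_le {j k : S} (hjk : j ≠ k) (V : Matrix (Fin D × Fin D) (Fin D × Fin D) ℂ) :
    ‖onPair j k V‖ ≤ ‖V‖ :=
  NonUnitalStarAlgHom.norm_apply_le (onPairHom (S := S) hjk) V

lemma onSite_eq_onPair_left {j k : S} (hjk : j ≠ k) (A : Matrix (Fin D) (Fin D) ℂ) :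
    onSite j A = onPair j k (A ⊗ₖ 1) := by
  rw [← onSite_mul_onSite hjk, onSite_one, mul_one]

lemma onSite_eq_onPair_right {j k : S} (hjk : j ≠ k) (A : Matrix (Fin D) (Fin D) ℂ) :
    onSite k A = onPair j k (1 ⊗ₖ A) := by
  rw [← onSite_mul_onSite hjk, onSite_one, one_mul]

lemma single_prod (p q : Fin D × Fin D) (c : ℂ) :
    Matrix.single p q c
      = c • (Matrix.single p.1 q.1 (1 : ℂ) ⊗ₖ Matrix.single p.2 q.2 (1 : ℂ)) := by
  ext ⟨a, b⟩ ⟨a', b'⟩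
  obtain ⟨p1, p2⟩ := p
  obtain ⟨q1, q2⟩ := q
  simp only [Matrix.smul_apply, Matrix.kroneckerMap_apply, Matrix.single_apply, Prod.mk.injEq]
  by_cases h1 : p1 = a <;> by_cases h2 : p2 = b <;> by_cases h3 : q1 = a' <;>
    by_cases h4 : q2 = b' <;> simp [h1, h2, h3, h4]

lemma matrix_eq_sum_kronecker (V : Matrix (Fin D × Fin D) (Fin D × Fin D) ℂ) :
    V = ∑ p, ∑ q, V p q •
      (Matrix.single p.1 q.1 (1 : ℂ) ⊗ₖ Matrix.single p.2 q.2 (1 : ℂ)) := by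
  conv_lhs => rw [Matrix.matrix_eq_sum_single V]
  simp_rw [single_prod]

lemma commute_onPair {j k : S} (hjk : j ≠ k) (V : Matrix (Fin D × Fin D) (Fin D × Fin D) ℂ)
    {O : Op S D} (hj : ∀ A, Commute (onSite j A) O) (hk : ∀ A, Commute (onSite k A) O) :
    Commute (onPair j k V) O := by
  rw [matrix_eq_sum_kronecker V]
  change Commute (onPairHom hjk _) O
  simp only [map_sum, map_smul]
  refine Commute.sum_left _ _ _ fun p _ => Commute.sum_left _ _ _ fun q _ => Commute.smul_left ?_ _
  change Commute (onPair j k _) O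
  rw [← onSite_mul_onSite hjk]
  exact (hj _).mul_left (hk _)

/-! ### Local observables -/

/-- The observables that are localized in `Λ`: those commuting with all operators at the other
sites. -/
def localAlg (Λ : Finset S) (D : ℕ) : Subalgebra ℂ (Op S D) :=
  Subalgebra.centralizer ℂ {X | ∃ k, k ∉ Λ ∧ ∃ A, X = onSite k A}

lemma mem_localAlg {Λ : Finset S} {O : Op S D} :
    O ∈ localAlg Λ D ↔ ∀ k, k ∉ Λ → ∀ A, Commute (onSite k A) O := by
  rw [localAlg, Subalgebra.mem_centralizer_iff]
  constructor
  · intro h k hk A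
    exact h _ ⟨k, hk, A, rfl⟩
  · rintro h _ ⟨k, hk, A, rfl⟩
    exact h k hk A

lemma localAlg_mono {Λ Λ' : Finset S} (h : Λ ⊆ Λ') : localAlg Λ D ≤ localAlg Λ' D := fun _ hO =>
  mem_localAlg.2 fun k hk A => mem_localAlg.1 hO k (fun hk' => hk (h hk')) A

lemma conjTranspose_mem_localAlg {Λ : Finset S} {O : Op S D} (hO : O ∈ localAlg Λ D) :
    Oᴴ ∈ localAlg Λ D := mem_localAlg.2 fun k hk A => by
  have h := (mem_localAlg.1 hO k hk Aᴴ).star_star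
  simpa [Matrix.star_eq_conjTranspose, conjTranspose_onSite] using h

lemma onSite_mem_localAlg {Λ : Finset S} {j : S} (hj : j ∈ Λ) (A : Matrix (Fin D) (Fin D) ℂ) :
    onSite j A ∈ localAlg Λ D :=
  mem_localAlg.2 fun _ hk B => commute_onSite (ne_of_mem_of_not_mem hj hk).symm B A

lemma onPair_mem_localAlg {Λ : Finset S} {j k : S} (hjk : j ≠ k) (hj : j ∈ Λ) (hk : k ∈ Λ)
    (V : Matrix (Fin D × Fin D) (Fin D × Fin D) ℂ) : onPair j k V ∈ localAlg Λ D :=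
  mem_localAlg.2 fun _ hi B => (commute_onPair hjk V
    (fun A => commute_onSite (ne_of_mem_of_not_mem hj hi) A B)
    (fun A => commute_onSite (ne_of_mem_of_not_mem hk hi) A B)).symm

lemma heis_commutator_mem {Λ : Finset S} {H O : Op S D} (hH : H ∈ localAlg Λ D)
    (hO : O ∈ localAlg Λ D) : heis (commutator H) O ∈ localAlg Λ D := by
  rw [heis_commutator]
  exact sub_mem (mul_mem hO hH) (mul_mem hH hO)

lemma heis_dissipator_mem {Λ : Finset S} {A B O : Op S D} (hA : A ∈ localAlg Λ D)
    (hB : B ∈ localAlg Λ D) (hO : O ∈ localAlg Λ D) :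
    heis (dissipator A B) O ∈ localAlg Λ D := by
  have hB' := conjTranspose_mem_localAlg hB
  rw [heis_dissipator]
  exact sub_mem (mul_mem (mul_mem hB' hO) hA)
    (Subalgebra.smul_mem _ (add_mem (mul_mem hO (mul_mem hB' hA)) (mul_mem (mul_mem hB' hA) hO)) _)

/-- The partial trace over the site `k`, normalized so as to be a conditional expectation. -/
def averageSite (k : S) : Module.End ℂ (Op S D) :=
  ((D : ℂ)⁻¹) • ∑ a, ∑ b, LinearMap.mulLeft ℂ (onSite k (Matrix.single a b 1))
    * LinearMap.mulRight ℂ (onSite k (Matrix.single b a 1))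

lemma averageSite_apply (k : S) (O : Op S D) :
    averageSite k O = ((D : ℂ)⁻¹) • ∑ a, ∑ b,
      onSite k (Matrix.single a b 1) * O * onSite k (Matrix.single b a 1) := by
  simp [averageSite, LinearMap.sum_apply, mul_assoc]

lemma sum_onSite_single (k : S) (hD : D ≠ 0) :
    ((D : ℂ)⁻¹) • ∑ a : Fin D, ∑ b : Fin D,
      onSite k (Matrix.single a b 1) * onSite k (Matrix.single b a (1 : ℂ)) = (1 : Op S D) := by
  have h : ∀ a b : Fin D, onSite k (Matrix.single a b 1) * onSite k (Matrix.single b a (1 : ℂ))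
      = onSiteHom (S := S) k (Matrix.single a a 1) := fun a b => by
    rw [← onSite_mul, Matrix.single_mul_single_same, mul_one]; rfl
  simp only [h, Finset.sum_const, Finset.card_univ, Fintype.card_fin]
  rw [← Finset.smul_sum, ← map_sum, Matrix.sum_single_one, map_one]
  rw [← Nat.cast_smul_eq_nsmul ℂ, smul_smul, inv_mul_cancel₀ (by exact_mod_cast hD), one_smul]

lemma averageSite_of_commute {k : S} (hD : D ≠ 0) {O : Op S D}
    (h : ∀ A, Commute (onSite k A) O) : averageSite k O = O := by
  rw [averageSite_apply]
  conv_rhs => rw [← mul_one O, ← sum_onSite_single k hD]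
  rw [mul_smul_comm, Finset.mul_sum]
  simp only [Finset.mul_sum, ← mul_assoc, (h _).eq]

lemma commute_averageSite (k : S) (O : Op S D) (A : Matrix (Fin D) (Fin D) ℂ) :
    Commute (onSite k A) (averageSite k O) := by
  have key : ∀ c d : Fin D, Commute (onSiteHom (S := S) k (Matrix.single c d 1))
      (averageSite k O) := by
    intro c d
    change onSite k _ * averageSite k O = averageSite k O * onSite k _
    rw [averageSite_apply, mul_smul_comm, smul_mul_assoc]
    congr 1
    have h1 : ∀ a b : Fin D, onSite k (Matrix.single c d (1 : ℂ)) *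
        (onSite k (Matrix.single a b 1) * O * onSite k (Matrix.single b a 1))
        = if d = a then onSite k (Matrix.single c b 1) * O * onSite k (Matrix.single b d 1)
          else 0 := by
      intro a b
      rw [← mul_assoc, ← mul_assoc, ← onSite_mul]
      split_ifs with h
      · subst h; simp
      · rw [Matrix.single_mul_single_of_ne _ _ _ _ h, onSite_zero, zero_mul, zero_mul]
    have h2 : ∀ a b : Fin D, onSite k (Matrix.single a b (1 : ℂ)) * O *
        onSite k (Matrix.single b a 1) * onSite k (Matrix.single c d 1)
        = if c = a then onSite k (Matrix.single c b 1) * O * onSite k (Matrix.single b d 1)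
          else 0 := by
      intro a b
      rw [mul_assoc, ← onSite_mul]
      split_ifs with h
      · subst h; simp
      · rw [Matrix.single_mul_single_of_ne _ _ _ _ (Ne.symm h), onSite_zero, mul_zero]
    simp only [Finset.mul_sum, Finset.sum_mul, h1, h2]
    rw [Finset.sum_comm, Finset.sum_comm (s := Finset.univ) (t := Finset.univ)]
    simp
  change Commute (onSiteHom (S := S) k A) _
  rw [Matrix.matrix_eq_sum_single A]
  simp only [map_sum]
  refine Commute.sum_left _ _ _ fun c _ => Commute.sum_left _ _ _ fun d _ => ?_
  have : Matrix.single c d (A c d) = A c d • Matrix.single c d (1 : ℂ) := by simp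
  rw [this, map_smul]
  exact (key c d).smul_left _

lemma commute_averageSite_of_commute {j k : S} (hjk : j ≠ k) {O : Op S D}
    {A : Matrix (Fin D) (Fin D) ℂ} (h : Commute (onSite j A) O) :
    Commute (onSite j A) (averageSite k O) := by
  rw [averageSite_apply]
  refine Commute.smul_right (Commute.sum_right _ _ _ fun a _ => Commute.sum_right _ _ _
    fun b _ => ?_) _
  exact ((commute_onSite hjk _ _).mul_right h).mul_right (commute_onSite hjk _ _)

lemma posSemidef_averageSite (k : S) {O : Op S D} (hO : O.PosSemidef) :
    (averageSite k O).PosSemidef := by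
  rw [averageSite_apply]
  refine Matrix.PosSemidef.smul (Matrix.posSemidef_sum _ fun a _ => Matrix.posSemidef_sum _
    fun b _ => ?_) (by positivity)
  have h := hO.mul_mul_conjTranspose_same (onSite k (Matrix.single a b 1))
  rwa [conjTranspose_onSite, Matrix.conjTranspose_single, star_one] at h

/-- The conditional expectation onto the observables localized in `Λ`: it maps Hermitian operators
to Hermitian ones and does not increase their norm. -/
lemma exists_condExp (hD : D ≠ 0) (Λ : Finset S) :
    ∃ E : Module.End ℂ (Op S D), (∀ O, E O ∈ localAlg Λ D) ∧ (∀ O ∈ localAlg Λ D, E O = O) ∧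
      ∀ O : Op S D, O.IsHermitian → (E O).IsHermitian ∧ ‖E O‖ ≤ ‖O‖ := by
  -- average over the sites outside of `Λ`, one after the other
  have key : ∀ s : Finset S, ∃ E : Module.End ℂ (Op S D),
      (∀ O, ∀ k ∈ s, ∀ A, Commute (onSite k A) (E O)) ∧
      (∀ O : Op S D, (∀ k ∈ s, ∀ A, Commute (onSite k A) O) → E O = O) ∧
      ∀ O : Op S D, O.PosSemidef → (E O).PosSemidef := by
    intro s
    induction s using Finset.induction_on with
    | empty => exact ⟨1, by simp, by simp, by simp⟩
    | insert k s hk ih =>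
      obtain ⟨E, h1, h2, h3⟩ := ih
      refine ⟨averageSite k * E, fun O j hj A => ?_, fun O hO => ?_, fun O hO => ?_⟩
      · rw [Module.End.mul_apply]
        rcases Finset.mem_insert.1 hj with rfl | hj
        · exact commute_averageSite _ _ _
        · exact commute_averageSite_of_commute (ne_of_mem_of_not_mem hj hk) (h1 O j hj A)
      · rw [Module.End.mul_apply, h2 O fun j hj => hO j (Finset.mem_insert_of_mem hj),
          averageSite_of_commute hD (hO k (Finset.mem_insert_self k s))]
      · exact posSemidef_averageSite k (h3 O hO)
  obtain ⟨E, h1, h2, h3⟩ := key Λᶜ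
  have h4 : E 1 = 1 := h2 1 fun k _ A => Commute.one_right _
  refine ⟨E, fun O => mem_localAlg.2 fun k hk A => h1 O k (Finset.mem_compl.2 hk) A,
    fun O hO => h2 O fun k hk A => mem_localAlg.1 hO k (Finset.mem_compl.1 hk) A, fun O hO => ?_⟩
  have h5 := h3 _ (posSemidef_sub_of_norm_le hO le_rfl)
  have h6 := h3 _ (posSemidef_add_of_norm_le hO le_rfl)
  rw [map_sub, map_smul, h4] at h5
  rw [map_add, map_smul, h4] at h6
  refine ⟨?_, norm_le_of_posSemidef (norm_nonneg _) h5 h6⟩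
  have h7 := h6.isHermitian.sub (by simp [Matrix.IsHermitian] :
    ((‖O‖ : ℂ) • (1 : Op S D)).IsHermitian)
  rwa [add_sub_cancel_left] at h7

end Sites

/-! ### Product states -/

section States

variable {S : Type*} [Fintype S] [DecidableEq S] {D : ℕ}

/-- The product state `⨂ ρ_i` with the factors at `j` and `k` replaced by the two-site matrix `Z`. -/
def pairState (ρ : S → Matrix (Fin D) (Fin D) ℂ) (j k : S) :
    Matrix (Fin D × Fin D) (Fin D × Fin D) ℂ →ₗ[ℂ] Op S D where
  toFun Z := Matrix.of fun σ τ => Z (σ j, σ k) (τ j, τ k) *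
    ∏ i ∈ (Finset.univ.erase j).erase k, ρ i (σ i) (τ i)
  map_add' Z Z' := by ext; simp [Matrix.add_apply, add_mul]
  map_smul' c Z := by ext; simp [Matrix.smul_apply, mul_assoc]

/-- The product state `⨂ ρ_i` with the factor at `j` replaced by the matrix `Y`. -/
def siteState (ρ : S → Matrix (Fin D) (Fin D) ℂ) (j : S) :
    Matrix (Fin D) (Fin D) ℂ →ₗ[ℂ] Op S D where
  toFun Y := tensorState (Function.update ρ j Y)
  map_add' Y Y' := by
    ext σ τ
    simp only [tensorState, Matrix.add_apply]
    simp only [← Finset.mul_prod_erase _ _ (Finset.mem_univ j), Function.update_self,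
      Matrix.add_apply, add_mul]
    congr 2 <;> exact Finset.prod_congr rfl fun i hi => by
      rw [Function.update_of_ne (Finset.ne_of_mem_erase hi),
        Function.update_of_ne (Finset.ne_of_mem_erase hi)]
  map_smul' c Y := by
    ext σ τ
    simp only [tensorState, Matrix.smul_apply, RingHom.id_apply]
    simp only [← Finset.mul_prod_erase _ _ (Finset.mem_univ j), Function.update_self,
      Matrix.smul_apply, smul_mul_assoc]
    congr 2; exact Finset.prod_congr rfl fun i hi => by
      rw [Function.update_of_ne (Finset.ne_of_mem_erase hi),
        Function.update_of_ne (Finset.ne_of_mem_erase hi)]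

variable (ρ : S → Matrix (Fin D) (Fin D) ℂ)

lemma siteState_apply (j : S) (Y : Matrix (Fin D) (Fin D) ℂ) :
    siteState ρ j Y = tensorState (Function.update ρ j Y) := rfl

lemma siteState_self (j : S) : siteState ρ j (ρ j) = tensorState ρ := by
  rw [siteState_apply, Function.update_eq_self]

lemma siteState_entry (j : S) (Y : Matrix (Fin D) (Fin D) ℂ) (σ τ : S → Fin D) :
    siteState ρ j Y σ τ = Y (σ j) (τ j) * ∏ i ∈ Finset.univ.erase j, ρ i (σ i) (τ i) := by
  rw [siteState_apply, tensorState, ← Finset.mul_prod_erase _ _ (Finset.mem_univ j),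
    Function.update_self]
  congr 1
  exact Finset.prod_congr rfl fun i hi => by
    rw [Function.update_of_ne (Finset.ne_of_mem_erase hi)]

lemma onSite_mul_siteState (j : S) (A Y : Matrix (Fin D) (Fin D) ℂ) :
    onSite j A * siteState ρ j Y = siteState ρ j (A * Y) := by
  ext σ τ
  rw [onSite_mul_apply, siteState_entry, Matrix.mul_apply, Finset.sum_mul]
  refine Finset.sum_congr rfl fun a _ => ?_
  rw [siteState_entry, Function.update_self, mul_assoc]
  congr 2
  exact Finset.prod_congr rfl fun i hi => by
    rw [Function.update_of_ne (Finset.ne_of_mem_erase hi)]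

lemma siteState_mul_onSite (j : S) (A Y : Matrix (Fin D) (Fin D) ℂ) :
    siteState ρ j Y * onSite j A = siteState ρ j (Y * A) := by
  ext σ τ
  rw [mul_onSite_apply, siteState_entry, Matrix.mul_apply, Finset.sum_mul]
  refine Finset.sum_congr rfl fun a _ => ?_
  rw [siteState_entry, Function.update_self, mul_right_comm]
  congr 1
  exact Finset.prod_congr rfl fun i hi => by
    rw [Function.update_of_ne (Finset.ne_of_mem_erase hi)]

lemma pairState_kronecker {j k : S} (hjk : j ≠ k) (A B : Matrix (Fin D) (Fin D) ℂ) :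
    pairState ρ j k (A ⊗ₖ B) = siteState (Function.update ρ k B) j A := by
  ext σ τ
  rw [siteState_entry, ← Finset.mul_prod_erase _ _
    (Finset.mem_erase.2 ⟨hjk.symm, Finset.mem_univ k⟩), Function.update_self]
  simp only [pairState, LinearMap.coe_mk, AddHom.coe_mk, Matrix.of_apply,
    Matrix.kroneckerMap_apply, mul_assoc]
  congr 2
  exact Finset.prod_congr rfl fun i hi => by
    rw [Function.update_of_ne (Finset.ne_of_mem_erase hi)]

lemma pairState_self {j k : S} (hjk : j ≠ k) :
    pairState ρ j k (ρ j ⊗ₖ ρ k) = tensorState ρ := by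
  rw [pairState_kronecker ρ hjk, Function.update_eq_self, siteState_self]

lemma onPair_mul_pairState {j k : S} (hjk : j ≠ k)
    (V Z : Matrix (Fin D × Fin D) (Fin D × Fin D) ℂ) :
    onPair j k V * pairState ρ j k Z = pairState ρ j k (V * Z) := by
  ext σ τ
  rw [onPair_mul_apply hjk]
  simp only [pairState, LinearMap.coe_mk, AddHom.coe_mk, Matrix.of_apply, Matrix.mul_apply,
    Finset.sum_mul]
  refine Finset.sum_congr rfl fun a _ => ?_
  rw [Function.update_self, Function.update_of_ne hjk, Function.update_self, mul_assoc]
  congr 2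
  refine Finset.prod_congr rfl fun i hi => ?_
  obtain ⟨h1, h2⟩ := Finset.mem_erase.1 hi
  rw [Function.update_of_ne h1, Function.update_of_ne (Finset.ne_of_mem_erase h2)]

lemma conjTranspose_pairState {j k : S} (Z : Matrix (Fin D × Fin D) (Fin D × Fin D) ℂ) :
    (pairState ρ j k Z)ᴴ = pairState (fun i => (ρ i)ᴴ) j k Zᴴ := by
  ext σ τ
  simp [pairState]

lemma pairState_mul_onPair {j k : S} (hjk : j ≠ k)
    (V Z : Matrix (Fin D × Fin D) (Fin D × Fin D) ℂ) :
    pairState ρ j k Z * onPair j k V = pairState ρ j k (Z * V) := by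
  have h := congrArg Matrix.conjTranspose
    (onPair_mul_pairState (fun i => (ρ i)ᴴ) hjk Vᴴ Zᴴ)
  rw [Matrix.conjTranspose_mul, conjTranspose_pairState, conjTranspose_pairState,
    conjTranspose_onPair, Matrix.conjTranspose_mul] at h
  simpa using h

lemma trace_tensorState : (tensorState ρ).trace = ∏ i, (ρ i).trace := by
  simp only [Matrix.trace, Matrix.diag_apply, tensorState]
  rw [Finset.prod_univ_sum, Fintype.piFinset_univ]

lemma entry_eq_trace (hρ : ∀ i, (ρ i).trace = 1) (j : S) (a b : Fin D) :
    ρ j a b = (onSite j (Matrix.single b a 1) * tensorState ρ).trace := by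
  rw [← siteState_self ρ j, onSite_mul_siteState, siteState_apply, trace_tensorState,
    ← Finset.mul_prod_erase _ _ (Finset.mem_univ j), Function.update_self, Finset.prod_eq_one]
  · rw [Matrix.trace_single_mul]; simp
  · intro i hi
    rw [Function.update_of_ne (Finset.ne_of_mem_erase hi), hρ]

/-- A linear functional vanishing on commutators is a multiple of the trace. -/
lemma eq_trace_mul_of_tracial (f : Matrix (Fin D) (Fin D) ℂ →ₗ[ℂ] ℂ)
    (hf : ∀ A B, f (A * B) = f (B * A)) {C : Matrix (Fin D) (Fin D) ℂ} (hC : C.trace = 1)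
    (Y : Matrix (Fin D) (Fin D) ℂ) : f Y = Y.trace * f C := by
  have h1 : ∀ a b c : Fin D, a ≠ b → f (Matrix.single a b 1) = 0 := fun a b c hab => by
    have h := hf (Matrix.single a a 1) (Matrix.single a b 1)
    rwa [Matrix.single_mul_single_same, Matrix.single_mul_single_of_ne _ _ _ _ hab.symm, map_zero,
      mul_one] at h
  have h2 : ∀ a c : Fin D, f (Matrix.single a a 1) = f (Matrix.single c c 1) := fun a c => by
    have h := hf (Matrix.single a c 1) (Matrix.single c a 1)
    rwa [Matrix.single_mul_single_same, Matrix.single_mul_single_same, mul_one] at h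
  have h3 : ∀ (Z : Matrix (Fin D) (Fin D) ℂ) (c : Fin D),
      f Z = Z.trace * f (Matrix.single c c 1) := by
    intro Z c
    conv_lhs => rw [Matrix.matrix_eq_sum_single Z]
    simp only [map_sum]
    rw [Matrix.trace, Finset.sum_mul]
    refine Finset.sum_congr rfl fun a _ => ?_
    rw [Finset.sum_eq_single a]
    · have : Matrix.single a a (Z a a) = Z a a • Matrix.single a a (1 : ℂ) := by simp
      rw [this, map_smul, smul_eq_mul, h2 a c, Matrix.diag_apply]
    · intro b _ hb
      have : Matrix.single a b (Z a b) = Z a b • Matrix.single a b (1 : ℂ) := by simp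
      rw [this, map_smul, h1 a b a (Ne.symm hb), smul_zero]
    · simp
  rcases isEmpty_or_nonempty (Fin D) with hD | ⟨⟨c⟩⟩
  · simp [Matrix.trace] at hC
  · rw [h3 Y c, h3 C c, hC, one_mul]

lemma traceSecond_kronecker (A B : Matrix (Fin D) (Fin D) ℂ) :
    traceSecond (A ⊗ₖ B) = B.trace • A := by
  ext a b
  simp [traceSecond, Matrix.trace, ← Finset.mul_sum, mul_comm]

/-- The partial trace over the second factor as a linear map. -/
def traceSecondHom (D : ℕ) :
    Matrix (Fin D × Fin D) (Fin D × Fin D) ℂ →ₗ[ℂ] Matrix (Fin D) (Fin D) ℂ where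
  toFun := traceSecond
  map_add' Z Z' := by ext; simp [traceSecond, Finset.sum_add_distrib]
  map_smul' c Z := by ext; simp [traceSecond, Finset.mul_sum]

lemma traceSecondHom_apply (Z : Matrix (Fin D × Fin D) (Fin D × Fin D) ℂ) :
    traceSecondHom D Z = traceSecond Z := rfl

/-- Observables commuting with the operators at `k` see the factor at `k` only through its trace. -/
lemma trace_mul_siteState {k : S} {O : Op S D} (hO : ∀ A, Commute (onSite k A) O)
    {C : Matrix (Fin D) (Fin D) ℂ} (hC : C.trace = 1) (Y : Matrix (Fin D) (Fin D) ℂ) :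
    (O * siteState ρ k Y).trace = Y.trace * (O * siteState ρ k C).trace := by
  let f : Matrix (Fin D) (Fin D) ℂ →ₗ[ℂ] ℂ :=
    (Matrix.traceLinearMap _ ℂ ℂ ∘ₗ LinearMap.mulLeft ℂ O) ∘ₗ siteState ρ k
  refine eq_trace_mul_of_tracial f (fun A B => ?_) hC Y
  change (O * siteState ρ k (A * B)).trace = (O * siteState ρ k (B * A)).trace
  rw [← onSite_mul_siteState, ← siteState_mul_onSite, ← mul_assoc, ← (hO A).eq, mul_assoc,
    Matrix.trace_mul_comm, mul_assoc]

lemma trace_mul_pairState {j k : S} (hjk : j ≠ k) {O : Op S D}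
    (hO : ∀ A, Commute (onSite k A) O) (hk : (ρ k).trace = 1)
    (Z : Matrix (Fin D × Fin D) (Fin D × Fin D) ℂ) :
    (O * pairState ρ j k Z).trace = (O * siteState ρ j (traceSecond Z)).trace := by
  have hcomm : ∀ A B : Matrix (Fin D) (Fin D) ℂ,
      siteState (Function.update ρ k B) j A = siteState (Function.update ρ j A) k B := by
    intro A B
    rw [siteState_apply, siteState_apply, Function.update_comm hjk]
  have key : ∀ A B : Matrix (Fin D) (Fin D) ℂ, (O * pairState ρ j k (A ⊗ₖ B)).trace
      = (O * siteState ρ j (B.trace • A)).trace := by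
    intro A B
    rw [pairState_kronecker ρ hjk, hcomm, trace_mul_siteState _ hO hk B, ← hcomm,
      Function.update_eq_self, map_smul, mul_smul_comm, Matrix.trace_smul, smul_eq_mul]
  rw [← traceSecondHom_apply, matrix_eq_sum_kronecker Z]
  simp only [map_sum, map_smul, Finset.mul_sum, Matrix.trace_sum, mul_smul_comm,
    Matrix.trace_smul, key, traceSecondHom_apply, traceSecond_kronecker]

lemma trace_mul_tensorState_congr {Λ : Finset S} {O : Op S D} (hO : O ∈ localAlg Λ D)
    {ρ ρ' : S → Matrix (Fin D) (Fin D) ℂ} (hρ : ∀ i, i ∉ Λ → (ρ i).trace = 1)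
    (hρ' : ∀ i, i ∉ Λ → (ρ' i).trace = 1) (h : ∀ i ∈ Λ, ρ i = ρ' i) :
    (O * tensorState ρ).trace = (O * tensorState ρ').trace := by
  have key : ∀ s : Finset S, Disjoint s Λ →
      (O * tensorState ρ).trace = (O * tensorState (fun i => if i ∈ s then ρ' i else ρ i)).trace := by
    intro s
    induction s using Finset.induction_on with
    | empty => simp
    | insert k s hk ih =>
      intro hd
      rw [Finset.disjoint_insert_left] at hd
      rw [ih hd.2]
      set ρs : S → Matrix (Fin D) (Fin D) ℂ := fun i => if i ∈ s then ρ' i else ρ i with hρs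
      have h1 : (fun i => if i ∈ insert k s then ρ' i else ρ i) = Function.update ρs k (ρ' k) := by
        funext i
        by_cases hi : i = k
        · subst hi; simp
        · rw [Function.update_of_ne hi]; simp [hρs, hi]
      have h2 : ρs k = ρ k := by simp [hρs, hk]
      have h3 := trace_mul_siteState ρs (mem_localAlg.1 hO k hd.1) (hρ k hd.1) (ρ' k)
      rw [hρ' k hd.1, one_mul, ← h2, siteState_self, siteState_apply] at h3
      rw [h1, h3]
  rw [key Λᶜ disjoint_compl_left]
  congr 3
  funext i
  by_cases hi : i ∈ Λ
  · simp [hi, h i hi]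
  · simp [hi]

lemma norm_trace_mul_tensorState_le_prod (O : Op S D) :
    ‖(O * tensorState ρ).trace‖ ≤ ‖O‖ * ∏ i, entrySum (ρ i) := by
  have h1 : ∏ i, entrySum (ρ i) = ∑ σ : S → Fin D, ∑ τ : S → Fin D, ∏ i, ‖ρ i (σ i) (τ i)‖ := by
    simp only [entrySum]
    rw [Finset.prod_univ_sum, Fintype.piFinset_univ]
    refine Finset.sum_congr rfl fun σ _ => ?_
    rw [Finset.prod_univ_sum, Fintype.piFinset_univ]
  rw [Matrix.trace_mul_comm, h1, Finset.mul_sum]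
  simp only [Matrix.trace, Matrix.diag_apply, Matrix.mul_apply]
  refine (norm_sum_le _ _).trans (Finset.sum_le_sum fun σ _ => ?_)
  rw [Finset.mul_sum]
  refine (norm_sum_le _ _).trans (Finset.sum_le_sum fun τ _ => ?_)
  rw [norm_mul, mul_comm]
  refine mul_le_mul (norm_entry_le O τ σ) (le_of_eq ?_) (norm_nonneg _) (norm_nonneg _)
  simp [tensorState]

/-- The expectation value of a local observable in a product state is bounded in terms of the
factors in its support. -/
lemma norm_trace_mul_tensorState_le {Λ : Finset S} {O : Op S D} (hO : O ∈ localAlg Λ D)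
    (hρ : ∀ i, i ∉ Λ → (ρ i).trace = 1) :
    ‖(O * tensorState ρ).trace‖ ≤ ‖O‖ * ∏ i ∈ Λ, entrySum (ρ i) := by
  rcases Nat.eq_zero_or_pos D with rfl | hD
  · by_cases hΛ : ∃ i, i ∉ Λ
    · obtain ⟨i, hi⟩ := hΛ
      simpa [Matrix.trace] using hρ i hi
    · push Not at hΛ
      have : Λ = Finset.univ := Finset.eq_univ_iff_forall.2 hΛ
      subst this
      exact norm_trace_mul_tensorState_le_prod ρ O
  · -- replace the factors outside of `Λ` by rank-one projections onto a basis vector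
    set E : Matrix (Fin D) (Fin D) ℂ := Matrix.single ⟨0, hD⟩ ⟨0, hD⟩ 1 with hE
    have hE1 : entrySum E = 1 := by
      rw [entrySum, Finset.sum_eq_single ⟨0, hD⟩, Finset.sum_eq_single ⟨0, hD⟩]
      · simp [hE]
      · intro j _ hj; simp [hE, Ne.symm hj]
      · simp
      · intro i _ hi
        exact Finset.sum_eq_zero fun j _ => by simp [hE, Ne.symm hi]
      · simp
    rw [trace_mul_tensorState_congr hO (ρ' := fun i => if i ∈ Λ then ρ i else E) hρ
      (fun i hi => by simp [hi, hE]) (fun i hi => by simp [hi])]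
    refine (norm_trace_mul_tensorState_le_prod _ O).trans (le_of_eq ?_)
    have h2 : ∀ i, entrySum (if i ∈ Λ then ρ i else E) = if i ∈ Λ then entrySum (ρ i) else 1 := by
      intro i; split_ifs; exacts [rfl, hE1]
    simp only [h2, Finset.prod_ite_mem, Finset.univ_inter]

lemma norm_trace_mul_tensorState_le_pow {Λ : Finset S} {O : Op S D} (hO : O ∈ localAlg Λ D)
    (hρ : ∀ i, i ∉ Λ → (ρ i).trace = 1) {b : ℝ} (hb : ∀ i ∈ Λ, entrySum (ρ i) ≤ b) :
    ‖(O * tensorState ρ).trace‖ ≤ ‖O‖ * b ^ Λ.card := by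
  refine (norm_trace_mul_tensorState_le ρ hO hρ).trans ?_
  gcongr
  exact (Finset.prod_le_prod (fun i _ => entrySum_nonneg _) hb).trans_eq (Finset.prod_const b)

end States

/-! ### The generator as a sum of one-site and two-site maps -/

section CommutatorLinear

variable {n : Type*} [Fintype n] [DecidableEq n]

lemma commutator_add (H K : Matrix n n ℂ) : commutator (H + K) = commutator H + commutator K := by
  refine LinearMap.ext fun X => ?_
  simp [commutator, add_mul, mul_add]; abel

lemma commutator_smul (c : ℂ) (H : Matrix n n ℂ) : commutator (c • H) = c • commutator H := by
  refine LinearMap.ext fun X => ?_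
  simp [commutator, smul_sub]

/-- `commutator` as a linear map. -/
def commutatorHom : Matrix n n ℂ →ₗ[ℂ] Module.End ℂ (Matrix n n ℂ) where
  toFun := commutator
  map_add' := commutator_add
  map_smul' := commutator_smul

lemma commutatorHom_apply (H : Matrix n n ℂ) : commutatorHom H = commutator H := rfl

end CommutatorLinear

namespace Model

variable {S : Type*} [Fintype S] [DecidableEq S] {D : ℕ} {ι : Type*} [Fintype ι]
  (M : Model S D ι)

/-- The one-site generator `𝓛_j` as a map on the operators on all sites. -/
def siteSuper (j : S) : Module.End ℂ (Op S D) :=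
  (-Complex.I) • commutator (onSite j (M.h j))
    + ∑ μ, (M.κ μ j : ℂ) • dissipator (onSite j (M.jump μ)) (onSite j (M.jump μ))

/-- The diagonal part of the long-range dissipation, with prefactor `s`. -/
def selfSuper (s : ℝ) (j : S) : Module.End ℂ (Op S D) :=
  ∑ μ, ((s : ℂ) * M.w μ j j) • dissipator (onSite j (M.jump μ)) (onSite j (M.jump μ))

/-- The two-site generator `𝓛_{jk}` as a map on the operators on all sites. -/
def pairSuper (j k : S) : Module.End ℂ (Op S D) :=
  (-Complex.I / 2) • commutator (onPair j k (M.V j k) + onPair k j (M.V k j))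
    + ∑ μ, ((M.w μ j k / 2) • dissipator (onSite j (M.jump μ)) (onSite k (M.jump μ))
        + (M.w μ k j / 2) • dissipator (onSite k (M.jump μ)) (onSite j (M.jump μ)))

/-- The many-body generator with couplings `a j k` of the pairs and a prefactor `s` of the diagonal
part of the long-range dissipation. -/
def coupledGen (a : S → S → ℝ) (s : ℝ) : Module.End ℂ (Op S D) :=
  ∑ j, (M.siteSuper j + M.selfSuper s j)
    + (1 / 2 : ℂ) • ∑ j, ∑ k ∈ Finset.univ.erase j, (a j k : ℂ) • M.pairSuper j k

/-- The right-hand side of the mean-field equation with couplings `a j k`. -/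
def coupledField (a : S → S → ℝ) (ρ : S → Matrix (Fin D) (Fin D) ℂ) (j : S) :
    Matrix (Fin D) (Fin D) ℂ :=
  M.siteGen j (ρ j)
    + ∑ k ∈ Finset.univ.erase j, (a j k : ℂ) • traceSecond (M.pairGen j k (ρ j ⊗ₖ ρ k))

omit [Fintype S] in
lemma sum_erase_swap {A : Type*} [AddCommMonoid A] (s : Finset S) (f : S → S → A) :
    ∑ j ∈ s, ∑ k ∈ s.erase j, f k j = ∑ j ∈ s, ∑ k ∈ s.erase j, f j k := by
  refine Finset.sum_comm' fun x y => ?_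
  simp only [Finset.mem_erase]
  tauto

lemma sum_eq_diag_add_erase {A : Type*} [AddCommMonoid A] (f : S → S → A) :
    ∑ j, ∑ k, f j k = ∑ j, f j j + ∑ j, ∑ k ∈ Finset.univ.erase j, f j k := by
  rw [← Finset.sum_add_distrib]
  exact Finset.sum_congr rfl fun j _ => (Finset.add_sum_erase _ _ (Finset.mem_univ j)).symm

lemma sum_erase_eq_add_compl {A : Type*} [AddCommMonoid A] {Λ : Finset S} {j : S} (hj : j ∈ Λ)
    (f : S → A) : ∑ k ∈ Finset.univ.erase j, f k = ∑ k ∈ Λ.erase j, f k + ∑ k ∈ Λᶜ, f k := by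
  rw [← Finset.sum_union]
  · congr 1
    ext k
    simp only [Finset.mem_erase, Finset.mem_univ, and_true, Finset.mem_union, Finset.mem_compl]
    constructor
    · intro h; by_cases hk : k ∈ Λ <;> simp [h, hk]
    · rintro (h | h)
      · exact h.1
      · exact fun h' => h (h' ▸ hj)
  · exact Finset.disjoint_left.2 fun k hk hk' =>
      Finset.mem_compl.1 hk' (Finset.mem_of_mem_erase hk)

lemma pairSuper_comm (j k : S) : M.pairSuper j k = M.pairSuper k j := by
  simp only [pairSuper]
  congr 1
  · rw [add_comm]
  · exact Finset.sum_congr rfl fun μ _ => add_comm _ _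

lemma coupledGen_eq {a : S → S → ℝ} (ha : ∀ j k, a j k = a k j) (s : ℝ) :
    M.coupledGen a s = ∑ j, (M.siteSuper j + M.selfSuper s j)
      + ∑ j, ∑ k ∈ Finset.univ.erase j, (a j k : ℂ) •
        ((-Complex.I / 2) • commutator (onPair j k (M.V j k))
          + ∑ μ, (M.w μ j k / 2) • dissipator (onSite j (M.jump μ)) (onSite k (M.jump μ))) := by
  set F : S → S → Module.End ℂ (Op S D) := fun j k => (a j k : ℂ) •
        ((-Complex.I / 2) • commutator (onPair j k (M.V j k))
          + ∑ μ, (M.w μ j k / 2) • dissipator (onSite j (M.jump μ)) (onSite k (M.jump μ))) with hF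
  have h : ∀ j k, (a j k : ℂ) • M.pairSuper j k = F j k + F k j := by
    intro j k
    simp only [hF, pairSuper, commutator_add, Finset.sum_add_distrib, ha k j]
    module
  rw [coupledGen]
  simp only [h, Finset.sum_add_distrib]
  rw [sum_erase_swap Finset.univ F]
  congr 1
  rw [← two_smul ℂ, smul_smul, show (1 / 2 : ℂ) * 2 = 1 by norm_num, one_smul]

lemma coupledGen_apply_trace (a : S → S → ℝ) (s : ℝ) (X : Op S D) :
    (M.coupledGen a s X).trace = 0 := by
  simp [coupledGen, siteSuper, selfSuper, pairSuper, LinearMap.sum_apply, Matrix.trace_sum,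
    trace_commutator, trace_dissipator]

lemma heis_coupledGen (a : S → S → ℝ) (s : ℝ) (O : Op S D) :
    heis (M.coupledGen a s) O = ∑ j, (heis (M.siteSuper j) O + heis (M.selfSuper s j) O)
      + (1 / 2 : ℂ) • ∑ j, ∑ k ∈ Finset.univ.erase j, (a j k : ℂ) • heis (M.pairSuper j k) O := by
  simp only [coupledGen, heis_add, heis_sum, heis_smul]

lemma isHermitian_real_smul {n : Type*} {X : Matrix n n ℂ} (hX : X.IsHermitian) (r : ℝ) :
    ((r : ℂ) • X).IsHermitian := by
  simp [Matrix.IsHermitian, Matrix.conjTranspose_smul, hX.eq]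

lemma isHermitian_finset_sum {n κ : Type*} (s : Finset κ) {X : κ → Matrix n n ℂ}
    (hX : ∀ i ∈ s, (X i).IsHermitian) : (∑ i ∈ s, X i).IsHermitian := by
  rw [Matrix.IsHermitian, Matrix.conjTranspose_sum]
  exact Finset.sum_congr rfl fun i hi => hX i hi

lemma isHermitian_heis_siteSuper (j : S) {O : Op S D} (hO : O.IsHermitian) :
    (heis (M.siteSuper j) O).IsHermitian := by
  simp only [siteSuper, heis_add, heis_sum, heis_smul]
  refine Matrix.IsHermitian.add ?_ (isHermitian_finset_sum _ fun μ _ => isHermitian_real_smul ?_ _)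
  · have hH : (onSite (S := S) j (M.h j)).IsHermitian := by
      rw [Matrix.IsHermitian, conjTranspose_onSite, (M.h_herm j).eq]
    simpa using isHermitian_heis_commutator hH hO 1
  · exact conjTranspose_heis_dissipator _ _ hO

omit [Fintype S] [DecidableEq S] [Fintype ι] in
lemma star_w (μ : ι) (j k : S) : star (M.w μ j k) = M.w μ k j := (M.w_herm μ).apply k j

lemma isHermitian_heis_selfSuper (s : ℝ) (j : S) {O : Op S D} (hO : O.IsHermitian) :
    (heis (M.selfSuper s j) O).IsHermitian := by
  simp only [selfSuper, heis_sum, heis_smul]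
  refine isHermitian_finset_sum _ fun μ _ => ?_
  rw [Matrix.IsHermitian, Matrix.conjTranspose_smul, conjTranspose_heis_dissipator _ _ hO,
    star_mul', star_w]
  simp

lemma isHermitian_heis_pairSuper {j k : S} (hjk : j ≠ k) {O : Op S D} (hO : O.IsHermitian) :
    (heis (M.pairSuper j k) O).IsHermitian := by
  simp only [pairSuper, heis_add, heis_sum, heis_smul]
  refine Matrix.IsHermitian.add ?_ (isHermitian_finset_sum _ fun μ _ => ?_)
  · have hH : (onPair j k (M.V j k) + onPair k j (M.V k j)).IsHermitian := by
      rw [← onPair_swap j k, ← onPair_add, Matrix.IsHermitian, conjTranspose_onPair,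
        (M.V_herm j k hjk).eq]
    have h := isHermitian_heis_commutator hH hO (1 / 2)
    have h2 : (((1 / 2 : ℝ) : ℂ) * -Complex.I) = -Complex.I / 2 := by push_cast; ring
    rwa [h2] at h
  · rw [Matrix.IsHermitian, Matrix.conjTranspose_add, Matrix.conjTranspose_smul,
      Matrix.conjTranspose_smul, conjTranspose_heis_dissipator _ _ hO,
      conjTranspose_heis_dissipator _ _ hO, add_comm, star_div₀, star_div₀, star_w, star_w]
    simp

lemma isHermitian_heis_coupledGen (a : S → S → ℝ) (s : ℝ) {O : Op S D} (hO : O.IsHermitian) :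
    (heis (M.coupledGen a s) O).IsHermitian := by
  rw [heis_coupledGen]
  refine (isHermitian_finset_sum _ fun j _ => (M.isHermitian_heis_siteSuper j hO).add
    (M.isHermitian_heis_selfSuper s j hO)).add ?_
  have h : (1 / 2 : ℂ) = ((1 / 2 : ℝ) : ℂ) := by push_cast; rfl
  rw [h]
  exact isHermitian_real_smul (isHermitian_finset_sum _ fun j _ => isHermitian_finset_sum _
    fun k hk => isHermitian_real_smul
      (M.isHermitian_heis_pairSuper (Finset.ne_of_mem_erase hk).symm hO) _) _

lemma heis_siteSuper_mem {Λ : Finset S} {j : S} (hj : j ∈ Λ) {O : Op S D}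
    (hO : O ∈ localAlg Λ D) : heis (M.siteSuper j) O ∈ localAlg Λ D := by
  simp only [siteSuper, heis_add, heis_sum, heis_smul]
  exact add_mem (Subalgebra.smul_mem _ (heis_commutator_mem (onSite_mem_localAlg hj _) hO) _)
    (sum_mem fun μ _ => Subalgebra.smul_mem _ (heis_dissipator_mem (onSite_mem_localAlg hj _)
      (onSite_mem_localAlg hj _) hO) _)

lemma heis_selfSuper_mem {Λ : Finset S} (s : ℝ) {j : S} (hj : j ∈ Λ) {O : Op S D}
    (hO : O ∈ localAlg Λ D) : heis (M.selfSuper s j) O ∈ localAlg Λ D := by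
  simp only [selfSuper, heis_sum, heis_smul]
  exact sum_mem fun μ _ => Subalgebra.smul_mem _ (heis_dissipator_mem (onSite_mem_localAlg hj _)
      (onSite_mem_localAlg hj _) hO) _

lemma heis_pairSuper_mem {Λ : Finset S} {j k : S} (hjk : j ≠ k) (hj : j ∈ Λ) (hk : k ∈ Λ)
    {O : Op S D} (hO : O ∈ localAlg Λ D) : heis (M.pairSuper j k) O ∈ localAlg Λ D := by
  simp only [pairSuper, heis_add, heis_sum, heis_smul]
  have h1 : ∀ A, onSite j A ∈ localAlg Λ D := onSite_mem_localAlg hj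
  have h2 : ∀ A, onSite k A ∈ localAlg Λ D := onSite_mem_localAlg hk
  exact add_mem (Subalgebra.smul_mem _ (heis_commutator_mem
      (add_mem (onPair_mem_localAlg hjk hj hk _) (onPair_mem_localAlg hjk.symm hk hj _)) hO) _)
    (sum_mem fun μ _ => add_mem
      (Subalgebra.smul_mem _ (heis_dissipator_mem (h1 _) (h2 _) hO) _)
      (Subalgebra.smul_mem _ (heis_dissipator_mem (h2 _) (h1 _) hO) _))

lemma heis_siteSuper_of_notMem {Λ : Finset S} {j : S} (hj : j ∉ Λ) {O : Op S D}
    (hO : O ∈ localAlg Λ D) : heis (M.siteSuper j) O = 0 := by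
  have h := mem_localAlg.1 hO j hj
  simp only [siteSuper, heis_add, heis_sum, heis_smul]
  rw [heis_commutator_of_commute (h _), smul_zero, zero_add]
  refine Finset.sum_eq_zero fun μ _ => ?_
  rw [heis_dissipator_of_commute (h _) (by rw [conjTranspose_onSite]; exact h _), smul_zero]

lemma heis_selfSuper_of_notMem {Λ : Finset S} (s : ℝ) {j : S} (hj : j ∉ Λ) {O : Op S D}
    (hO : O ∈ localAlg Λ D) : heis (M.selfSuper s j) O = 0 := by
  have h := mem_localAlg.1 hO j hj
  simp only [selfSuper, heis_sum, heis_smul]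
  refine Finset.sum_eq_zero fun μ _ => ?_
  rw [heis_dissipator_of_commute (h _) (by rw [conjTranspose_onSite]; exact h _), smul_zero]

lemma heis_pairSuper_of_notMem {Λ : Finset S} {j k : S} (hjk : j ≠ k) (hj : j ∉ Λ) (hk : k ∉ Λ)
    {O : Op S D} (hO : O ∈ localAlg Λ D) : heis (M.pairSuper j k) O = 0 := by
  have h1 := mem_localAlg.1 hO j hj
  have h2 := mem_localAlg.1 hO k hk
  simp only [pairSuper, heis_add, heis_sum, heis_smul]
  rw [heis_commutator_of_commute ((commute_onPair hjk _ h1 h2).add_left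
    (commute_onPair hjk.symm _ h2 h1)), smul_zero, zero_add]
  refine Finset.sum_eq_zero fun μ _ => ?_
  rw [heis_dissipator_of_commute (h1 _) (by rw [conjTranspose_onSite]; exact h2 _),
    heis_dissipator_of_commute (h2 _) (by rw [conjTranspose_onSite]; exact h1 _), smul_zero,
    smul_zero, add_zero]

/-- The action of the Heisenberg generator on an observable localized in `Λ`. Only the maps that
touch `Λ` contribute, and the pairs that touch it in one site enlarge the support by one site. -/
lemma heis_coupledGen_of_mem {a : S → S → ℝ} (ha : ∀ j k, a j k = a k j) (s : ℝ) {Λ : Finset S}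
    {O : Op S D} (hO : O ∈ localAlg Λ D) :
    heis (M.coupledGen a s) O = ∑ j ∈ Λ, (heis (M.siteSuper j) O + heis (M.selfSuper s j) O)
      + (1 / 2 : ℂ) • ∑ j ∈ Λ, ∑ k ∈ Λ.erase j, (a j k : ℂ) • heis (M.pairSuper j k) O
      + ∑ j ∈ Λ, ∑ k ∈ Λᶜ, (a j k : ℂ) • heis (M.pairSuper j k) O := by
  set f : S → S → Op S D := fun j k => (a j k : ℂ) • heis (M.pairSuper j k) O with hf
  have hsymm : ∀ j k, f j k = f k j := fun j k => by rw [hf]; simp only [ha j k, M.pairSuper_comm j k]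
  have hvan : ∀ j k, j ≠ k → j ∉ Λ → k ∉ Λ → f j k = 0 := fun j k h1 h2 h3 => by
    simp only [hf]; rw [M.heis_pairSuper_of_notMem h1 h2 h3 hO, smul_zero]
  rw [heis_coupledGen]
  have h1 : ∑ j, (heis (M.siteSuper j) O + heis (M.selfSuper s j) O)
      = ∑ j ∈ Λ, (heis (M.siteSuper j) O + heis (M.selfSuper s j) O) := by
    refine (Finset.sum_subset (Finset.subset_univ Λ) fun j _ hj => ?_).symm
    rw [M.heis_siteSuper_of_notMem hj hO, M.heis_selfSuper_of_notMem s hj hO, add_zero]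
  have h2 : ∑ j, ∑ k ∈ Finset.univ.erase j, f j k
      = ∑ j ∈ Λ, ∑ k ∈ Λ.erase j, f j k + (2 : ℂ) • ∑ j ∈ Λ, ∑ k ∈ Λᶜ, f j k := by
    rw [← Finset.sum_add_sum_compl Λ]
    have hA : ∀ j ∈ Λ, ∑ k ∈ Finset.univ.erase j, f j k
        = ∑ k ∈ Λ.erase j, f j k + ∑ k ∈ Λᶜ, f j k := fun j hj => sum_erase_eq_add_compl hj _
    have hB : ∀ j ∈ Λᶜ, ∑ k ∈ Finset.univ.erase j, f j k = ∑ k ∈ Λ, f j k := by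
      intro j hj
      refine (Finset.sum_subset (fun k hk => ?_) fun k hk hk' => ?_).symm
      · exact Finset.mem_erase.2 ⟨ne_of_mem_of_not_mem hk (Finset.mem_compl.1 hj),
          Finset.mem_univ _⟩
      · exact hvan j k (Finset.ne_of_mem_erase hk).symm (Finset.mem_compl.1 hj) hk'
    rw [Finset.sum_congr rfl hA, Finset.sum_congr rfl hB, Finset.sum_add_distrib,
      Finset.sum_comm (s := Λᶜ)]
    rw [two_smul, ← add_assoc]
    congr 1
    exact Finset.sum_congr rfl fun j _ => Finset.sum_congr rfl fun k _ => hsymm k j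
  rw [h1, h2, smul_add, smul_smul, add_assoc, show (1 / 2 : ℂ) * 2 = 1 by norm_num, one_smul]

/-! ### Bounds on the couplings -/

omit [Fintype S] in
lemma norm_V_le {C : ℝ} (hC : ∀ j k, M.strength j k ≤ C) {j k : S} (hjk : j ≠ k) :
    2 * ‖M.V j k‖ ≤ C := by
  have h := hC j k
  rw [strength, if_neg hjk] at h
  have h1 : 0 ≤ ∑ μ, ‖M.w μ j k‖ * opNorm (M.jump μ) * opNorm (M.jump μ)ᴴ :=
    Finset.sum_nonneg fun μ _ => by simp only [opNorm_eq]; positivity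
  have h2 : 0 ≤ ∑ μ, ‖M.w μ k j‖ * opNorm (M.jump μ) * opNorm (M.jump μ)ᴴ :=
    Finset.sum_nonneg fun μ _ => by simp only [opNorm_eq]; positivity
  rw [opNorm_eq] at h
  linarith

omit [Fintype S] in
lemma sum_norm_w_le {C : ℝ} (hC : ∀ j k, M.strength j k ≤ C) (j k : S) :
    ∑ μ, (‖M.w μ j k‖ + ‖M.w μ k j‖) * (‖M.jump μ‖ * ‖M.jump μ‖) ≤ C := by
  have h := hC j k
  rw [strength] at h
  have h0 : 0 ≤ (if j = k then 0 else 2 * opNorm (M.V j k)) := by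
    split_ifs
    · exact le_rfl
    · rw [opNorm_eq]; positivity
  have h1 : ∑ μ, (‖M.w μ j k‖ + ‖M.w μ k j‖) * (‖M.jump μ‖ * ‖M.jump μ‖)
      = (∑ μ, ‖M.w μ j k‖ * opNorm (M.jump μ) * opNorm (M.jump μ)ᴴ)
        + ∑ μ, ‖M.w μ k j‖ * opNorm (M.jump μ) * opNorm (M.jump μ)ᴴ := by
    rw [← Finset.sum_add_distrib]
    refine Finset.sum_congr rfl fun μ _ => ?_
    rw [opNorm_eq, opNorm_eq, Matrix.l2_opNorm_conjTranspose]
    ring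
  linarith

lemma norm_heis_pairSuper_le {C : ℝ} (hC : ∀ j k, M.strength j k ≤ C) {j k : S} (hjk : j ≠ k)
    (O : Op S D) : ‖heis (M.pairSuper j k) O‖ ≤ 2 * C * ‖O‖ := by
  simp only [pairSuper, heis_add, heis_sum, heis_smul]
  have hI : ‖(-Complex.I / 2 : ℂ)‖ = 1 / 2 := by simp
  have h2 : ‖(2 : ℂ)‖ = 2 := by simp
  have hV : ‖onPair j k (M.V j k) + onPair k j (M.V k j)‖ ≤ C := by
    refine (norm_add_le _ _).trans ?_
    have h1 := norm_onPair_le hjk (M.V j k)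
    have h2 := norm_onPair_le hjk.symm (M.V k j)
    linarith [M.norm_V_le hC hjk, M.norm_V_le hC hjk.symm]
  have hdiss : ∀ (c : ℂ) (i l : S) (μ : ι),
      ‖(c / 2) • heis (dissipator (onSite i (M.jump μ)) (onSite l (M.jump μ))) O‖
        ≤ ‖c‖ * (‖M.jump μ‖ * ‖M.jump μ‖) * ‖O‖ := by
    intro c i l μ
    rw [norm_smul, norm_div, h2]
    calc _ ≤ ‖c‖ / 2 * (2 * (‖M.jump μ‖ * ‖M.jump μ‖) * ‖O‖) := by
          gcongr
          refine (norm_heis_dissipator_le _ _ _).trans ?_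
          gcongr <;> exact norm_onSite_le _ _
      _ = _ := by ring
  have h3 : ‖(-Complex.I / 2 : ℂ) • heis (commutator (onPair j k (M.V j k) + onPair k j (M.V k j))) O‖
      ≤ C * ‖O‖ := by
    rw [norm_smul, hI]
    have := norm_heis_commutator_le (onPair j k (M.V j k) + onPair k j (M.V k j)) O
    nlinarith [norm_nonneg O]
  have h4 : ‖∑ μ, ((M.w μ j k / 2) • heis (dissipator (onSite j (M.jump μ)) (onSite k (M.jump μ))) O
      + (M.w μ k j / 2) • heis (dissipator (onSite k (M.jump μ)) (onSite j (M.jump μ))) O)‖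
      ≤ C * ‖O‖ := by
    calc _ ≤ ∑ μ, (‖M.w μ j k‖ + ‖M.w μ k j‖) * (‖M.jump μ‖ * ‖M.jump μ‖) * ‖O‖ := by
          refine (norm_sum_le _ _).trans (Finset.sum_le_sum fun μ _ => ?_)
          refine (norm_add_le _ _).trans ?_
          linarith [hdiss (M.w μ j k) j k μ, hdiss (M.w μ k j) k j μ]
      _ ≤ _ := by
          rw [← Finset.sum_mul]
          exact mul_le_mul_of_nonneg_right (M.sum_norm_w_le hC j k) (norm_nonneg _)
  refine (norm_add_le _ _).trans ?_
  linarith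

lemma norm_heis_selfSuper_le {C : ℝ} (hC : ∀ j k, M.strength j k ≤ C) (s : ℝ) (j : S)
    (O : Op S D) : ‖heis (M.selfSuper s j) O‖ ≤ |s| * C * ‖O‖ := by
  simp only [selfSuper, heis_sum, heis_smul]
  calc _ ≤ ∑ μ, |s| * ((‖M.w μ j j‖ + ‖M.w μ j j‖) * (‖M.jump μ‖ * ‖M.jump μ‖)) * ‖O‖ := by
        refine (norm_sum_le _ _).trans (Finset.sum_le_sum fun μ _ => ?_)
        rw [norm_smul, norm_mul, Complex.norm_real, Real.norm_eq_abs]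
        calc _ ≤ |s| * ‖M.w μ j j‖ * (2 * (‖M.jump μ‖ * ‖M.jump μ‖) * ‖O‖) := by
              gcongr
              refine (norm_heis_dissipator_le _ _ _).trans ?_
              gcongr <;> exact norm_onSite_le _ _
          _ = _ := by ring
    _ ≤ _ := by
        rw [← Finset.sum_mul, ← Finset.mul_sum]
        have := M.sum_norm_w_le hC j j
        gcongr

omit [Fintype S] in
lemma norm_pairGen_le {C : ℝ} (hC : ∀ j k, M.strength j k ≤ C) (hD : 1 ≤ D) {j k : S}
    (hjk : j ≠ k) (X : Matrix (Fin D × Fin D) (Fin D × Fin D) ℂ) :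
    ‖M.pairGen j k X‖ ≤ 2 * (D : ℝ) ^ 8 * C * ‖X‖ := by
  have hD1 : (1 : ℝ) ≤ D := by exact_mod_cast hD
  have hC0 : 0 ≤ C := le_trans (by positivity) (M.norm_V_le hC hjk)
  have hbig : ∀ {A : Matrix (Fin D × Fin D) (Fin D × Fin D) ℂ} {c : ℝ}, (∀ p q, ‖A p q‖ ≤ c) →
      ‖A‖ ≤ (D : ℝ) ^ 4 * c := fun h => by
    refine (norm_le_entrySum _).trans ((entrySum_le_of_entry_le h).trans (le_of_eq ?_))
    simp only [Fintype.card_prod, Fintype.card_fin, Nat.cast_mul]; ring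
  have hI : ‖(-Complex.I / 2 : ℂ)‖ = 1 / 2 := by simp
  have h2 : ‖(2 : ℂ)‖ = 2 := by simp
  have hV : ‖M.V j k + (M.V k j).submatrix Prod.swap Prod.swap‖ ≤ (D : ℝ) ^ 8 * C := by
    refine (norm_add_le _ _).trans ?_
    have h1 : ‖(M.V k j).submatrix Prod.swap Prod.swap‖ ≤ (D : ℝ) ^ 4 * ‖M.V k j‖ :=
      hbig fun p q => norm_entry_le (M.V k j) p.swap q.swap
    have h3 : (D : ℝ) ^ 4 * ‖M.V k j‖ ≤ (D : ℝ) ^ 8 * (C / 2) := by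
      refine mul_le_mul (pow_le_pow_right₀ hD1 (by norm_num)) ?_ (norm_nonneg _) (by positivity)
      linarith [M.norm_V_le hC hjk.symm]
    have h4 : 1 * ‖M.V j k‖ ≤ (D : ℝ) ^ 8 * (C / 2) := by
      refine mul_le_mul (one_le_pow₀ hD1) ?_ (norm_nonneg _) (by positivity)
      linarith [M.norm_V_le hC hjk]
    linarith
  have hl : ∀ μ, ‖M.jump μ ⊗ₖ (1 : Matrix (Fin D) (Fin D) ℂ)‖ ≤ (D : ℝ) ^ 4 * ‖M.jump μ‖ := by
    refine fun μ => hbig fun p q => ?_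
    rw [Matrix.kroneckerMap_apply, norm_mul, Matrix.one_apply]
    split_ifs <;> simp [norm_entry_le]
  have hr : ∀ μ, ‖(1 : Matrix (Fin D) (Fin D) ℂ) ⊗ₖ M.jump μ‖ ≤ (D : ℝ) ^ 4 * ‖M.jump μ‖ := by
    refine fun μ => hbig fun p q => ?_
    rw [Matrix.kroneckerMap_apply, norm_mul, Matrix.one_apply]
    split_ifs <;> simp [norm_entry_le]
  have hdiss : ∀ (c : ℂ) (μ : ι) (A B : Matrix (Fin D × Fin D) (Fin D × Fin D) ℂ),
      ‖A‖ ≤ (D : ℝ) ^ 4 * ‖M.jump μ‖ → ‖B‖ ≤ (D : ℝ) ^ 4 * ‖M.jump μ‖ →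
      ‖(c / 2) • dissipator A B X‖
        ≤ (D : ℝ) ^ 8 * (‖c‖ * (‖M.jump μ‖ * ‖M.jump μ‖)) * ‖X‖ := by
    intro c μ A B hA hB
    rw [norm_smul, norm_div, h2]
    calc _ ≤ ‖c‖ / 2 * (2 * (((D : ℝ) ^ 4 * ‖M.jump μ‖) * ((D : ℝ) ^ 4 * ‖M.jump μ‖)) * ‖X‖) := by
          gcongr
          refine (norm_dissipator_le _ _ _).trans ?_
          gcongr
      _ = _ := by ring
  simp only [pairGen, LinearMap.add_apply, LinearMap.smul_apply, LinearMap.sum_apply]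
  have h3 : ‖(-Complex.I / 2 : ℂ) • commutator (M.V j k + (M.V k j).submatrix Prod.swap Prod.swap) X‖
      ≤ (D : ℝ) ^ 8 * C * ‖X‖ := by
    rw [norm_smul, hI]
    have := norm_commutator_le (M.V j k + (M.V k j).submatrix Prod.swap Prod.swap) X
    nlinarith [norm_nonneg X]
  have h4 : ‖∑ μ, ((M.w μ j k / 2) • dissipator (M.jump μ ⊗ₖ 1) (1 ⊗ₖ M.jump μ) X
      + (M.w μ k j / 2) • dissipator (1 ⊗ₖ M.jump μ) (M.jump μ ⊗ₖ 1) X)‖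
      ≤ (D : ℝ) ^ 8 * C * ‖X‖ := by
    calc _ ≤ ∑ μ, (D : ℝ) ^ 8 * ((‖M.w μ j k‖ + ‖M.w μ k j‖) * (‖M.jump μ‖ * ‖M.jump μ‖)) * ‖X‖ := by
          refine (norm_sum_le _ _).trans (Finset.sum_le_sum fun μ _ => ?_)
          refine (norm_add_le _ _).trans ?_
          linarith [hdiss (M.w μ j k) μ _ _ (hl μ) (hr μ), hdiss (M.w μ k j) μ _ _ (hr μ) (hl μ)]
      _ ≤ _ := by
          rw [← Finset.sum_mul, ← Finset.mul_sum]
          have := M.sum_norm_w_le hC j k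
          gcongr
  refine (norm_add_le _ _).trans ?_
  linarith

omit [Fintype S] [DecidableEq S] [Fintype ι] in
lemma entrySum_traceSecond_le (Z : Matrix (Fin D × Fin D) (Fin D × Fin D) ℂ) :
    entrySum (traceSecond Z) ≤ entrySum Z := by
  simp only [entrySum, traceSecond, Fintype.sum_prod_type]
  refine Finset.sum_le_sum fun a _ => ?_
  rw [Finset.sum_comm]
  calc _ ≤ ∑ b, ∑ c, ‖Z (a, c) (b, c)‖ := Finset.sum_le_sum fun b _ => norm_sum_le _ _
    _ ≤ _ := Finset.sum_le_sum fun b _ => Finset.sum_le_sum fun c _ =>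
      Finset.single_le_sum (f := fun c' => ‖Z (a, c) (b, c')‖) (fun _ _ => norm_nonneg _)
        (Finset.mem_univ c)

lemma entrySum_kronecker (A B : Matrix (Fin D) (Fin D) ℂ) :
    entrySum (A ⊗ₖ B) = entrySum A * entrySum B := by
  simp only [entrySum, Fintype.sum_prod_type, Matrix.kroneckerMap_apply, norm_mul]
  rw [Finset.sum_mul_sum]
  refine Finset.sum_congr rfl fun a _ => Finset.sum_congr rfl fun b _ => ?_
  rw [Finset.sum_mul_sum]

omit [Fintype S] in
lemma entrySum_traceSecond_pairGen_le {C : ℝ} (hC : ∀ j k, M.strength j k ≤ C) (hD : 1 ≤ D)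
    {j k : S} (hjk : j ≠ k) (A B : Matrix (Fin D) (Fin D) ℂ) :
    entrySum (traceSecond (M.pairGen j k (A ⊗ₖ B)))
      ≤ 2 * (D : ℝ) ^ 12 * C * (entrySum A * entrySum B) := by
  have hC0 : 0 ≤ C := le_trans (by positivity) (M.norm_V_le hC hjk)
  calc _ ≤ entrySum (M.pairGen j k (A ⊗ₖ B)) := entrySum_traceSecond_le _
    _ ≤ (D : ℝ) ^ 4 * ‖M.pairGen j k (A ⊗ₖ B)‖ := by
        refine (entrySum_le _).trans (le_of_eq ?_)
        simp only [Fintype.card_prod, Fintype.card_fin, Nat.cast_mul]; ring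
    _ ≤ (D : ℝ) ^ 4 * (2 * (D : ℝ) ^ 8 * C * (entrySum A * entrySum B)) := by
        gcongr
        refine (M.norm_pairGen_le hC hD hjk _).trans ?_
        gcongr
        exact (norm_le_entrySum _).trans_eq (entrySum_kronecker A B)
    _ = _ := by ring

end Model

namespace Model

/-! ### Product states approximately follow the many-body dynamics -/

variable {S : Type*} [Fintype S] [DecidableEq S] {D : ℕ} {ι : Type*} [Fintype ι]
  (M : Model S D ι)

lemma siteSuper_siteState (ρ : S → Matrix (Fin D) (Fin D) ℂ) (j : S)
    (Y : Matrix (Fin D) (Fin D) ℂ) :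
    M.siteSuper j (siteState ρ j Y) = siteState ρ j (M.siteGen j Y) := by
  simp only [siteSuper, siteGen, commutator, dissipator, LinearMap.add_apply, LinearMap.sub_apply,
    LinearMap.smul_apply, LinearMap.sum_apply, LinearMap.mulLeft_apply, LinearMap.mulRight_apply,
    Module.End.mul_apply, map_add, map_sub, map_smul, map_sum, conjTranspose_onSite,
    ← onSite_mul, onSite_mul_siteState, siteState_mul_onSite]

lemma pairSuper_pairState (ρ : S → Matrix (Fin D) (Fin D) ℂ) {j k : S} (hjk : j ≠ k)
    (Z : Matrix (Fin D × Fin D) (Fin D × Fin D) ℂ) :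
    M.pairSuper j k (pairState ρ j k Z) = pairState ρ j k (M.pairGen j k Z) := by
  rw [pairSuper, pairGen, ← onPair_swap j k, ← onPair_add]
  simp only [onSite_eq_onPair_left hjk, onSite_eq_onPair_right hjk]
  simp only [commutator, dissipator, LinearMap.add_apply, LinearMap.sub_apply,
    LinearMap.smul_apply, LinearMap.sum_apply, LinearMap.mulLeft_apply, LinearMap.mulRight_apply,
    Module.End.mul_apply, map_add, map_sub, map_smul, map_sum, conjTranspose_onPair,
    ← onPair_mul hjk, onPair_mul_pairState ρ hjk, pairState_mul_onPair ρ hjk]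

omit [Fintype S] [DecidableEq S] [Fintype ι] in
lemma trace_traceSecond (Z : Matrix (Fin D × Fin D) (Fin D × Fin D) ℂ) :
    (traceSecond Z).trace = Z.trace := by
  simp [Matrix.trace, traceSecond, Fintype.sum_prod_type]

lemma trace_coupledField (a : S → S → ℝ) (ρ : S → Matrix (Fin D) (Fin D) ℂ) (j : S) :
    (M.coupledField a ρ j).trace = 0 := by
  simp [coupledField, siteGen, pairGen, LinearMap.sum_apply, Matrix.trace_sum, trace_traceSecond,
    trace_commutator, trace_dissipator]

lemma trace_mul_siteState_le (ρ : S → Matrix (Fin D) (Fin D) ℂ) {Λ : Finset S} {O : Op S D}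
    (hO : O ∈ localAlg Λ D) (hρ : ∀ i, (ρ i).trace = 1) {b : ℝ} (hb1 : 1 ≤ b)
    (hb : ∀ i, entrySum (ρ i) ≤ b) {j : S} (hj : j ∈ Λ) (Y : Matrix (Fin D) (Fin D) ℂ) :
    ‖(O * siteState ρ j Y).trace‖ ≤ ‖O‖ * (entrySum Y * b ^ Λ.card) := by
  rw [siteState_apply]
  refine (norm_trace_mul_tensorState_le _ hO fun i hi => ?_).trans ?_
  · rw [Function.update_of_ne (ne_of_mem_of_not_mem hj hi).symm, hρ]
  · gcongr
    rw [← Finset.mul_prod_erase _ _ hj, Function.update_self]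
    refine mul_le_mul_of_nonneg_left ?_ (entrySum_nonneg _)
    calc _ ≤ ∏ i ∈ Λ.erase j, b := by
          refine Finset.prod_le_prod (fun i _ => entrySum_nonneg _) fun i hi => ?_
          rw [Function.update_of_ne (Finset.ne_of_mem_erase hi)]
          exact hb i
      _ = b ^ (Λ.erase j).card := Finset.prod_const b
      _ ≤ b ^ Λ.card := pow_le_pow_right₀ hb1 (Finset.card_le_card (Finset.erase_subset _ _))

/-- Expectation values of local observables in a product state change at the same rate under the
many-body generator and under the mean-field equation, up to the couplings within the support, the
strength of which is bounded by a small number `η`. -/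
lemma norm_trace_coupledGen_sub_le {a : S → S → ℝ} (ha : ∀ j k, a j k = a k j)
    (ha0 : ∀ j k, 0 ≤ a j k) {η s C : ℝ} (haη : ∀ j k, j ≠ k → a j k ≤ η) (hs : |s| ≤ η)
    (hC0 : 0 ≤ C) (hC : ∀ j k, M.strength j k ≤ C) (hD : 1 ≤ D)
    (ρ : S → Matrix (Fin D) (Fin D) ℂ) (hρ : ∀ i, (ρ i).trace = 1) {b : ℝ} (hb1 : 1 ≤ b)
    (hb : ∀ i, entrySum (ρ i) ≤ b) {Λ : Finset S} {O : Op S D} (hO : O ∈ localAlg Λ D) :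
    ‖(O * M.coupledGen a s (tensorState ρ)).trace
        - ∑ j, (O * siteState ρ j (M.coupledField a ρ j)).trace‖
      ≤ 3 * η * (2 * (D : ℝ) ^ 12 * C) * (Λ.card : ℝ) ^ 2 * b ^ (Λ.card + 2) * ‖O‖ := by
  set K : ℝ := 2 * (D : ℝ) ^ 12 * C with hK
  set m := Λ.card with hm
  set σ := tensorState ρ with hσ
  have hη : 0 ≤ η := (abs_nonneg s).trans hs
  have hD1 : (1 : ℝ) ≤ (D : ℝ) ^ 12 := one_le_pow₀ (by exact_mod_cast hD)
  have hCK : 2 * C ≤ K := by rw [hK]; nlinarith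
  have hK0 : 0 ≤ K := by positivity
  have hbm : (1 : ℝ) ≤ b ^ m := one_le_pow₀ hb1
  have hb2 : (1 : ℝ) ≤ b ^ 2 := one_le_pow₀ hb1
  have hlocal : ∀ Y ∈ localAlg Λ D, ‖(Y * σ).trace‖ ≤ ‖Y‖ * b ^ m := fun Y hY =>
    norm_trace_mul_tensorState_le_pow ρ hY (fun i _ => hρ i) fun i _ => hb i
  -- the contributions to the rate of change under the many-body generator
  have h1 : (O * M.coupledGen a s σ).trace
      = (∑ j ∈ Λ, (O * siteState ρ j (M.siteGen j (ρ j))).trace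
          + ∑ j ∈ Λ, (heis (M.selfSuper s j) O * σ).trace)
        + (1 / 2 : ℂ) * (∑ j ∈ Λ, ∑ k ∈ Λ.erase j,
            (a j k : ℂ) * (heis (M.pairSuper j k) O * σ).trace)
        + ∑ j ∈ Λ, ∑ k ∈ Λᶜ, (a j k : ℂ) *
            (O * siteState ρ j (traceSecond (M.pairGen j k (ρ j ⊗ₖ ρ k)))).trace := by
    rw [← trace_heis_mul, M.heis_coupledGen_of_mem ha s hO]
    simp only [add_mul, Finset.sum_mul, Matrix.trace_add, Matrix.trace_sum, smul_mul_assoc,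
      Matrix.trace_smul, smul_eq_mul, Finset.sum_add_distrib]
    refine congrArg₂ (· + ·) (congrArg₂ (· + ·) (congrArg₂ (· + ·) ?_ rfl) rfl) ?_
    · refine Finset.sum_congr rfl fun j _ => ?_
      rw [trace_heis_mul, hσ, ← siteState_self ρ j, M.siteSuper_siteState]
    · refine Finset.sum_congr rfl fun j hj => Finset.sum_congr rfl fun k hk => ?_
      have hjk : j ≠ k := ne_of_mem_of_not_mem hj (Finset.mem_compl.1 hk)
      rw [trace_heis_mul, hσ, ← pairState_self ρ hjk, M.pairSuper_pairState ρ hjk,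
        trace_mul_pairState ρ hjk (mem_localAlg.1 hO k (Finset.mem_compl.1 hk)) (hρ k)]
  -- the contributions to the rate of change under the mean-field equation
  have h2 : ∑ j, (O * siteState ρ j (M.coupledField a ρ j)).trace
      = ∑ j ∈ Λ, (O * siteState ρ j (M.siteGen j (ρ j))).trace
        + (∑ j ∈ Λ, ∑ k ∈ Λ.erase j, (a j k : ℂ) *
            (O * siteState ρ j (traceSecond (M.pairGen j k (ρ j ⊗ₖ ρ k)))).trace
          + ∑ j ∈ Λ, ∑ k ∈ Λᶜ, (a j k : ℂ) *
            (O * siteState ρ j (traceSecond (M.pairGen j k (ρ j ⊗ₖ ρ k)))).trace) := by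
    rw [← Finset.sum_add_distrib, ← Finset.sum_add_distrib]
    refine (Finset.sum_subset (Finset.subset_univ Λ) fun j _ hj => ?_).symm.trans
      (Finset.sum_congr rfl fun j hj => ?_)
    · rw [trace_mul_siteState ρ (mem_localAlg.1 hO j hj) (hρ j), trace_coupledField, zero_mul]
    · rw [coupledField, map_add, mul_add, Matrix.trace_add, ← sum_erase_eq_add_compl hj]
      simp only [map_sum, map_smul, Finset.mul_sum, mul_smul_comm, Matrix.trace_sum,
        Matrix.trace_smul, smul_eq_mul]
  have h3 : ‖∑ j ∈ Λ, (heis (M.selfSuper s j) O * σ).trace‖ ≤ m * (η * K * ‖O‖ * b ^ m) := by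
    refine (norm_sum_le _ _).trans ((Finset.sum_le_card_nsmul _ _ _ fun j hj => ?_).trans_eq
      (nsmul_eq_mul _ _))
    refine (hlocal _ (M.heis_selfSuper_mem s hj hO)).trans ?_
    gcongr
    refine (M.norm_heis_selfSuper_le hC s j O).trans ?_
    gcongr
    linarith
  have hcard : ∀ j ∈ Λ, ((Λ.erase j).card : ℝ) ≤ m := fun j _ => by
    exact_mod_cast Finset.card_le_card (Finset.erase_subset _ _)
  have hdouble : ∀ (f : S → S → ℂ) (B : ℝ), 0 ≤ B → (∀ j ∈ Λ, ∀ k ∈ Λ.erase j, ‖f j k‖ ≤ B) →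
      ‖∑ j ∈ Λ, ∑ k ∈ Λ.erase j, f j k‖ ≤ (m : ℝ) ^ 2 * B := by
    intro f B hB hf
    calc _ ≤ ∑ j ∈ Λ, (m : ℝ) * B := by
          refine (norm_sum_le _ _).trans (Finset.sum_le_sum fun j hj => ?_)
          refine (norm_sum_le _ _).trans ((Finset.sum_le_card_nsmul _ _ _ (hf j hj)).trans ?_)
          rw [nsmul_eq_mul]
          exact mul_le_mul_of_nonneg_right (hcard j hj) hB
      _ = _ := by rw [Finset.sum_const, nsmul_eq_mul]; ring
  have hnorm : ∀ j k, j ≠ k → ‖(a j k : ℂ)‖ ≤ η := fun j k hjk => by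
    rw [Complex.norm_real, Real.norm_eq_abs, abs_of_nonneg (ha0 j k)]
    exact haη j k hjk
  have h4 : ‖∑ j ∈ Λ, ∑ k ∈ Λ.erase j, (a j k : ℂ) * (heis (M.pairSuper j k) O * σ).trace‖
      ≤ (m : ℝ) ^ 2 * (η * (K * ‖O‖ * b ^ m)) := by
    refine hdouble _ _ (by positivity) fun j hj k hk => ?_
    have hjk : j ≠ k := (Finset.ne_of_mem_erase hk).symm
    rw [norm_mul]
    refine mul_le_mul (hnorm j k hjk) ?_ (norm_nonneg _) hη
    refine (hlocal _ (M.heis_pairSuper_mem hjk hj (Finset.mem_of_mem_erase hk) hO)).trans ?_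
    gcongr
    refine (M.norm_heis_pairSuper_le hC hjk O).trans ?_
    gcongr
  have h5 : ‖∑ j ∈ Λ, ∑ k ∈ Λ.erase j, (a j k : ℂ) *
      (O * siteState ρ j (traceSecond (M.pairGen j k (ρ j ⊗ₖ ρ k)))).trace‖
      ≤ (m : ℝ) ^ 2 * (η * (‖O‖ * (K * (b * b) * b ^ m))) := by
    refine hdouble _ _ (by positivity) fun j hj k hk => ?_
    have hjk : j ≠ k := (Finset.ne_of_mem_erase hk).symm
    rw [norm_mul]
    refine mul_le_mul (hnorm j k hjk) ?_ (norm_nonneg _) hη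
    refine (trace_mul_siteState_le ρ hO hρ hb1 hb hj _).trans ?_
    gcongr
    refine (M.entrySum_traceSecond_pairGen_le hC hD hjk _ _).trans ?_
    have := entrySum_nonneg (ρ k)
    gcongr
    · exact hb j
    · exact hb k
  have h6 : (O * M.coupledGen a s σ).trace - ∑ j, (O * siteState ρ j (M.coupledField a ρ j)).trace
      = ∑ j ∈ Λ, (heis (M.selfSuper s j) O * σ).trace
        + (1 / 2 : ℂ) * (∑ j ∈ Λ, ∑ k ∈ Λ.erase j,
            (a j k : ℂ) * (heis (M.pairSuper j k) O * σ).trace)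
        - ∑ j ∈ Λ, ∑ k ∈ Λ.erase j, (a j k : ℂ) *
            (O * siteState ρ j (traceSecond (M.pairGen j k (ρ j ⊗ₖ ρ k)))).trace := by
    rw [h1, h2]; ring
  rw [h6]
  refine (norm_sub_le _ _).trans ((add_le_add (norm_add_le _ _) le_rfl).trans ?_)
  rw [norm_mul, show ‖(1 / 2 : ℂ)‖ = 1 / 2 by simp]
  have hQ : 0 ≤ η * K * ‖O‖ * b ^ m := by positivity
  have hQ2 : η * K * ‖O‖ * b ^ m ≤ η * K * ‖O‖ * b ^ m * b ^ 2 := le_mul_of_one_le_right hQ hb2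
  have hm2 : (m : ℝ) ≤ (m : ℝ) ^ 2 := by
    rcases Nat.eq_zero_or_pos m with h0 | h0
    · simp [h0]
    · have : (1 : ℝ) ≤ m := by exact_mod_cast h0
      nlinarith
  have h7 : (m : ℝ) * (η * K * ‖O‖ * b ^ m) ≤ (m : ℝ) ^ 2 * (η * K * ‖O‖ * b ^ m * b ^ 2) :=
    mul_le_mul hm2 hQ2 hQ (by positivity)
  have h8 : (m : ℝ) ^ 2 * (η * K * ‖O‖ * b ^ m) ≤ (m : ℝ) ^ 2 * (η * K * ‖O‖ * b ^ m * b ^ 2) :=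
    mul_le_mul_of_nonneg_left hQ2 (by positivity)
  have h9 : 0 ≤ (m : ℝ) ^ 2 * (η * K * ‖O‖ * b ^ m) := by positivity
  calc _ ≤ m * (η * K * ‖O‖ * b ^ m) + 1 / 2 * ((m : ℝ) ^ 2 * (η * (K * ‖O‖ * b ^ m)))
        + (m : ℝ) ^ 2 * (η * (‖O‖ * (K * (b * b) * b ^ m))) := by gcongr
    _ ≤ 3 * ((m : ℝ) ^ 2 * (η * K * ‖O‖ * b ^ m * b ^ 2)) := by nlinarith
    _ = _ := by rw [pow_add]; ring

end Model

/-! ### The lattice generator -/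

section LatticeGenerator

variable {d L D : ℕ} {ι : Type*} [Fintype ι] (M : Model (Site d L) D ι) (bc : Boundary) (α : ℝ)

/-- The couplings of the pairs of sites: inverse powers of the distance with Kac normalization. -/
def coupling (bc : Boundary) (α : ℝ) {d L : ℕ} (j k : Site d L) : ℝ :=
  1 / (kac bc α d L * siteDist bc j k ^ α)

lemma siteDist_comm (j k : Site d L) : siteDist bc j k = siteDist bc k j := by
  simp only [siteDist]
  congr 1
  refine Finset.sum_congr rfl fun a _ => ?_
  cases bc <;> simp [coordDist, abs_sub_comm]

lemma coupling_comm (j k : Site d L) : coupling bc α j k = coupling bc α k j := by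
  rw [coupling, coupling, siteDist_comm]

lemma generator_eq :
    M.generator bc α = M.coupledGen (coupling bc α) (1 / (2 * kac bc α d L)) := by
  rw [Model.coupledGen_eq _ (coupling_comm bc α), Model.generator, Model.hamiltonian]
  simp only [← commutatorHom_apply, map_add, map_smul, map_sum]
  have h1 : ∑ j, ∑ k, commutatorHom (if j = k then 0 else
        ((1 / siteDist bc j k ^ α : ℝ) : ℂ) • onPair j k (M.V j k))
      = ∑ j, ∑ k ∈ Finset.univ.erase j, ((1 / siteDist bc j k ^ α : ℝ) : ℂ) •
        commutatorHom (onPair j k (M.V j k)) := by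
    rw [Model.sum_eq_diag_add_erase]
    simp only [if_true, map_zero, Finset.sum_const_zero, zero_add]
    refine Finset.sum_congr rfl fun j _ => Finset.sum_congr rfl fun k hk => ?_
    rw [if_neg (Finset.ne_of_mem_erase hk).symm, map_smul]
  have h2 : ∀ μ, ∑ j, ∑ k, M.rate bc α μ j k •
        dissipator (onSite j (M.jump μ)) (onSite k (M.jump μ))
      = ∑ j, ((M.κ μ j : ℂ) + ((1 / (2 * kac bc α d L) : ℝ) : ℂ) * M.w μ j j) •
          dissipator (onSite j (M.jump μ)) (onSite j (M.jump μ))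
        + ∑ j, ∑ k ∈ Finset.univ.erase j, ((coupling bc α j k : ℂ) * (M.w μ j k / 2)) •
          dissipator (onSite j (M.jump μ)) (onSite k (M.jump μ)) := by
    intro μ
    rw [Model.sum_eq_diag_add_erase]
    congr 1
    · refine Finset.sum_congr rfl fun j _ => ?_
      congr 1
      simp [Model.rate]
      ring
    · refine Finset.sum_congr rfl fun j _ => Finset.sum_congr rfl fun k hk => ?_
      have hjk := (Finset.ne_of_mem_erase hk).symm
      congr 1
      simp only [Model.rate, if_neg hjk, coupling]
      push_cast
      rw [zero_add, div_eq_mul_inv, div_eq_mul_inv, div_eq_mul_inv]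
      simp only [mul_inv]
      ring
  have h3 : ∑ μ, ∑ j, ∑ k, M.rate bc α μ j k •
        dissipator (onSite j (M.jump μ)) (onSite k (M.jump μ))
      = ∑ j, ∑ μ, ((M.κ μ j : ℂ) + ((1 / (2 * kac bc α d L) : ℝ) : ℂ) * M.w μ j j) •
          dissipator (onSite j (M.jump μ)) (onSite j (M.jump μ))
        + ∑ j, ∑ k ∈ Finset.univ.erase j, ∑ μ, ((coupling bc α j k : ℂ) * (M.w μ j k / 2)) •
          dissipator (onSite j (M.jump μ)) (onSite k (M.jump μ)) := by
    simp only [h2, Finset.sum_add_distrib]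
    congr 1
    · exact Finset.sum_comm
    · rw [Finset.sum_comm]
      exact Finset.sum_congr rfl fun j _ => Finset.sum_comm
  rw [h1, h3]
  simp only [Model.siteSuper, Model.selfSuper, commutatorHom_apply, smul_add,
    Finset.sum_add_distrib, Finset.smul_sum, smul_smul, add_smul]
  have h4 : ∀ j k : Site d L, -Complex.I * (((1 / (2 * kac bc α d L) : ℝ) : ℂ) *
      ((1 / siteDist bc j k ^ α : ℝ) : ℂ)) = (coupling bc α j k : ℂ) * (-Complex.I / 2) := by
    intro j k
    simp only [coupling]
    push_cast
    simp only [one_div, mul_inv]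
    ring
  simp only [h4]
  abel

end LatticeGenerator

/-! ### The norm of the marginals -/

section Marginals

variable {S : Type*} [Fintype S] [DecidableEq S] {D : ℕ}

/-- The Hermitian observables that are localized in `Λ`. -/
def localHerm (Λ : Finset S) (D : ℕ) : Submodule ℝ (Op S D) where
  carrier := {O | O.IsHermitian ∧ O ∈ localAlg Λ D}
  zero_mem' := ⟨Matrix.isHermitian_zero, zero_mem _⟩
  add_mem' h h' := ⟨h.1.add h'.1, add_mem h.2 h'.2⟩
  smul_mem' c O h := by
    rw [← Complex.coe_smul]
    exact ⟨Model.isHermitian_real_smul h.1 c, Subalgebra.smul_mem _ h.2 _⟩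

/-- The linear functional `O ↦ tr (O X)` on the Hermitian observables localized in `Λ`. It encodes
the marginal of `X` on `Λ`. -/
def marginal (Λ : Finset S) (X : Op S D) : localHerm Λ D →L[ℝ] ℂ where
  toFun O := ((O : Op S D) * X).trace
  map_add' O O' := by simp [add_mul]
  map_smul' c O := by simp [Matrix.trace_smul]
  cont := by fun_prop

/-- The norm of the marginal of `X` on `Λ`, as a functional on the Hermitian observables that are
localized in `Λ`. -/
def marginalNorm (Λ : Finset S) (D : ℕ) : Seminorm ℝ (Op S D) :=
  Seminorm.ofSMulLE (fun X => ‖marginal Λ X‖)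
    (le_antisymm (ContinuousLinearMap.opNorm_le_bound _ le_rfl fun O => by simp [marginal])
      (norm_nonneg (marginal Λ (0 : Op S D))))
    (fun X Y => by
      refine le_trans (le_of_eq ?_) (norm_add_le (marginal Λ X) (marginal Λ Y))
      congr 1
      ext O
      simp [marginal, mul_add])
    (fun c X => by
      refine ContinuousLinearMap.opNorm_le_bound _
        (mul_nonneg (norm_nonneg c) (norm_nonneg (marginal Λ X))) fun O => ?_
      have h1 : marginal Λ (c • X) O = c • marginal Λ X O := by
        simp [marginal, Matrix.trace_smul]
      rw [h1, norm_smul, mul_assoc]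
      exact mul_le_mul_of_nonneg_left ((marginal Λ X).le_opNorm O) (norm_nonneg c))

lemma marginalNorm_le {Λ : Finset S} {X : Op S D} {c : ℝ} (hc : 0 ≤ c)
    (h : ∀ O : Op S D, O.IsHermitian → O ∈ localAlg Λ D → ‖(O * X).trace‖ ≤ c * ‖O‖) :
    marginalNorm Λ D X ≤ c :=
  ContinuousLinearMap.opNorm_le_bound (marginal Λ X) hc fun O => h O.1 O.2.1 O.2.2

lemma norm_trace_mul_le_marginal {Λ : Finset S} (X : Op S D) {O : Op S D} (hO : O.IsHermitian)
    (hO' : O ∈ localAlg Λ D) : ‖(O * X).trace‖ ≤ marginalNorm Λ D X * ‖O‖ :=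
  (marginal Λ X).le_opNorm (⟨O, hO, hO'⟩ : localHerm Λ D)

lemma marginalNorm_le_mul_norm (Λ : Finset S) (X : Op S D) :
    marginalNorm Λ D X ≤ Fintype.card (S → Fin D) * ‖X‖ := by
  refine marginalNorm_le (by positivity) fun O _ _ => (norm_trace_le _).trans ?_
  calc _ ≤ (Fintype.card (S → Fin D) : ℝ) * (‖O‖ * ‖X‖) := by
        gcongr
        exact norm_mul_le O X
    _ = _ := by ring

lemma continuous_marginalNorm (Λ : Finset S) (D : ℕ) :
    Continuous fun X : Op S D => marginalNorm Λ D X := by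
  refine (LipschitzWith.of_dist_le' (K := Fintype.card (S → Fin D)) fun X Y => ?_).continuous
  rw [Real.dist_eq, dist_eq_norm]
  exact (abs_sub_map_le_sub (marginalNorm Λ D) X Y).trans (marginalNorm_le_mul_norm Λ _)

/-- Observables that are not Hermitian are controlled through their real and imaginary parts. -/
lemma norm_trace_mul_le_two_mul {Λ : Finset S} (X : Op S D) {O : Op S D}
    (hO : O ∈ localAlg Λ D) : ‖(O * X).trace‖ ≤ 2 * marginalNorm Λ D X * ‖O‖ := by
  have hO' := conjTranspose_mem_localAlg hO
  have hn : ‖Oᴴ‖ = ‖O‖ := Matrix.l2_opNorm_conjTranspose O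
  have h1 : (O + Oᴴ).IsHermitian := by simp [Matrix.IsHermitian, add_comm]
  have h2 : (Complex.I • (O - Oᴴ)).IsHermitian := by
    simp only [Matrix.IsHermitian, Matrix.conjTranspose_smul, Matrix.conjTranspose_sub,
      Matrix.conjTranspose_conjTranspose, RCLike.star_def, Complex.conj_I]
    module
  have h3 := norm_trace_mul_le_marginal X h1 (add_mem hO hO')
  have h4 := norm_trace_mul_le_marginal X h2 (Subalgebra.smul_mem _ (sub_mem hO hO') _)
  have h5 : (O * X).trace = (1 / 2 : ℂ) * ((O + Oᴴ) * X).trace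
      - (Complex.I / 2) * ((Complex.I • (O - Oᴴ)) * X).trace := by
    simp only [add_mul, sub_mul, smul_mul_assoc, Matrix.trace_add, Matrix.trace_smul,
      Matrix.trace_sub, smul_eq_mul]
    linear_combination ((O * X).trace - (Oᴴ * X).trace) / 2 * Complex.I_sq
  have h6 : ‖O + Oᴴ‖ ≤ 2 * ‖O‖ := (norm_add_le _ _).trans (by rw [hn]; linarith)
  have h7 : ‖Complex.I • (O - Oᴴ)‖ ≤ 2 * ‖O‖ := by
    rw [norm_smul, Complex.norm_I, one_mul]
    exact (norm_sub_le _ _).trans (by rw [hn]; linarith)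
  have h8 : ‖(Complex.I / 2 : ℂ)‖ = 1 / 2 := by simp
  have h9 : ‖(1 / 2 : ℂ)‖ = 1 / 2 := by simp
  have hN := apply_nonneg (marginalNorm Λ D) X
  rw [h5]
  refine (norm_sub_le _ _).trans ?_
  rw [norm_mul, norm_mul, h8, h9]
  nlinarith [mul_le_mul_of_nonneg_left h6 hN, mul_le_mul_of_nonneg_left h7 hN]

lemma marginalNorm_le_one (Λ : Finset S) {X : Op S D} (hX : X.PosSemidef) (ht : X.trace = 1) :
    marginalNorm Λ D X ≤ 1 :=
  marginalNorm_le zero_le_one fun O hO _ => by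
    simpa [ht] using norm_trace_mul_le hO hX

lemma marginalNorm_tensorState_le {ρ : S → Matrix (Fin D) (Fin D) ℂ}
    (hρ : ∀ i, (ρ i).trace = 1) {b : ℝ} (hb1 : 0 ≤ b) (hb : ∀ i, entrySum (ρ i) ≤ b)
    (Λ : Finset S) : marginalNorm Λ D (tensorState ρ) ≤ b ^ Λ.card :=
  marginalNorm_le (by positivity) fun O _ hO' => by
    rw [mul_comm]
    exact norm_trace_mul_tensorState_le_pow ρ hO' (fun i _ => hρ i) fun i _ => hb i

/-- The factors of a product state are controlled by its one-site marginals. -/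
lemma entrySum_le_marginal {ρ : S → Matrix (Fin D) (Fin D) ℂ} (hρ : ∀ i, (ρ i).trace = 1)
    (j : S) : entrySum (ρ j) ≤ 2 * (D : ℝ) ^ 2 * marginalNorm {j} D (tensorState ρ) := by
  have h : ∀ a b, ‖ρ j a b‖ ≤ 2 * marginalNorm {j} D (tensorState ρ) := fun a b => by
    rw [entry_eq_trace ρ hρ]
    refine (norm_trace_mul_le_two_mul (Λ := {j}) _
      (onSite_mem_localAlg (Finset.mem_singleton_self j) _)).trans ?_
    refine mul_le_of_le_one_right (by positivity) ((norm_onSite_le _ _).trans ?_)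
    simpa using norm_single_le b a (1 : ℂ)
  refine (entrySum_le_of_entry_le h).trans (le_of_eq ?_)
  simp only [Fintype.card_fin]
  ring

end Marginals

namespace Model

variable {S : Type*} [Fintype S] [DecidableEq S] {D : ℕ} {ι : Type*} [Fintype ι]

/-- The many-body dynamics with couplings `a j k` is positive, and the couplings have the mean-field
scaling: each of them is bounded by a small number `η`, and the couplings of one site to all others
add up to at most `A`. -/
structure MeanFieldScaling (M : Model S D ι) (a : S → S → ℝ) (s η A C : ℝ) : Prop where
  comm : ∀ j k, a j k = a k j
  nonneg : ∀ j k, 0 ≤ a j k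
  le : ∀ j k, j ≠ k → a j k ≤ η
  abs_le : |s| ≤ η
  sum_le : ∀ j, ∑ k ∈ Finset.univ.erase j, a j k ≤ A
  strength_nonneg : 0 ≤ C
  strength_le : ∀ j k, M.strength j k ≤ C
  dim_pos : 1 ≤ D
  positive : ∀ t : ℝ, 0 ≤ t → ∀ X : Op S D, X.PosSemidef →
    (evolve (M.coupledGen a s) t X).PosSemidef

variable {M : Model S D ι} {a : S → S → ℝ} {s η A C : ℝ}

/-- The hierarchy for the marginals in a differential form: up to terms of higher order, the
marginal on `Λ` can grow only by the influence of the marginals on the sets `Λ ∪ {k}`. -/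
lemma MeanFieldScaling.exists_marginalNorm_le (H : M.MeanFieldScaling a s η A C) :
    ∃ ω : ℝ → ℝ, (∀ h, 0 ≤ ω h) ∧ ω =o[𝓝[≥] 0] (fun h => h) ∧
      ∀ h : ℝ, 0 ≤ h → ∀ (Λ : Finset S) (X : Op S D) (B : ℝ), 0 ≤ B →
        (∀ k, k ∉ Λ → marginalNorm (insert k Λ) D X ≤ B) →
        marginalNorm Λ D (X + h • M.coupledGen a s X)
          ≤ (1 + ω h) * marginalNorm Λ D X + h * (Λ.card * (4 * C * A) * B) := by
  obtain ⟨ω, hω0, hωo, hω⟩ := exists_norm_add_heis_le H.positive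
    (M.coupledGen_apply_trace a s) (fun O hO => M.isHermitian_heis_coupledGen a s hO)
  refine ⟨ω, hω0, hωo, fun h hh Λ X B hB0 hB => ?_⟩
  set G := M.coupledGen a s
  obtain ⟨E, hE1, hE2, hE3⟩ := exists_condExp (S := S) (D := D)
    (Nat.one_le_iff_ne_zero.1 H.dim_pos) Λ
  have hC := H.strength_nonneg
  have hAj : ∀ j ∈ Λ, ∑ k ∈ Λᶜ, a j k ≤ A := fun j hj => by
    refine le_trans ?_ (H.sum_le j)
    rw [sum_erase_eq_add_compl hj]
    exact le_add_of_nonneg_left (Finset.sum_nonneg fun k _ => H.nonneg j k)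
  have hnn : 0 ≤ (1 + ω h) * marginalNorm Λ D X + h * (Λ.card * (4 * C * A) * B) := by
    have h1 := hω0 h
    refine add_nonneg (by positivity) (mul_nonneg hh ?_)
    rcases Λ.eq_empty_or_nonempty with rfl | ⟨j, hj⟩
    · simp
    · have hA : 0 ≤ A := (Finset.sum_nonneg fun k _ => H.nonneg j k).trans (hAj j hj)
      positivity
  refine marginalNorm_le hnn
    fun O hO hO' => ?_
  have hsum : ∑ j ∈ Λ, ∑ k ∈ Λᶜ, a j k * (4 * C * ‖O‖ * B)
      ≤ Λ.card * (4 * C * A) * B * ‖O‖ := by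
    calc _ ≤ ∑ j ∈ Λ, A * (4 * C * ‖O‖ * B) := by
          refine Finset.sum_le_sum fun j hj => ?_
          rw [← Finset.sum_mul]
          have := hAj j hj
          gcongr
      _ = _ := by rw [Finset.sum_const, nsmul_eq_mul]; ring
  have hterm : ∀ j ∈ Λ, ∀ k ∈ Λᶜ, ‖((heis (M.pairSuper j k) O - E (heis (M.pairSuper j k) O))
      * X).trace‖ ≤ 4 * C * ‖O‖ * B := by
    intro j hj k hk
    have hjk : j ≠ k := by rintro rfl; exact Finset.mem_compl.1 hk hj
    have hk' := Finset.mem_compl.1 hk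
    have hT : (heis (M.pairSuper j k) O).IsHermitian := M.isHermitian_heis_pairSuper hjk hO
    have hTm : heis (M.pairSuper j k) O ∈ localAlg (insert k Λ) D :=
      M.heis_pairSuper_mem hjk (Finset.mem_insert_of_mem hj) (Finset.mem_insert_self _ _)
        (localAlg_mono (Finset.subset_insert _ _) hO')
    have hTn := M.norm_heis_pairSuper_le H.strength_le hjk O
    have hET := hE3 _ hT
    have e1 := norm_trace_mul_le_marginal X hT hTm
    have e2 := norm_trace_mul_le_marginal X hET.1
      (localAlg_mono (Finset.subset_insert k Λ) (hE1 (heis (M.pairSuper j k) O)))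
    have hb := hB k hk'
    rw [sub_mul, Matrix.trace_sub]
    refine (norm_sub_le _ _).trans ?_
    have e3 : marginalNorm (insert k Λ) D X * ‖heis (M.pairSuper j k) O‖ ≤ B * (2 * C * ‖O‖) := by
      gcongr
    have e4 : marginalNorm (insert k Λ) D X * ‖E (heis (M.pairSuper j k) O)‖
        ≤ B * (2 * C * ‖O‖) := by
      gcongr
      exact hET.2.trans hTn
    linarith
  -- The terms that do not leave `Λ` are fixed by the conditional expectation.
  have hrest : heis G O - E (heis G O) = ∑ j ∈ Λ, ∑ k ∈ Λᶜ, (a j k : ℂ) •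
      (heis (M.pairSuper j k) O - E (heis (M.pairSuper j k) O)) := by
    have hloc := M.heis_coupledGen_of_mem H.comm s hO'
    set P : Op S D := ∑ j ∈ Λ, (heis (M.siteSuper j) O + heis (M.selfSuper s j) O)
        + (1 / 2 : ℂ) • ∑ j ∈ Λ, ∑ k ∈ Λ.erase j, (a j k : ℂ) • heis (M.pairSuper j k) O with hP
    have hPm : P ∈ localAlg Λ D := by
      refine add_mem (sum_mem fun j hj => add_mem (M.heis_siteSuper_mem hj hO')
        (M.heis_selfSuper_mem s hj hO')) (Subalgebra.smul_mem _ (sum_mem fun j hj => sum_mem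
        fun k hk => Subalgebra.smul_mem _ (M.heis_pairSuper_mem
          (Finset.ne_of_mem_erase hk).symm hj (Finset.mem_of_mem_erase hk) hO') _) _)
    have hG : heis G O = P + ∑ j ∈ Λ, ∑ k ∈ Λᶜ, (a j k : ℂ) • heis (M.pairSuper j k) O := by
      rw [hloc]
    rw [hG, map_add, hE2 P hPm]
    simp only [map_sum, map_smul, smul_sub, Finset.sum_sub_distrib]
    abel
  have hsplit : (O * (X + h • G X)).trace = ((E (O + (h : ℂ) • heis G O)) * X).trace
      + (h : ℂ) * ((heis G O - E (heis G O)) * X).trace := by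
    have h1 : (O * (X + h • G X)).trace = (O * X).trace + (h : ℂ) * (O * G X).trace := by
      rw [mul_add, Matrix.trace_add, ← Complex.coe_smul, Matrix.mul_smul, Matrix.trace_smul,
        smul_eq_mul]
    rw [h1, ← trace_heis_mul, map_add, hE2 O hO', map_smul, add_mul, Matrix.trace_add,
      smul_mul_assoc, Matrix.trace_smul, sub_mul, Matrix.trace_sub, smul_eq_mul]
    ring
  have hherm : (O + (h : ℂ) • heis G O).IsHermitian :=
    hO.add (Model.isHermitian_real_smul (M.isHermitian_heis_coupledGen a s hO) h)
  rw [hsplit]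
  refine (norm_add_le _ _).trans ?_
  have f1 : ‖((E (O + (h : ℂ) • heis G O)) * X).trace‖
      ≤ marginalNorm Λ D X * ((1 + ω h) * ‖O‖) := by
    refine (norm_trace_mul_le_marginal X (hE3 _ hherm).1 (hE1 _)).trans ?_
    gcongr
    exact (hE3 _ hherm).2.trans (hω h hh O hO)
  have f2 : ‖((heis G O - E (heis G O)) * X).trace‖ ≤ Λ.card * (4 * C * A) * B * ‖O‖ := by
    refine le_trans ?_ hsum
    rw [hrest, Finset.sum_mul, Matrix.trace_sum]
    refine (norm_sum_le _ _).trans (Finset.sum_le_sum fun j hj => ?_)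
    rw [Finset.sum_mul, Matrix.trace_sum]
    refine (norm_sum_le _ _).trans (Finset.sum_le_sum fun k hk => ?_)
    rw [smul_mul_assoc, Matrix.trace_smul, smul_eq_mul, norm_mul, Complex.norm_real,
      Real.norm_of_nonneg (H.nonneg j k)]
    exact mul_le_mul_of_nonneg_left (hterm j hj k hk) (H.nonneg j k)
  rw [norm_mul, Complex.norm_real, Real.norm_of_nonneg hh]
  have f3 := mul_le_mul_of_nonneg_left f2 hh
  nlinarith

end Model

/-! ### Growth of the marginals along a curve -/

namespace Model

variable {S : Type*} [Fintype S] [DecidableEq S] {D : ℕ} {ι : Type*} [Fintype ι]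
variable {M : Model S D ι} {a : S → S → ℝ} {s η A C : ℝ}

lemma eventually_marginalNorm_le {X : ℝ → Op S D} {X' : Op S D} {t : ℝ}
    (hX : HasDerivWithinAt X X' (Set.Ici t) t) {ε : ℝ} (hε : 0 < ε) :
    ∀ᶠ z in 𝓝[>] t, ∀ Λ : Finset S, marginalNorm Λ D (X z)
      ≤ marginalNorm Λ D (X t + (z - t) • X') + ε * (z - t) := by
  refine Filter.eventually_all.2 fun Λ => ?_
  set c : ℝ := (Fintype.card (S → Fin D) : ℝ)
  have hc : 0 < c + 1 := by positivity
  have h2 := (hasDerivWithinAt_iff_isLittleO.1 hX).def (div_pos hε hc)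
  have h3 := h2.filter_mono (nhdsWithin_mono t Set.Ioi_subset_Ici_self)
  filter_upwards [h3, self_mem_nhdsWithin] with z hz hzt
  have hzt' : 0 < z - t := sub_pos.2 hzt
  rw [Real.norm_of_nonneg hzt'.le] at hz
  have h4 : X z = (X t + (z - t) • X') + (X z - X t - (z - t) • X') := by abel
  have h5 := map_add_le_add (marginalNorm Λ D) (X t + (z - t) • X') (X z - X t - (z - t) • X')
  rw [← h4] at h5
  have h6 := marginalNorm_le_mul_norm Λ (X z - X t - (z - t) • X')
  have h7 : c * ‖X z - X t - (z - t) • X'‖ ≤ ε * (z - t) := by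
    calc _ ≤ (c + 1) * (ε / (c + 1) * (z - t)) := by gcongr; linarith
      _ = ε * (z - t) := by field_simp
  linarith

/-- Along a curve that solves the many-body equation up to an error `R`, the marginal on `Λ` grows
at most with the rate `|Λ| * 4 * C * A * B`, where `B` bounds the marginals on the sets
`Λ ∪ {k}`. -/
lemma MeanFieldScaling.eventually_marginalNorm_le (H : M.MeanFieldScaling a s η A C)
    {X : ℝ → Op S D} {R : Op S D} {t : ℝ}
    (hX : HasDerivWithinAt X (M.coupledGen a s (X t) + R) (Set.Ici t) t) {ε : ℝ} (hε : 0 < ε) :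
    ∀ᶠ z in 𝓝[>] t, ∀ (Λ : Finset S) (B : ℝ), 0 ≤ B →
      (∀ k, k ∉ Λ → marginalNorm (insert k Λ) D (X t) ≤ B) →
      marginalNorm Λ D (X z) ≤ marginalNorm Λ D (X t) + (z - t) *
        (Λ.card * (4 * C * A) * B + marginalNorm Λ D R + ε * (1 + marginalNorm Λ D (X t))) := by
  obtain ⟨ω, hω0, hωo, hω⟩ := H.exists_marginalNorm_le
  have h1 : Tendsto (fun z : ℝ => z - t) (𝓝[>] t) (𝓝[≥] 0) := by
    refine tendsto_nhdsWithin_iff.2 ⟨?_, ?_⟩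
    · have : Tendsto (fun z : ℝ => z - t) (𝓝 t) (𝓝 (t - t)) :=
        (continuous_id.sub continuous_const).tendsto t
      rw [sub_self] at this
      exact this.mono_left nhdsWithin_le_nhds
    · filter_upwards [self_mem_nhdsWithin] with z hz
      exact (sub_pos.2 (Set.mem_Ioi.1 hz)).le
  have h2 := h1.eventually (hωo.def hε)
  filter_upwards [Model.eventually_marginalNorm_le hX hε, h2, self_mem_nhdsWithin]
    with z hz hωz hzt Λ B hB0 hB
  have hzt' : 0 < z - t := sub_pos.2 hzt
  rw [Real.norm_of_nonneg hzt'.le, Real.norm_of_nonneg (hω0 _)] at hωz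
  have h3 : X t + (z - t) • (M.coupledGen a s (X t) + R)
      = (X t + (z - t) • M.coupledGen a s (X t)) + (z - t) • R := by
    rw [smul_add, add_assoc]
  have h4 := hω (z - t) hzt'.le Λ (X t) B hB0 hB
  have h5 : marginalNorm Λ D ((z - t) • R) = (z - t) * marginalNorm Λ D R := by
    rw [map_smul_eq_mul, Real.norm_of_nonneg hzt'.le]
  have h6 := hz Λ
  rw [h3] at h6
  have h7 := map_add_le_add (marginalNorm Λ D) (X t + (z - t) • M.coupledGen a s (X t))
    ((z - t) • R)
  have h8 := mul_le_mul_of_nonneg_right hωz (apply_nonneg (marginalNorm Λ D) (X t))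
  linarith

lemma norm_fun_le {κ : Type*} [Fintype κ] {x : κ → ℝ} {r : ℝ} (hr : 0 ≤ r) (hx : ∀ i, 0 ≤ x i)
    (h : ∀ i, x i ≤ r) : ‖x‖ ≤ r :=
  (pi_norm_le_iff_of_nonneg hr).2 fun i => by rw [Real.norm_of_nonneg (hx i)]; exact h i

lemma le_norm_fun {κ : Type*} [Fintype κ] (x : κ → ℝ) (i : κ) : x i ≤ ‖x‖ :=
  (Real.le_norm_self _).trans (norm_le_pi_norm x i)

lemma sq_le_two_mul_two_pow (n : ℕ) : (n : ℝ) ^ 2 ≤ 2 * 2 ^ n := by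
  induction n with
  | zero => norm_num
  | succ n ih =>
    rcases Nat.lt_or_ge n 3 with h | h
    · interval_cases n <;> norm_num
    · have : (3 : ℝ) ≤ n := by exact_mod_cast h
      rw [pow_succ (2 : ℝ)]
      push_cast
      nlinarith

lemma one_sub_pow_mul_one_add_le {u : ℝ} (hu : 0 ≤ u) (hu1 : u ≤ 1) (n : ℕ) :
    (1 - u) ^ n * (1 + n * u) ≤ 1 := by
  have h1 : 1 + n * u ≤ (1 + u) ^ n := one_add_mul_le_pow (by linarith) n
  calc (1 - u) ^ n * (1 + n * u) ≤ (1 - u) ^ n * (1 + u) ^ n :=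
        mul_le_mul_of_nonneg_left h1 (pow_nonneg (by linarith) n)
    _ = ((1 - u) * (1 + u)) ^ n := (mul_pow _ _ _).symm
    _ ≤ 1 := pow_le_one₀ (by nlinarith) (by nlinarith)

lemma slope_lt_of_le {f : ℝ → ℝ} {t z r c : ℝ} (hz : t < z) (h : f z ≤ f t + (z - t) * c)
    (hc : c < r) : slope f t z < r := by
  rw [slope_def_field, div_lt_iff₀ (sub_pos.2 hz)]
  nlinarith [sub_pos.2 hz]

/-- The weighted supremum `max_Λ z ^ |Λ| * marginalNorm Λ X` of the marginals grows slowly, if the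
weight `z` decreases with a speed that compensates the coupling of the marginal on `Λ` to the
marginals on `Λ ∪ {k}`. -/
lemma MeanFieldScaling.marginalNorm_le_of_hierarchy (H : M.MeanFieldScaling a s η A C)
    {X R : ℝ → Op S D} {t₀ τ z₀ κ δ F₀ b : ℝ} (hκ : 0 < κ) (hκ' : 4 * C * A ≤ κ)
    (hb : 1 ≤ b) (hz₀ : z₀ = 1 / (2 * b)) (hτz : 2 * κ * τ ≤ z₀) (hδ : 0 ≤ δ)
    (hX : ∀ t ∈ Set.Ico t₀ (t₀ + τ),
      HasDerivWithinAt X (M.coupledGen a s (X t) + R t) (Set.Ici t) t)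
    (hXc : ContinuousOn X (Set.Icc t₀ (t₀ + τ)))
    (hR : ∀ t ∈ Set.Ico t₀ (t₀ + τ), ∀ Λ : Finset S,
      marginalNorm Λ D (R t) ≤ δ * Λ.card ^ 2 * b ^ Λ.card)
    (hF₀ : 0 ≤ F₀) (hX₀ : ∀ Λ : Finset S, z₀ ^ Λ.card * marginalNorm Λ D (X t₀) ≤ F₀) :
    ∀ t ∈ Set.Icc t₀ (t₀ + τ), ∀ Λ : Finset S,
      (z₀ / 2) ^ Λ.card * marginalNorm Λ D (X t) ≤ F₀ + 2 * δ * τ := by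
  have hz₀' : 0 < z₀ := by rw [hz₀]; positivity
  have hz₁ : z₀ ≤ 1 := by
    rw [hz₀, div_le_one (by positivity)]
    linarith
  set ζ : ℝ → ℝ := fun t => z₀ - κ * (t - t₀) with hζ
  have hζl : ∀ t ∈ Set.Icc t₀ (t₀ + τ), z₀ / 2 ≤ ζ t := by
    intro t ht
    have : t - t₀ ≤ τ := by linarith [ht.2]
    simp only [hζ]
    nlinarith
  have hζu : ∀ t ∈ Set.Icc t₀ (t₀ + τ), ζ t ≤ z₀ := by
    intro t ht
    have : 0 ≤ t - t₀ := by linarith [ht.1]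
    simp only [hζ]
    nlinarith
  set x : ℝ → Finset S → ℝ := fun t Λ => ζ t ^ Λ.card * marginalNorm Λ D (X t) with hx
  set f : ℝ → ℝ := fun t => ‖x t‖ with hf
  have hfc : ContinuousOn f (Set.Icc t₀ (t₀ + τ)) := by
    refine ContinuousOn.norm (continuousOn_pi.2 fun Λ => ?_)
    refine ContinuousOn.mul (by fun_prop) ?_
    exact (continuous_marginalNorm Λ D).comp_continuousOn hXc
  have hf' : ∀ t ∈ Set.Ico t₀ (t₀ + τ), ∀ r, 2 * δ < r →
      ∃ᶠ z in 𝓝[>] t, slope f t z < r := by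
    intro t ht r hr
    have ht' : t ∈ Set.Icc t₀ (t₀ + τ) := Set.Ico_subset_Icc_self ht
    have hft : 0 ≤ f t := norm_nonneg _
    have hε : 0 < (r - 2 * δ) / (2 * (1 + f t)) := by
      have : 0 < r - 2 * δ := by linarith
      positivity
    set ε := (r - 2 * δ) / (2 * (1 + f t)) with hεd
    have hεf : ε * (1 + f t) = (r - 2 * δ) / 2 := by
      rw [hεd]; field_simp
    have hzt0 : 0 < ζ t := lt_of_lt_of_le (by positivity) (hζl t ht')
    have hsmall : ∀ᶠ z in 𝓝[>] t, z < t + ζ t / κ := by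
      have : t < t + ζ t / κ := by have := div_pos hzt0 hκ; linarith
      exact nhdsWithin_le_nhds (Iio_mem_nhds this)
    refine Eventually.frequently ?_
    filter_upwards [H.eventually_marginalNorm_le (hX t ht) hε, hsmall, self_mem_nhdsWithin]
      with z hz hzs hzt
    have hzt' : 0 < z - t := sub_pos.2 hzt
    set u := κ * (z - t) / ζ t with hu
    have hu0 : 0 ≤ u := by positivity
    have hu1 : u ≤ 1 := by
      rw [hu, div_le_one hzt0]
      have : z - t < ζ t / κ := by linarith
      rw [lt_div_iff₀ hκ] at this
      linarith
    have hζz : ζ z = ζ t * (1 - u) := by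
      rw [hu, mul_sub, mul_div_cancel₀ _ hzt0.ne']
      simp only [hζ]
      ring
    have h1u : 0 ≤ 1 - u := by linarith
    have hζz0 : 0 ≤ ζ z := by rw [hζz]; positivity
    refine slope_lt_of_le (c := 2 * δ + ε * (1 + f t)) hzt ?_ (by rw [hεf]; linarith)
    refine norm_fun_le (by positivity) (fun Λ => mul_nonneg (pow_nonneg hζz0 _)
      (apply_nonneg (marginalNorm Λ D) (X z))) fun Λ => ?_
    set n := Λ.card with hn
    have hm : ∀ Λ' : Finset S, marginalNorm Λ' D (X t) ≤ f t / ζ t ^ Λ'.card := by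
      intro Λ'
      rw [le_div_iff₀ (by positivity), mul_comm]
      exact le_norm_fun (x t) Λ'
    have hz1 := hz Λ (f t / ζ t ^ (n + 1)) (by positivity) fun k hk => by
      have := hm (insert k Λ)
      rwa [Finset.card_insert_of_notMem hk] at this
    have hmΛ := hm Λ
    set m := marginalNorm Λ D (X t) with hmd
    have hR' := hR t ht Λ
    set e := marginalNorm Λ D (R t) with he
    have hm0 : 0 ≤ m := apply_nonneg (marginalNorm Λ D) (X t)
    have he0 : 0 ≤ e := apply_nonneg (marginalNorm Λ D) (R t)
    have hpow : ζ z ^ n = (1 - u) ^ n * ζ t ^ n := by rw [hζz, mul_pow, mul_comm]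
    have hp1 : (1 - u) ^ n ≤ 1 := pow_le_one₀ h1u (by linarith)
    have hp0 : 0 ≤ (1 - u) ^ n := pow_nonneg h1u n
    have hq0 : 0 < ζ t ^ n := by positivity
    have hq1 : ζ t ^ n ≤ 1 := pow_le_one₀ hzt0.le ((hζu t ht').trans hz₁)
    have hmf : ζ t ^ n * m ≤ f t := le_norm_fun (x t) Λ
    -- Since `ζ t * b ≤ 1 / 2`, the weight beats the exponential growth of the residual in `n`.
    have hef : ζ t ^ n * e ≤ 2 * δ := by
      have h1 : ζ t * b ≤ 1 / 2 := by
        calc ζ t * b ≤ z₀ * b := by have := hζu t ht'; gcongr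
          _ = 1 / 2 := by rw [hz₀]; field_simp
      have h2 : (ζ t * b) ^ n ≤ (1 / 2) ^ n := pow_le_pow_left₀ (by positivity) h1 n
      calc ζ t ^ n * e ≤ ζ t ^ n * (δ * n ^ 2 * b ^ n) := by gcongr
        _ = δ * n ^ 2 * (ζ t * b) ^ n := by rw [mul_pow]; ring
        _ ≤ δ * (2 * 2 ^ n) * (1 / 2) ^ n := by
            have := sq_le_two_mul_two_pow n
            gcongr
        _ = 2 * δ * (2 * (1 / 2)) ^ n := by rw [mul_pow]; ring
        _ = 2 * δ := by norm_num
    -- The coupling produces a factor `1 + n * u`, and the decrease of the weight a factor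
    -- `(1 - u) ^ n`; their product is at most one.
    calc ζ z ^ n * marginalNorm Λ D (X z)
        ≤ ζ z ^ n * (m + (z - t) * (n * (4 * C * A) * (f t / ζ t ^ (n + 1)) + e
            + ε * (1 + m))) := by gcongr
      _ ≤ ζ z ^ n * (m + (z - t) * (n * κ * (f t / ζ t ^ (n + 1)) + e
            + ε * (1 + m))) := by gcongr
      _ = (1 - u) ^ n * (ζ t ^ n * m + n * (κ * (z - t) / ζ t) * f t
            + (z - t) * (ζ t ^ n * e + ε * (ζ t ^ n + ζ t ^ n * m))) := by
          rw [hpow]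
          field_simp
          ring
      _ ≤ (1 - u) ^ n * (f t + n * u * f t + (z - t) * (2 * δ + ε * (1 + f t))) := by
          gcongr
      _ = (1 - u) ^ n * (1 + n * u) * f t
            + (1 - u) ^ n * ((z - t) * (2 * δ + ε * (1 + f t))) := by ring
      _ ≤ 1 * f t + 1 * ((z - t) * (2 * δ + ε * (1 + f t))) := by
          gcongr
          exact one_sub_pow_mul_one_add_le hu0 hu1 n
      _ = f t + (z - t) * (2 * δ + ε * (1 + f t)) := by ring
  have hfence := image_le_of_liminf_slope_right_le_deriv_boundary (f := f) (a := t₀)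
    (b := t₀ + τ) hfc (B := fun t => F₀ + 2 * δ * (t - t₀)) (B' := fun _ => 2 * δ) (by
      have : f t₀ ≤ F₀ := norm_fun_le hF₀ (fun Λ => mul_nonneg (pow_nonneg (by simp [hζ, hz₀'.le])
        _) (apply_nonneg (marginalNorm Λ D) (X t₀))) fun Λ => by simpa [hx, hζ] using hX₀ Λ
      simpa using this) (by fun_prop) (fun t _ => by
      have h1 : HasDerivAt (fun t : ℝ => F₀ + 2 * δ * (t - t₀)) (2 * δ * 1) t :=
        (((hasDerivAt_id t).sub_const t₀).const_mul (2 * δ)).const_add F₀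
      simpa using h1.hasDerivWithinAt) hf'
  intro t ht Λ
  have h1 := hfence ht
  have h2 : ζ t ^ Λ.card * marginalNorm Λ D (X t) ≤ f t := le_norm_fun (x t) Λ
  have h3 : (z₀ / 2) ^ Λ.card ≤ ζ t ^ Λ.card := pow_le_pow_left₀ (by positivity) (hζl t ht) _
  have h4 := mul_le_mul_of_nonneg_right h3 (apply_nonneg (marginalNorm Λ D) (X t))
  have h5 : t - t₀ ≤ τ := by linarith [ht.2]
  have h6 := mul_le_mul_of_nonneg_left h5 (by positivity : 0 ≤ 2 * δ)
  linarith

end Model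

/-! ### The product curve of a mean-field solution -/

section ProductCurve

variable {S : Type*} [Fintype S] [DecidableEq S] {D : ℕ}

/-- The tensor product as a multilinear function of its factors. -/
def tensorMultilinear (S : Type*) [Fintype S] [DecidableEq S] (D : ℕ) :
    MultilinearMap ℝ (fun _ : S => Matrix (Fin D) (Fin D) ℂ) (Op S D) :=
  MultilinearMap.mk' tensorState (fun ρ j X Y => map_add (siteState ρ j) X Y)
    fun ρ j c X => map_smul (siteState ρ j) (c : ℂ) X

omit [DecidableEq S] in
lemma continuous_tensorState :
    Continuous (tensorState : (S → Matrix (Fin D) (Fin D) ℂ) → Op S D) := by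
  refine continuous_matrix fun σ τ => continuous_finsetProd _ fun j _ => ?_
  exact (continuous_apply j).matrix_elem (σ j) (τ j)

lemma hasDerivWithinAt_tensorState {ρ : S → ℝ → Matrix (Fin D) (Fin D) ℂ}
    {ρ' : S → Matrix (Fin D) (Fin D) ℂ} {s : Set ℝ} {t : ℝ}
    (h : ∀ j, HasDerivWithinAt (ρ j) (ρ' j) s t) :
    HasDerivWithinAt (fun t => tensorState fun j => ρ j t)
      (∑ j, siteState (fun j => ρ j t) j (ρ' j)) s t := by
  let f : ContinuousMultilinearMap ℝ (fun _ : S => Matrix (Fin D) (Fin D) ℂ) (Op S D) :=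
    ⟨tensorMultilinear S D, continuous_tensorState⟩
  have h1 : HasDerivWithinAt (fun t j => ρ j t) ρ' s t := hasDerivWithinAt_pi.2 h
  have h2 := (f.hasFDerivAt fun j => ρ j t).comp_hasDerivWithinAt t h1
  rw [ContinuousMultilinearMap.linearDeriv_apply] at h2
  exact h2

lemma tensorState_mul_tensorState (ρ σ : S → Matrix (Fin D) (Fin D) ℂ) :
    tensorState ρ * tensorState σ = tensorState fun j => ρ j * σ j := by
  ext x y
  simp only [Matrix.mul_apply, tensorState, Finset.prod_univ_sum, Fintype.piFinset_univ,
    Finset.prod_mul_distrib]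

open scoped MatrixOrder in
lemma posSemidef_tensorState {ρ : S → Matrix (Fin D) (Fin D) ℂ} (hρ : ∀ j, (ρ j).PosSemidef) :
    (tensorState ρ).PosSemidef := by
  choose B hB using fun j => CStarAlgebra.nonneg_iff_eq_star_mul_self.1 (hρ j).nonneg
  have h1 : tensorState ρ = (tensorState B)ᴴ * tensorState B := by
    have h2 : (tensorState B)ᴴ = tensorState fun j => (B j)ᴴ := by
      ext x y
      simp [tensorState, Matrix.conjTranspose_apply]
    rw [h2, tensorState_mul_tensorState]
    congr 1
    funext j
    exact hB j
  rw [h1]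
  exact Matrix.posSemidef_conjTranspose_mul_self _

end ProductCurve

/-! ### Propagation of the product form -/

namespace Model

variable {S : Type*} [Fintype S] [DecidableEq S] {D : ℕ} {ι : Type*} [Fintype ι]
variable {M : Model S D ι} {a : S → S → ℝ} {s η A C : ℝ}

/-- A solution of the mean-field equations with couplings `a j k` whose factors have trace one. -/
structure IsNormalizedSolution (M : Model S D ι) (a : S → S → ℝ)
    (ρ : S → ℝ → Matrix (Fin D) (Fin D) ℂ) : Prop where
  hasDeriv : ∀ j, ∀ t : ℝ, 0 ≤ t →
    HasDerivWithinAt (ρ j) (M.coupledField a (fun k => ρ k t) j) (Set.Ici 0) t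
  trace_eq : ∀ j, ∀ t : ℝ, 0 ≤ t → (ρ j t).trace = 1

/-- The deviation of the product state from a solution of the many-body equation. -/
lemma MeanFieldScaling.marginalNorm_residual_le (H : M.MeanFieldScaling a s η A C)
    {ρ : S → Matrix (Fin D) (Fin D) ℂ} (hρ : ∀ j, (ρ j).trace = 1) {b : ℝ} (hb1 : 1 ≤ b)
    (hb : ∀ j, entrySum (ρ j) ≤ b) (Λ : Finset S) :
    marginalNorm Λ D (M.coupledGen a s (tensorState ρ)
        - ∑ j, siteState ρ j (M.coupledField a ρ j))
      ≤ 3 * η * (2 * (D : ℝ) ^ 12 * C) * b ^ 2 * Λ.card ^ 2 * b ^ Λ.card := by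
  have hη : 0 ≤ η := (abs_nonneg s).trans H.abs_le
  have hC := H.strength_nonneg
  have hb0 : 0 ≤ b := by linarith
  refine marginalNorm_le (by positivity) fun O _ hO => ?_
  have h1 := norm_trace_coupledGen_sub_le M H.comm H.nonneg H.le H.abs_le hC H.strength_le H.dim_pos
    ρ hρ hb1 hb hO
  rw [mul_sub, Matrix.trace_sub, Finset.mul_sum, Matrix.trace_sum]
  refine h1.trans (le_of_eq ?_)
  rw [pow_add]
  ring

/-- The factors of a mean-field solution stay bounded for a time that does not depend on the size
of the system. The bound is `8 * D ^ 2 = 2 * D ^ 2 * 4`: the one-site marginal norms are at most two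
at `t₀` and at most four until `t₀ + τ`, and `2 * D ^ 2` converts them into entries. -/
lemma MeanFieldScaling.entrySum_le_of_isNormalizedSolution (H : M.MeanFieldScaling a s η A C)
    (hη : η ≤ 1) {ρ : S → ℝ → Matrix (Fin D) (Fin D) ℂ} (hρ : M.IsNormalizedSolution a ρ)
    {t₀ τ κ g b : ℝ} (ht₀ : 0 ≤ t₀) (hκ : 0 ≤ κ) (hκ' : 4 * C * A ≤ κ)
    (hb : b = 8 * (D : ℝ) ^ 2)
    (hg : g = κ * b ^ 2 + 3 * (2 * (D : ℝ) ^ 12 * C) * b ^ 3 + 1) (hτ : g * τ ≤ 2)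
    (h₀ : ∀ j, marginalNorm {j} D (tensorState fun k => ρ k t₀) ≤ 2) :
    ∀ t ∈ Set.Icc t₀ (t₀ + τ), ∀ j, entrySum (ρ j t) ≤ b := by
  have hC := H.strength_nonneg
  have hη0 : 0 ≤ η := (abs_nonneg s).trans H.abs_le
  have hD : (1 : ℝ) ≤ D := by exact_mod_cast H.dim_pos
  have hD2 : (1 : ℝ) ≤ (D : ℝ) ^ 2 := one_le_pow₀ hD
  have hb8 : 8 ≤ b := by rw [hb]; linarith
  have hg1 : 1 ≤ g := by
    rw [hg]
    have : 0 ≤ κ * b ^ 2 + 3 * (2 * (D : ℝ) ^ 12 * C) * b ^ 3 := by positivity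
    linarith
  set σ : ℝ → Op S D := fun t => tensorState fun k => ρ k t with hσ
  set x : ℝ → S → ℝ := fun t j => marginalNorm {j} D (σ t) with hx
  set f : ℝ → ℝ := fun t => ‖x t‖ with hf
  set β : ℝ → ℝ := fun t => max 1 (2 * (D : ℝ) ^ 2 * f t) with hβ
  have hderiv : ∀ t, 0 ≤ t → HasDerivWithinAt σ
      (∑ j, siteState (fun k => ρ k t) j (M.coupledField a (fun k => ρ k t) j)) (Set.Ici 0) t :=
    fun t ht => hasDerivWithinAt_tensorState fun j => hρ.hasDeriv j t ht
  have hcont : ContinuousOn σ (Set.Icc t₀ (t₀ + τ)) := fun t ht =>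
    ((hderiv t (ht₀.trans ht.1)).continuousWithinAt).mono fun z hz => ht₀.trans hz.1
  have hfc : ContinuousOn f (Set.Icc t₀ (t₀ + τ)) :=
    ContinuousOn.norm (continuousOn_pi.2 fun j =>
      (continuous_marginalNorm {j} D).comp_continuousOn hcont)
  have hentry : ∀ t, 0 ≤ t → ∀ j, entrySum (ρ j t) ≤ 2 * (D : ℝ) ^ 2 * f t := by
    intro t ht j
    refine (entrySum_le_marginal (ρ := fun k => ρ k t) (fun i => hρ.trace_eq i t ht) j).trans ?_
    exact mul_le_mul_of_nonneg_left (le_norm_fun (x t) j) (by positivity)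
  have hf' : ∀ t ∈ Set.Ico t₀ (t₀ + τ), ∀ r,
      κ * β t ^ 2 + 3 * (2 * (D : ℝ) ^ 12 * C) * β t ^ 3 < r →
      ∃ᶠ z in 𝓝[>] t, slope f t z < r := by
    intro t ht r hr
    have ht' : 0 ≤ t := ht₀.trans ht.1
    have hft : 0 ≤ f t := norm_nonneg _
    have hβ1 : 1 ≤ β t := le_max_left _ _
    have hβe : ∀ j, entrySum (ρ j t) ≤ β t := fun j =>
      (hentry t ht' j).trans (le_max_right _ _)
    set q := κ * β t ^ 2 + 3 * (2 * (D : ℝ) ^ 12 * C) * β t ^ 3 with hq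
    have hq0 : 0 ≤ q := by positivity
    have hε : 0 < (r - q) / (2 * (1 + f t)) := by
      have : 0 < r - q := by linarith
      positivity
    set ε := (r - q) / (2 * (1 + f t)) with hεd
    have hεf : ε * (1 + f t) = (r - q) / 2 := by rw [hεd]; field_simp
    have hd : HasDerivWithinAt σ (M.coupledGen a s (σ t) + ((∑ j, siteState (fun k => ρ k t) j
        (M.coupledField a (fun k => ρ k t) j)) - M.coupledGen a s (σ t))) (Set.Ici t) t := by
      rw [add_sub_cancel]
      exact (hderiv t ht').mono (Set.Ici_subset_Ici.2 ht')
    refine Eventually.frequently ?_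
    filter_upwards [H.eventually_marginalNorm_le hd hε, self_mem_nhdsWithin] with z hz hzt
    have hzt' : 0 < z - t := sub_pos.2 hzt
    refine slope_lt_of_le (c := q + ε * (1 + f t)) hzt ?_ (by rw [hεf]; linarith)
    refine norm_fun_le (by positivity) (fun j => apply_nonneg (marginalNorm {j} D) (σ z))
      fun j => ?_
    have h1 := hz {j} (β t ^ 2) (by positivity) fun k hk => by
      have := marginalNorm_tensorState_le (fun i => hρ.trace_eq i t ht')
        (zero_le_one.trans hβ1) hβe (insert k {j})
      rwa [Finset.card_insert_of_notMem hk, Finset.card_singleton] at this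
    have h2 := H.marginalNorm_residual_le (fun i => hρ.trace_eq i t ht') hβ1 hβe {j}
    rw [map_sub_rev] at h2
    rw [Finset.card_singleton] at h1 h2
    have h3 : 3 * η * (2 * (D : ℝ) ^ 12 * C) * β t ^ 2 * (1 : ℕ) ^ 2 * β t ^ 1
        ≤ 3 * (2 * (D : ℝ) ^ 12 * C) * β t ^ 3 := by
      have h4 : 0 ≤ 3 * (2 * (D : ℝ) ^ 12 * C) * β t ^ 3 := by positivity
      calc _ = η * (3 * (2 * (D : ℝ) ^ 12 * C) * β t ^ 3) := by push_cast; ring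
        _ ≤ 1 * (3 * (2 * (D : ℝ) ^ 12 * C) * β t ^ 3) := by gcongr
        _ = _ := one_mul _
    have h5 : marginalNorm {j} D (σ t) ≤ f t := le_norm_fun (x t) j
    calc marginalNorm {j} D (σ z) ≤ _ := h1
      _ ≤ f t + (z - t) * (1 * κ * β t ^ 2 + 3 * (2 * (D : ℝ) ^ 12 * C) * β t ^ 3
            + ε * (1 + f t)) := by
          push_cast
          gcongr
          exact h2.trans h3
      _ = _ := by rw [hq]; ring
  have hfence := image_le_of_liminf_slope_right_lt_deriv_boundary' (f := f) (a := t₀)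
    (b := t₀ + τ) hfc hf' (B := fun t => 2 + g * (t - t₀)) (B' := fun _ => g) (by
      have : f t₀ ≤ 2 := norm_fun_le (by norm_num)
        (fun j => apply_nonneg (marginalNorm {j} D) (σ t₀)) h₀
      simpa using this) (by fun_prop) (fun t _ => by
      have h1 : HasDerivAt (fun t : ℝ => 2 + g * (t - t₀)) (g * 1) t :=
        (((hasDerivAt_id t).sub_const t₀).const_mul g).const_add 2
      simpa using h1.hasDerivWithinAt) (fun t ht hft => by
      have h1 : f t ≤ 4 := by
        have : t - t₀ ≤ τ := by linarith [ht.2]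
        rw [hft]
        nlinarith
      have h2 : β t ≤ b := max_le (by linarith) (by rw [hb]; nlinarith)
      have h0 : 0 ≤ β t := zero_le_one.trans (le_max_left _ _)
      calc κ * β t ^ 2 + 3 * (2 * (D : ℝ) ^ 12 * C) * β t ^ 3
          ≤ κ * b ^ 2 + 3 * (2 * (D : ℝ) ^ 12 * C) * b ^ 3 := by gcongr
        _ < g := by rw [hg]; linarith)
  intro t ht j
  have h1 := hfence ht
  have h2 : t - t₀ ≤ τ := by linarith [ht.2]
  have h3 : f t ≤ 4 := by nlinarith
  refine (hentry t (ht₀.trans ht.1) j).trans ?_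
  rw [hb]
  nlinarith

/-- If the marginals on small sets of sites are close to those of the product state at the time
`t₀`, then they remain close for a time that does not depend on the size of the system. -/
lemma MeanFieldScaling.marginalNorm_sub_le (H : M.MeanFieldScaling a s η A C)
    (hη : η ≤ 1) {ρ : S → ℝ → Matrix (Fin D) (Fin D) ℂ} (hρ : M.IsNormalizedSolution a ρ)
    (hρ₀ : ∀ j, (ρ j 0).PosSemidef)
    {t₀ τ κ g b δ : ℝ} (ht₀ : 0 ≤ t₀) (hκ : 0 < κ) (hκ' : 4 * C * A ≤ κ)
    (hb : b = 8 * (D : ℝ) ^ 2)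
    (hg : g = κ * b ^ 2 + 3 * (2 * (D : ℝ) ^ 12 * C) * b ^ 3 + 1) (hτ0 : 0 ≤ τ) (hτ : g * τ ≤ 2)
    (hτ' : 2 * κ * τ ≤ 1 / (2 * b)) {N : ℕ} (hN : 1 ≤ N) (hδ : δ ≤ 1)
    (h₀ : ∀ Λ : Finset S, Λ.card ≤ N → marginalNorm Λ D
      (evolve (M.coupledGen a s) t₀ (tensorState fun k => ρ k 0) - tensorState fun k => ρ k t₀)
        ≤ δ) :
    ∀ t ∈ Set.Icc t₀ (t₀ + τ), ∀ Λ : Finset S, (1 / (4 * b)) ^ Λ.card * marginalNorm Λ D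
      (evolve (M.coupledGen a s) t (tensorState fun k => ρ k 0) - tensorState fun k => ρ k t)
        ≤ δ + 2 * (1 / 2) ^ N + 6 * η * (2 * (D : ℝ) ^ 12 * C) * b ^ 2 * τ := by
  have hC := H.strength_nonneg
  have hη0 : 0 ≤ η := (abs_nonneg s).trans H.abs_le
  have hD : (1 : ℝ) ≤ D := by exact_mod_cast H.dim_pos
  have hb1 : 1 ≤ b := by
    have : (1 : ℝ) ≤ (D : ℝ) ^ 2 := one_le_pow₀ hD
    rw [hb]
    linarith
  have hδ0 : 0 ≤ δ := (apply_nonneg _ _).trans (h₀ ∅ (by simp))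
  set ϱ : ℝ → Op S D := fun t => evolve (M.coupledGen a s) t (tensorState fun k => ρ k 0) with hϱ
  set σ : ℝ → Op S D := fun t => tensorState fun k => ρ k t with hσ
  have hϱ1 : ∀ t, 0 ≤ t → ∀ Λ, marginalNorm Λ D (ϱ t) ≤ 1 := fun t ht Λ => by
    refine marginalNorm_le_one Λ (H.positive t ht _ (posSemidef_tensorState hρ₀)) ?_
    rw [trace_evolve (M.coupledGen_apply_trace a s), trace_tensorState]
    exact Finset.prod_eq_one fun j _ => hρ.trace_eq j 0 le_rfl
  have hentry := H.entrySum_le_of_isNormalizedSolution hη hρ ht₀ hκ.le hκ' hb hg hτ fun j => by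
    have h1 := hϱ1 t₀ ht₀ {j}
    have h2 := h₀ {j} (by simpa using hN)
    have h3 : σ t₀ = ϱ t₀ - (ϱ t₀ - σ t₀) := by abel
    change marginalNorm {j} D (σ t₀) ≤ 2
    rw [h3]
    refine (map_sub_le_add (marginalNorm {j} D) _ _).trans ?_
    linarith
  have hderiv : ∀ t ∈ Set.Icc t₀ (t₀ + τ), HasDerivWithinAt (fun t => ϱ t - σ t)
      (M.coupledGen a s (ϱ t - σ t) + (M.coupledGen a s (σ t) -
        ∑ j, siteState (fun k => ρ k t) j (M.coupledField a (fun k => ρ k t) j)))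
      (Set.Ici t₀) t := by
    intro t ht
    have h1 := (hasDerivAt_evolve (M.coupledGen a s) (tensorState fun k => ρ k 0) t)
    have h2 := hasDerivWithinAt_tensorState fun j => hρ.hasDeriv j t (ht₀.trans ht.1)
    have h3 := (h1.hasDerivWithinAt (s := Set.Ici t₀)).sub (h2.mono (Set.Ici_subset_Ici.2 ht₀))
    have h4 : M.coupledGen a s (ϱ t - σ t) + (M.coupledGen a s (σ t) -
        ∑ j, siteState (fun k => ρ k t) j (M.coupledField a (fun k => ρ k t) j))
        = M.coupledGen a s (ϱ t)
          - ∑ j, siteState (fun k => ρ k t) j (M.coupledField a (fun k => ρ k t) j) := by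
      rw [map_sub]
      abel
    rw [h4]
    exact h3
  -- On sets with at most `N` sites the initial error is at most `δ`; on larger ones the marginals
  -- are of size at most `2 * b ^ |Λ|`, and the weight makes them smaller than `2 * (1 / 2) ^ N`.
  have hmain := H.marginalNorm_le_of_hierarchy (X := fun t => ϱ t - σ t)
    (R := fun t => M.coupledGen a s (σ t) -
        ∑ j, siteState (fun k => ρ k t) j (M.coupledField a (fun k => ρ k t) j))
    (δ := 3 * η * (2 * (D : ℝ) ^ 12 * C) * b ^ 2) (F₀ := δ + 2 * (1 / 2) ^ N) (z₀ := 1 / (2 * b))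
    hκ hκ' hb1 rfl hτ' (by positivity)
    (fun t ht => (hderiv t (Set.Ico_subset_Icc_self ht)).mono (Set.Ici_subset_Ici.2 ht.1))
    (fun t ht => ((hderiv t ht).continuousWithinAt).mono fun z hz => hz.1)
    (fun t ht Λ => H.marginalNorm_residual_le (fun i => hρ.trace_eq i t (ht₀.trans ht.1)) hb1
      (hentry t (Set.Ico_subset_Icc_self ht)) Λ) (by positivity) (fun Λ => by
      have hz0 : (0 : ℝ) ≤ 1 / (2 * b) := by positivity
      have hz1 : 1 / (2 * b) ≤ 1 := by
        rw [div_le_one (by positivity)]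
        linarith
      rcases le_or_gt Λ.card N with hΛ | hΛ
      · refine (mul_le_of_le_one_left (apply_nonneg _ _) (pow_le_one₀ hz0 hz1)).trans ?_
        refine (h₀ Λ hΛ).trans ?_
        have : (0 : ℝ) ≤ 2 * (1 / 2) ^ N := by positivity
        linarith
      · have h1 : marginalNorm Λ D (ϱ t₀ - σ t₀) ≤ 2 * b ^ Λ.card := by
          refine (map_sub_le_add (marginalNorm Λ D) _ _).trans ?_
          have h2 := marginalNorm_tensorState_le (fun i => hρ.trace_eq i t₀ ht₀)
            (zero_le_one.trans hb1) (hentry t₀ ⟨le_rfl, by linarith⟩) Λ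
          have h3 : 1 ≤ b ^ Λ.card := one_le_pow₀ hb1
          have h4 := hϱ1 t₀ ht₀ Λ
          change marginalNorm Λ D (σ t₀) ≤ _ at h2
          linarith
        calc (1 / (2 * b)) ^ Λ.card * marginalNorm Λ D (ϱ t₀ - σ t₀)
            ≤ (1 / (2 * b)) ^ Λ.card * (2 * b ^ Λ.card) := by gcongr
          _ = 2 * (1 / (2 * b) * b) ^ Λ.card := by rw [mul_pow]; ring
          _ = 2 * (1 / 2) ^ Λ.card := by
              congr 2
              field_simp
          _ ≤ 2 * (1 / 2) ^ N := by
              have := pow_le_pow_of_le_one (by norm_num : (0 : ℝ) ≤ 1 / 2) (by norm_num) hΛ.le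
              gcongr 2 * ?_
          _ ≤ _ := by linarith)
  intro t ht Λ
  have h1 := hmain t ht Λ
  have h2 : 1 / (2 * b) / 2 = 1 / (4 * b) := by field_simp; norm_num
  rw [h2] at h1
  refine h1.trans (le_of_eq ?_)
  ring

end Model

namespace Model

variable {S : ℕ → Type*} [∀ L, Fintype (S L)] [∀ L, DecidableEq (S L)] {D : ℕ} {ι : Type*}
  [Fintype ι] {M : ∀ L, Model (S L) D ι} {a : ∀ L, S L → S L → ℝ} {s η : ℕ → ℝ} {A C : ℝ}

/-- Propagation of the product form: in the limit in which the individual couplings vanish, the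
marginals on boundedly many sites are those of the product of the mean-field solutions. -/
lemma eventually_marginalNorm_sub_le
    (H : ∀ᶠ L in atTop, (M L).MeanFieldScaling (a L) (s L) (η L) A C)
    (hη : Tendsto η atTop (𝓝 0)) {ρ : ∀ L, S L → ℝ → Matrix (Fin D) (Fin D) ℂ}
    (hρ : ∀ L, (M L).IsNormalizedSolution (a L) (ρ L)) (hρ₀ : ∀ L j, (ρ L j 0).PosSemidef)
    (t : ℝ) (ht : 0 ≤ t) (n : ℕ) (ε : ℝ) (hε : 0 < ε) :
    ∀ᶠ L in atTop, ∀ Λ : Finset (S L), Λ.card ≤ n → marginalNorm Λ D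
      (evolve ((M L).coupledGen (a L) (s L)) t (tensorState fun k => ρ L k 0)
        - tensorState fun k => ρ L k t) ≤ ε := by
  obtain ⟨L₀, hL₀⟩ := H.exists
  have hC := hL₀.strength_nonneg
  have hD : (1 : ℝ) ≤ D := by exact_mod_cast hL₀.dim_pos
  clear hL₀ L₀
  set κ : ℝ := max (4 * C * A) 1 with hκ
  have hκ0 : 0 < κ := lt_of_lt_of_le one_pos (le_max_right _ _)
  set b : ℝ := 8 * (D : ℝ) ^ 2 with hb
  have hb1 : 1 ≤ b := by
    have : (1 : ℝ) ≤ (D : ℝ) ^ 2 := one_le_pow₀ hD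
    rw [hb]
    linarith
  set K : ℝ := 2 * (D : ℝ) ^ 12 * C with hK
  have hK0 : 0 ≤ K := by positivity
  set g : ℝ := κ * b ^ 2 + 3 * K * b ^ 3 + 1 with hg
  have hg0 : 0 < g := by positivity
  set τ : ℝ := min (2 / g) (1 / (2 * b) / (2 * κ)) with hτ
  have hτ0 : 0 < τ := lt_min (by positivity) (by positivity)
  have hτg : g * τ ≤ 2 := by
    have : τ ≤ 2 / g := min_le_left _ _
    rw [le_div_iff₀ hg0] at this
    linarith
  have hτz : 2 * κ * τ ≤ 1 / (2 * b) := by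
    have : τ ≤ 1 / (2 * b) / (2 * κ) := min_le_right _ _
    rw [le_div_iff₀ (by positivity)] at this
    linarith
  -- The step length `τ` is the same for all system sizes.
  have step : ∀ t₀, 0 ≤ t₀ → (∀ (n : ℕ) (ε : ℝ), 0 < ε → ∀ᶠ L in atTop, ∀ Λ : Finset (S L),
      Λ.card ≤ n → marginalNorm Λ D (evolve ((M L).coupledGen (a L) (s L)) t₀
        (tensorState fun k => ρ L k 0) - tensorState fun k => ρ L k t₀) ≤ ε) →
      ∀ t ∈ Set.Icc t₀ (t₀ + τ), ∀ (n : ℕ) (ε : ℝ), 0 < ε → ∀ᶠ L in atTop, ∀ Λ : Finset (S L),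
      Λ.card ≤ n → marginalNorm Λ D (evolve ((M L).coupledGen (a L) (s L)) t
        (tensorState fun k => ρ L k 0) - tensorState fun k => ρ L k t) ≤ ε := by
    intro t₀ ht₀ h₀ t ht n ε hε
    set ε' : ℝ := (1 / (4 * b)) ^ n * ε with hε'
    have hε'0 : 0 < ε' := by positivity
    obtain ⟨N, hN⟩ := exists_pow_lt_of_lt_one (show 0 < ε' / 6 by positivity)
      (by norm_num : (1 / 2 : ℝ) < 1)
    have hη1 : ∀ᶠ L in atTop, η L < 1 := (tendsto_order.1 hη).2 _ one_pos
    have hη2 : ∀ᶠ L in atTop, 6 * η L * K * b ^ 2 * τ < ε' / 3 := by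
      have h1 : Tendsto (fun L => 6 * η L * K * b ^ 2 * τ) atTop
          (𝓝 (6 * 0 * K * b ^ 2 * τ)) :=
        (((hη.const_mul 6).mul_const K).mul_const (b ^ 2)).mul_const τ
      refine (tendsto_order.1 h1).2 _ ?_
      simp only [mul_zero, zero_mul]
      positivity
    filter_upwards [H, hη1, hη2, h₀ (N + 1) (min 1 (ε' / 3)) (lt_min one_pos (by positivity))]
      with L hL hL1 hL2 hL3 Λ hΛ
    have h1 := hL.marginalNorm_sub_le hL1.le (hρ L) (hρ₀ L) ht₀ hκ0 (le_max_left _ _) hb hg hτ0.le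
      hτg hτz (Nat.le_add_left 1 N) (min_le_left _ _) hL3 t ht Λ
    have h2 : (1 / 2 : ℝ) ^ (N + 1) ≤ (1 / 2) ^ N :=
      pow_le_pow_of_le_one (by norm_num) (by norm_num) (Nat.le_succ N)
    have h3 : min 1 (ε' / 3) ≤ ε' / 3 := min_le_right _ _
    have h4 : (1 / (4 * b)) ^ n ≤ (1 / (4 * b)) ^ Λ.card := by
      refine pow_le_pow_of_le_one (by positivity) ?_ hΛ
      rw [div_le_one (by positivity)]
      linarith
    have h5 := (mul_le_mul_of_nonneg_right h4 (apply_nonneg (marginalNorm Λ D) _)).trans h1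
    have h6 : (0 : ℝ) < (1 / (4 * b)) ^ n := by positivity
    refine le_of_mul_le_mul_left (h5.trans ?_) h6
    change _ ≤ ε'
    linarith
  have hinit : ∀ (n : ℕ) (ε : ℝ), 0 < ε → ∀ᶠ L in atTop, ∀ Λ : Finset (S L),
      Λ.card ≤ n → marginalNorm Λ D (evolve ((M L).coupledGen (a L) (s L)) 0
        (tensorState fun k => ρ L k 0) - tensorState fun k => ρ L k 0) ≤ ε := by
    intro n ε hε
    refine Eventually.of_forall fun L Λ _ => ?_
    rw [evolve_zero, sub_self, map_zero]
    exact hε.le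
  have hgrid : ∀ m : ℕ, ∀ (n : ℕ) (ε : ℝ), 0 < ε → ∀ᶠ L in atTop, ∀ Λ : Finset (S L),
      Λ.card ≤ n → marginalNorm Λ D (evolve ((M L).coupledGen (a L) (s L)) (m * τ)
        (tensorState fun k => ρ L k 0) - tensorState fun k => ρ L k (m * τ)) ≤ ε := by
    intro m
    induction m with
    | zero => simpa using hinit
    | succ m ih =>
      have h1 : ((m + 1 : ℕ) : ℝ) * τ = m * τ + τ := by push_cast; ring
      rw [h1]
      exact step (m * τ) (by positivity) ih _ ⟨by linarith, le_rfl⟩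
  set m := ⌊t / τ⌋₊
  have h1 : (m : ℝ) * τ ≤ t := by
    rw [← le_div_iff₀ hτ0]
    exact Nat.floor_le (by positivity)
  have h2 : t ≤ m * τ + τ := by
    have := (Nat.lt_floor_add_one (t / τ)).le
    rw [div_le_iff₀ hτ0] at this
    linarith
  exact step (m * τ) (by positivity) (hgrid m) t ⟨h1, h2⟩ n ε hε

end Model

/-! ### Sums over the lattice -/

section LatticeSums

variable {d L : ℕ}

/-- The distance of two coordinate values, as an element of `Fin L`. -/
def coordGap (bc : Boundary) (x y : Fin L) : Fin L :=
  match bc with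
  | Boundary.free => ⟨max x.1 y.1 - min x.1 y.1, by have := x.2; have := y.2; omega⟩
  | Boundary.periodic => ⟨min (max x.1 y.1 - min x.1 y.1) (L - (max x.1 y.1 - min x.1 y.1)), by
      have := x.2; have := y.2; omega⟩

lemma coordDist_coord (bc : Boundary) (r s : Site d L) (i : Fin d) :
    coordDist bc L (coord r i) (coord s i) = ((coordGap bc (r i) (s i) : ℕ) : ℝ) := by
  have h1 : |coord r i - coord s i|
      = ((max (r i).1 (s i).1 - min (r i).1 (s i).1 : ℕ) : ℝ) := by
    rw [Nat.cast_sub (min_le_max)]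
    simp only [coord, add_sub_add_right_eq_sub, Nat.cast_max, Nat.cast_min]
    exact (max_sub_min_eq_abs' _ _).symm
  cases bc
  · exact h1
  · have h2 : max (r i).1 (s i).1 - min (r i).1 (s i).1 ≤ L := by
      have := (r i).2; have := (s i).2; omega
    simp only [coordDist, coordGap, h1, Nat.cast_min, Nat.cast_sub h2]

lemma coordGap_pos (bc : Boundary) {x y : Fin L} (h : x ≠ y) : 1 ≤ (coordGap bc x y : ℕ) := by
  have h1 : x.1 ≠ y.1 := fun h' => h (Fin.ext h')
  have := x.2
  have := y.2
  cases bc <;> simp only [coordGap] <;> omega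

lemma one_le_siteDist (bc : Boundary) {r s : Site d L} (h : r ≠ s) : 1 ≤ siteDist bc r s := by
  obtain ⟨i, hi⟩ := Function.ne_iff.1 h
  rw [siteDist, Real.one_le_sqrt]
  have h1 : (1 : ℝ) ≤ coordDist bc L (coord r i) (coord s i) ^ 2 := by
    rw [coordDist_coord]
    exact one_le_pow₀ (by exact_mod_cast coordGap_pos bc hi)
  exact h1.trans (Finset.single_le_sum
    (f := fun i => coordDist bc L (coord r i) (coord s i) ^ 2) (fun _ _ => sq_nonneg _)
    (Finset.mem_univ i))

lemma siteNorm_free_sq (r : Site d L) :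
    siteNorm Boundary.free r ^ 2 = ∑ i, (((r i : ℕ) : ℝ) + 1) ^ 2 := by
  rw [siteNorm, Real.sq_sqrt (Finset.sum_nonneg fun _ _ => sq_nonneg _)]
  simp [coordDist, coord]

lemma one_le_siteNorm_free (hd : 1 ≤ d) (r : Site d L) : 1 ≤ siteNorm Boundary.free r := by
  have h0 : 0 ≤ siteNorm Boundary.free r := Real.sqrt_nonneg _
  rw [← one_le_sq_iff₀ h0, siteNorm_free_sq]
  have h1 : (1 : ℝ) ≤ (((r ⟨0, hd⟩ : ℕ) : ℝ) + 1) ^ 2 := one_le_pow₀ (by simp)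
  exact h1.trans (Finset.single_le_sum (f := fun i => (((r i : ℕ) : ℝ) + 1) ^ 2)
    (fun _ _ => sq_nonneg _) (Finset.mem_univ _))

lemma siteDist_sq (bc : Boundary) (r s : Site d L) :
    siteDist bc r s ^ 2 = ∑ i, ((coordGap bc (r i) (s i) : ℕ) : ℝ) ^ 2 := by
  rw [siteDist, Real.sq_sqrt (Finset.sum_nonneg fun _ _ => sq_nonneg _)]
  simp only [coordDist_coord]

/-- The site whose coordinates are the distances of the coordinates of `r` and `s`, shifted by one,
has a comparable norm. -/
lemma siteNorm_free_coordGap_le (bc : Boundary) {r s : Site d L} (h : r ≠ s) :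
    siteNorm Boundary.free (fun i => coordGap bc (r i) (s i))
      ≤ √(2 + 2 * d) * siteDist bc r s := by
  have h0 : 0 ≤ siteDist bc r s := Real.sqrt_nonneg _
  refine le_of_sq_le_sq ?_ (by positivity)
  have h1 := one_le_siteDist bc h
  rw [siteNorm_free_sq, mul_pow, Real.sq_sqrt (by positivity)]
  calc ∑ i, (((coordGap bc (r i) (s i) : ℕ) : ℝ) + 1) ^ 2
      ≤ ∑ i, (2 * ((coordGap bc (r i) (s i) : ℕ) : ℝ) ^ 2 + 2) :=
        Finset.sum_le_sum fun i _ => by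
          nlinarith [sq_nonneg (((coordGap bc (r i) (s i) : ℕ) : ℝ) - 1)]
    _ = 2 * siteDist bc r s ^ 2 + 2 * d * 1 := by
        rw [siteDist_sq, Finset.sum_add_distrib, ← Finset.mul_sum]
        simp [mul_comm]
    _ ≤ 2 * siteDist bc r s ^ 2 + 2 * d * siteDist bc r s ^ 2 := by
        gcongr
        exact one_le_pow₀ h1
    _ = _ := by ring

/-- At most four values of a coordinate have a given distance from a given value. -/
lemma card_coordGap_eq_le (bc : Boundary) (x v : Fin L) :
    (Finset.univ.filter fun y => coordGap bc x y = v).card ≤ 4 := by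
  have h : (Finset.univ.filter fun y => coordGap bc x y = v).card
      ≤ (Finset.univ : Finset (Bool × Bool)).card := by
    refine Finset.card_le_card_of_injOn (fun y => (decide (x.1 ≤ y.1),
      decide (max x.1 y.1 - min x.1 y.1 ≤ L - (max x.1 y.1 - min x.1 y.1))))
      (fun _ _ => Finset.mem_coe.2 (Finset.mem_univ _)) ?_
    intro y hy z hz hyz
    simp only [Finset.coe_filter, Finset.mem_univ, true_and, Set.mem_ofPred_eq] at hy hz
    have h1 : (coordGap bc x y).1 = (coordGap bc x z).1 := by rw [hy, hz]
    simp only [Prod.mk.injEq, decide_eq_decide] at hyz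
    have := x.2
    have := y.2
    have := z.2
    refine Fin.ext ?_
    cases bc <;> simp only [coordGap] at h1 <;> omega
  simpa using h

lemma siteDist_rpow_le (bc : Boundary) (hd : 1 ≤ d) {α : ℝ} (hα : 0 ≤ α) {r s : Site d L}
    (h : r ≠ s) : 1 / siteDist bc r s ^ α
      ≤ √(2 + 2 * d) ^ α * siteNorm Boundary.free (fun i => coordGap bc (r i) (s i)) ^ (-α) := by
  have h0 : 0 < siteDist bc r s := one_pos.trans_le (one_le_siteDist bc h)
  have h1 : 0 < siteNorm Boundary.free (fun i => coordGap bc (r i) (s i)) :=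
    one_pos.trans_le (one_le_siteNorm_free hd _)
  have h2 := Real.rpow_le_rpow h1.le (siteNorm_free_coordGap_le bc h) hα
  rw [Real.mul_rpow (Real.sqrt_nonneg _) h0.le] at h2
  have h3 : 0 < siteDist bc r s ^ α := Real.rpow_pos_of_pos h0 _
  have h4 := Real.rpow_pos_of_pos h1 α
  rw [Real.rpow_neg h1.le, ← div_eq_mul_inv, div_le_div_iff₀ h3 h4, one_mul]
  exact h2

lemma card_fiber_coordGap_le (bc : Boundary) (j r : Site d L) :
    (Finset.univ.filter fun k : Site d L => (fun i => coordGap bc (j i) (k i)) = r).card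
      ≤ 4 ^ d := by
  have h1 : (Finset.univ.filter fun k : Site d L => (fun i => coordGap bc (j i) (k i)) = r)
      = Fintype.piFinset fun i => Finset.univ.filter fun y => coordGap bc (j i) y = r i := by
    ext k
    simp [funext_iff]
  rw [h1, Fintype.card_piFinset]
  refine (Finset.prod_le_prod' fun i _ => card_coordGap_eq_le bc (j i) (r i)).trans ?_
  simp

lemma sum_comp_le {β γ : Type*} [Fintype β] [Fintype γ] [DecidableEq γ] {f : γ → ℝ}
    (hf : ∀ x, 0 ≤ f x) (g : β → γ) {c : ℕ}
    (hc : ∀ x, (Finset.univ.filter fun k => g k = x).card ≤ c) :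
    ∑ k, f (g k) ≤ c * ∑ x, f x := by
  rw [Finset.sum_comp f g, Finset.mul_sum]
  refine (Finset.sum_le_sum_of_subset_of_nonneg (Finset.subset_univ _) fun x _ _ =>
    nsmul_nonneg (hf x) _).trans (Finset.sum_le_sum fun x _ => ?_)
  rw [nsmul_eq_mul]
  exact mul_le_mul_of_nonneg_right (by exact_mod_cast hc x) (hf x)

/-- The sum of the couplings of one site to all others is comparable to the Kac factor. -/
lemma sum_siteDist_le (bc : Boundary) (hd : 1 ≤ d) {α : ℝ} (hα : 0 ≤ α) (j : Site d L) :
    ∑ k ∈ Finset.univ.erase j, 1 / siteDist bc j k ^ α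
      ≤ √(2 + 2 * d) ^ α * (4 ^ d * kac Boundary.free α d L) := by
  have hpos : ∀ r : Site d L, 0 ≤ siteNorm Boundary.free r ^ (-α) := fun r =>
    Real.rpow_nonneg (Real.sqrt_nonneg _) _
  have hc : 0 ≤ √(2 + 2 * d) ^ α := Real.rpow_nonneg (Real.sqrt_nonneg _) _
  set c : ℝ := √(2 + 2 * d) ^ α with hcd
  have h1 : ∑ k ∈ Finset.univ.erase j, 1 / siteDist bc j k ^ α ≤ ∑ k : Site d L, c *
      siteNorm Boundary.free (fun i => coordGap bc (j i) (k i)) ^ (-α) := by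
    refine (Finset.sum_le_sum fun k hk =>
      siteDist_rpow_le bc hd hα (Finset.ne_of_mem_erase hk).symm).trans ?_
    exact Finset.sum_le_sum_of_subset_of_nonneg (Finset.erase_subset _ _) fun k _ _ =>
      mul_nonneg hc (hpos _)
  have h2 := sum_comp_le hpos (fun (k : Site d L) i => coordGap bc (j i) (k i))
    (card_fiber_coordGap_le bc j)
  rw [Nat.cast_pow, Nat.cast_ofNat] at h2
  rw [← Finset.mul_sum] at h1
  exact h1.trans (mul_le_mul_of_nonneg_left h2 hc)

lemma kac_free_le (bc : Boundary) (hd : 1 ≤ d) {α : ℝ} (hα : 0 ≤ α) (L : ℕ) :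
    kac Boundary.free α d L ≤ kac bc α d L + 1 := by
  cases bc
  · linarith
  have hterm : ∀ r : Site d L, siteNorm Boundary.periodic r ≠ 0 →
      siteNorm Boundary.free r ^ (-α) ≤ siteNorm Boundary.periodic r ^ (-α) := by
    intro r hr
    have h0 : 0 < siteNorm Boundary.periodic r := lt_of_le_of_ne (Real.sqrt_nonneg _) hr.symm
    refine Real.rpow_le_rpow_of_nonpos h0 (Real.sqrt_le_sqrt ?_) (by linarith)
    refine Finset.sum_le_sum fun i _ => ?_
    have h1 : 0 ≤ coord r i := by rw [coord]; positivity
    have h2 : coord r i ≤ L := by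
      rw [coord]
      exact_mod_cast (r i).2
    simp only [coordDist, sub_zero, abs_of_nonneg h1]
    exact pow_le_pow_left₀ (le_min h1 (by linarith)) (min_le_left _ _) 2
  -- Only the site `(L, …, L)` has vanishing norm on the periodic lattice.
  have huniq : ∀ r r' : Site d L, siteNorm Boundary.periodic r = 0 →
      siteNorm Boundary.periodic r' = 0 → r = r' := by
    have hL : ∀ r : Site d L, siteNorm Boundary.periodic r = 0 → ∀ i, (r i).1 + 1 = L := by
      intro r hr i
      rw [siteNorm, Real.sqrt_eq_zero (Finset.sum_nonneg fun _ _ => sq_nonneg _),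
        Finset.sum_eq_zero_iff_of_nonneg (fun _ _ => sq_nonneg _)] at hr
      have h1 := hr i (Finset.mem_univ i)
      have h2 : (0 : ℝ) < coord r i := by rw [coord]; positivity
      rw [sq_eq_zero_iff] at h1
      simp only [coordDist, sub_zero, abs_of_pos h2] at h1
      have h3 : (L : ℝ) - coord r i = 0 := by
        rcases min_choice (coord r i) ((L : ℝ) - coord r i) with h | h
        · rw [h] at h1; exact absurd h1 h2.ne'
        · rwa [h] at h1
      rw [coord, sub_eq_zero] at h3
      exact_mod_cast h3.symm
    intro r r' hr hr'
    funext i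
    refine Fin.ext ?_
    have := hL r hr i
    have := hL r' hr' i
    omega
  have hone : ∀ r : Site d L, siteNorm Boundary.free r ^ (-α) ≤ 1 := fun r =>
    Real.rpow_le_one_of_one_le_of_nonpos (one_le_siteNorm_free hd r) (by linarith)
  have hle : ∀ r : Site d L, siteNorm Boundary.free r ^ (-α)
      ≤ siteNorm Boundary.periodic r ^ (-α)
        + if siteNorm Boundary.periodic r = 0 then 1 else 0 := by
    intro r
    split_ifs with h
    · have : 0 ≤ siteNorm Boundary.periodic r ^ (-α) :=
        Real.rpow_nonneg (Real.sqrt_nonneg _) _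
      linarith [hone r]
    · simpa using hterm r h
  calc kac Boundary.free α d L ≤ ∑ r : Site d L, (siteNorm Boundary.periodic r ^ (-α)
        + if siteNorm Boundary.periodic r = 0 then 1 else 0) :=
        Finset.sum_le_sum fun r _ => hle r
    _ = kac Boundary.periodic α d L
        + ((Finset.univ.filter fun r : Site d L => siteNorm Boundary.periodic r = 0).card : ℝ) := by
        rw [Finset.sum_add_distrib, Finset.sum_boole]
        rfl
    _ ≤ kac Boundary.periodic α d L + 1 := by
        have : (Finset.univ.filter fun r : Site d L => siteNorm Boundary.periodic r = 0).card ≤ 1 :=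
          Finset.card_le_one.2 fun r hr r' hr' =>
            huniq r r' (Finset.mem_filter.1 hr).2 (Finset.mem_filter.1 hr').2
        have : ((Finset.univ.filter fun r : Site d L =>
          siteNorm Boundary.periodic r = 0).card : ℝ) ≤ 1 := by exact_mod_cast this
        linarith

/-- The sites whose largest coordinate is the first one contribute a harmonic sum. -/
lemma sum_le_kac_free {e : ℕ} {α : ℝ} (hα : α ≤ (e + 1 : ℕ)) (L : ℕ) :
    1 / √((e + 1 : ℕ) : ℝ) ^ (e + 1) * ∑ m ∈ Finset.range L, 1 / ((m : ℝ) + 1)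
      ≤ kac Boundary.free α (e + 1) L := by
  have hpos : ∀ r : Site (e + 1) L, 0 ≤ siteNorm Boundary.free r ^ (-α) := fun r =>
    Real.rpow_nonneg (Real.sqrt_nonneg _) _
  have hterm : ∀ (m : Fin L) (r : Fin e → Fin L), (∀ i, r i ≤ m) →
      1 / √((e + 1 : ℕ) : ℝ) ^ (e + 1) * (1 / ((m : ℕ) + 1 : ℝ) ^ (e + 1))
        ≤ siteNorm Boundary.free (Fin.cons m r : Site (e + 1) L) ^ (-α) := by
    intro m r hr
    set x : Site (e + 1) L := Fin.cons m r with hx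
    have h1 : 1 ≤ siteNorm Boundary.free x := one_le_siteNorm_free (Nat.le_add_left 1 e) x
    have h2 : siteNorm Boundary.free x ≤ √((e + 1 : ℕ) : ℝ) * ((m : ℕ) + 1 : ℝ) := by
      refine le_of_sq_le_sq ?_ (by positivity)
      rw [siteNorm_free_sq, mul_pow, Real.sq_sqrt (by positivity)]
      have h3 : ∀ i, (((x i : ℕ) : ℝ) + 1) ^ 2 ≤ ((m : ℕ) + 1 : ℝ) ^ 2 := by
        intro i
        have h4 : (x i : ℕ) ≤ m := by
          refine Fin.cases ?_ (fun i => ?_) i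
          · simp [hx]
          · simpa [hx] using hr i
        gcongr
      refine (Finset.sum_le_sum fun i _ => h3 i).trans (le_of_eq ?_)
      simp
    calc 1 / √((e + 1 : ℕ) : ℝ) ^ (e + 1) * (1 / ((m : ℕ) + 1 : ℝ) ^ (e + 1))
        = (√((e + 1 : ℕ) : ℝ) * ((m : ℕ) + 1 : ℝ)) ^ (-((e + 1 : ℕ) : ℝ)) := by
          rw [Real.rpow_neg (by positivity), Real.rpow_natCast, mul_pow, mul_inv, one_div, one_div]
      _ ≤ siteNorm Boundary.free x ^ (-((e + 1 : ℕ) : ℝ)) :=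
          Real.rpow_le_rpow_of_nonpos (by linarith) h2 (neg_nonpos.2 (Nat.cast_nonneg _))
      _ ≤ siteNorm Boundary.free x ^ (-α) := Real.rpow_le_rpow_of_exponent_le h1 (by linarith)
  have hsplit : kac Boundary.free α (e + 1) L = ∑ m : Fin L, ∑ r : Fin e → Fin L,
      siteNorm Boundary.free (Fin.cons m r : Site (e + 1) L) ^ (-α) := by
    rw [kac, ← (Fin.consEquiv fun _ : Fin (e + 1) => Fin L).sum_comp, Fintype.sum_prod_type]
    rfl
  rw [hsplit, Finset.sum_range, Finset.mul_sum]
  refine Finset.sum_le_sum fun m _ => ?_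
  have hcard : (Fintype.piFinset fun _ : Fin e => Finset.Iic m).card = (m.1 + 1) ^ e := by
    simp [Fin.card_Iic]
  calc 1 / √((e + 1 : ℕ) : ℝ) ^ (e + 1) * (1 / ((m : ℕ) + 1 : ℝ))
      = ∑ r ∈ Fintype.piFinset fun _ : Fin e => Finset.Iic m,
          1 / √((e + 1 : ℕ) : ℝ) ^ (e + 1) * (1 / ((m : ℕ) + 1 : ℝ) ^ (e + 1)) := by
        rw [Finset.sum_const, hcard, nsmul_eq_mul]
        push_cast
        rw [pow_succ ((m : ℕ) + 1 : ℝ)]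
        field_simp
    _ ≤ ∑ r ∈ Fintype.piFinset fun _ : Fin e => Finset.Iic m,
          siteNorm Boundary.free (Fin.cons m r : Site (e + 1) L) ^ (-α) :=
        Finset.sum_le_sum fun r hr => hterm m r fun i =>
          Finset.mem_Iic.1 (Fintype.mem_piFinset.1 hr i)
    _ ≤ _ := Finset.sum_le_sum_of_subset_of_nonneg (Finset.subset_univ _) fun r _ _ => hpos _

/-- For `α ≤ d` the Kac factor diverges, so that each single coupling vanishes in the limit. -/
lemma tendsto_kac (bc : Boundary) (hd : 1 ≤ d) {α : ℝ} (hα : 0 ≤ α) (hαd : α ≤ d) :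
    Tendsto (fun L => kac bc α d L) atTop atTop := by
  obtain ⟨e, rfl⟩ : ∃ e, d = e + 1 := ⟨d - 1, by omega⟩
  have h1 : Tendsto (fun L => 1 / √((e + 1 : ℕ) : ℝ) ^ (e + 1) *
      ∑ m ∈ Finset.range L, 1 / ((m : ℝ) + 1) + -1) atTop atTop :=
    tendsto_atTop_add_const_right _ _
      (Real.tendsto_sum_range_one_div_nat_succ_atTop.const_mul_atTop (by positivity))
  refine tendsto_atTop_mono (fun L => ?_) h1
  have h2 := sum_le_kac_free hαd L
  have h3 := kac_free_le bc hd hα L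
  linarith

end LatticeSums

/-- The lattice model has the mean-field scaling. -/
lemma meanFieldScaling_lattice {d L D : ℕ} {ι : Type*} [Fintype ι] (M : Model (Site d L) D ι)
    (bc : Boundary) (hd : 1 ≤ d) {α : ℝ} (hα : 0 ≤ α) {C : ℝ} (hC0 : 0 ≤ C)
    (hC : ∀ j k, M.strength j k ≤ C) (hD : 1 ≤ D)
    (hCP : ∀ t : ℝ, 0 ≤ t → IsCompletelyPositive (evolve (M.generator bc α) t))
    (hkac : 1 ≤ kac bc α d L) :
    M.MeanFieldScaling (coupling bc α) (1 / (2 * kac bc α d L)) (1 / kac bc α d L)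
      (√(2 + 2 * d) ^ α * (4 ^ d * 2)) C where
  comm := coupling_comm bc α
  nonneg j k := by
    have h1 : 0 ≤ siteDist bc j k ^ α := Real.rpow_nonneg (Real.sqrt_nonneg _) _
    rw [coupling]
    positivity
  le j k hjk := by
    rw [coupling]
    have h1 : 1 ≤ siteDist bc j k ^ α := Real.one_le_rpow (one_le_siteDist bc hjk) hα
    refine one_div_le_one_div_of_le (by linarith) ?_
    nlinarith
  abs_le := by
    rw [abs_of_nonneg (by positivity)]
    exact one_div_le_one_div_of_le (by linarith) (by linarith)
  sum_le j := by
    have h0 : 0 < kac bc α d L := by linarith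
    have h1 := sum_siteDist_le bc hd hα j
    have h2 := kac_free_le bc hd hα L
    have h3 : ∑ k ∈ Finset.univ.erase j, coupling bc α j k
        = (∑ k ∈ Finset.univ.erase j, 1 / siteDist bc j k ^ α) / kac bc α d L := by
      rw [Finset.sum_div]
      refine Finset.sum_congr rfl fun k _ => ?_
      rw [coupling, div_div, mul_comm]
    rw [h3, div_le_iff₀ h0]
    refine h1.trans ?_
    rw [mul_assoc, mul_assoc]
    gcongr
    linarith
  strength_nonneg := hC0
  strength_le := hC
  dim_pos := hD
  positive t ht X hX := by
    rw [← generator_eq]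
    exact posSemidef_apply (hCP t ht) hX

/-! ### Reduced states and the trace norm -/

lemma traceNorm_le_of_entry_le {n : Type*} [Fintype n] [DecidableEq n] {A : Matrix n n ℂ} {c : ℝ}
    (hc : 0 ≤ c) (h : ∀ i j, ‖A i j‖ ≤ c) : traceNorm A ≤ (Fintype.card n : ℝ) ^ 2 * c := by
  set hA := Matrix.isHermitian_conjTranspose_mul_self A
  have hpos : ∀ i, 0 ≤ hA.eigenvalues i := Matrix.eigenvalues_conjTranspose_mul_self_nonneg A
  have htr : ∑ i, hA.eigenvalues i = ∑ i, ∑ j, ‖A j i‖ ^ 2 := by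
    have h1 := hA.trace_eq_sum_eigenvalues
    have h2 : (Aᴴ * A).trace = ((∑ i, ∑ j, ‖A j i‖ ^ 2 : ℝ) : ℂ) := by
      simp only [Matrix.trace, Matrix.diag_apply, Matrix.mul_apply, Matrix.conjTranspose_apply]
      push_cast
      refine Finset.sum_congr rfl fun i _ => Finset.sum_congr rfl fun j _ => ?_
      rw [RCLike.star_def, Complex.conj_mul']
    rw [h2] at h1
    have h3 := congrArg Complex.re h1
    rw [Complex.ofReal_re] at h3
    rw [h3]
    simp
  have hle : ∑ i, hA.eigenvalues i ≤ ((Fintype.card n : ℝ) * c) ^ 2 := by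
    rw [htr]
    calc ∑ i, ∑ j, ‖A j i‖ ^ 2 ≤ ∑ _i : n, ∑ _j : n, c ^ 2 :=
          Finset.sum_le_sum fun i _ => Finset.sum_le_sum fun j _ => by
            have := h j i
            gcongr
      _ = _ := by simp; ring
  calc traceNorm A ≤ ∑ _i : n, (Fintype.card n : ℝ) * c := by
        refine Finset.sum_le_sum fun i _ => Real.sqrt_le_iff.2 ⟨by positivity, ?_⟩
        exact (Finset.single_le_sum (fun i _ => hpos i) (Finset.mem_univ i)).trans hle
    _ = _ := by simp; ring

section Reduced

variable {S : Type*} [Fintype S] [DecidableEq S] {D : ℕ}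

omit [DecidableEq S] in
lemma tensorState_one : tensorState (fun _ : S => (1 : Matrix (Fin D) (Fin D) ℂ)) = 1 := by
  ext σ τ
  simp only [tensorState, Matrix.one_apply, Finset.prod_ite_zero, Finset.prod_const_one,
    Finset.mem_univ, true_imp_iff, funext_iff]

/-- A product of contractions acting on the sites of `Λ` is a contraction localized in `Λ`. -/
lemma tensorState_local (Λ : Finset S) {B : S → Matrix (Fin D) (Fin D) ℂ}
    (hB : ∀ j, ‖B j‖ ≤ 1) :
    tensorState (fun j => if j ∈ Λ then B j else 1) ∈ localAlg Λ D
      ∧ ‖tensorState (fun j => if j ∈ Λ then B j else 1)‖ ≤ 1 := by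
  induction Λ using Finset.induction_on with
  | empty =>
    simp only [Finset.notMem_empty, if_false, tensorState_one]
    refine ⟨one_mem _, ?_⟩
    rcases isEmpty_or_nonempty (S → Fin D) with h | h
    · rw [Subsingleton.elim (1 : Op S D) 0, norm_zero]
      exact zero_le_one
    · exact CStarRing.norm_one.le
  | insert k Λ hk ih =>
    have h1 : tensorState (fun j => if j ∈ insert k Λ then B j else 1)
        = onSite k (B k) * tensorState (fun j => if j ∈ Λ then B j else 1) := by
      rw [← siteState_self (fun j => if j ∈ Λ then B j else 1) k, onSite_mul_siteState,
        siteState_apply, if_neg hk, mul_one]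
      congr 1
      funext j
      rcases eq_or_ne j k with rfl | hj
      · simp
      · simp [hj]
    rw [h1]
    refine ⟨mul_mem (onSite_mem_localAlg (Finset.mem_insert_self k Λ) _)
      (localAlg_mono (Finset.subset_insert k Λ) ih.1), (norm_mul_le _ _).trans ?_⟩
    exact mul_le_one₀ ((norm_onSite_le _ _).trans (hB k)) (norm_nonneg _) ih.2

/-- The entries of the reduced operator are expectations of local observables. -/
lemma exists_reduced_apply_eq (Λ : Finset S) (σ τ : Λ → Fin D) :
    ∃ O ∈ localAlg Λ D, ‖O‖ ≤ 1 ∧ ∀ X : Op S D, reduced Λ X σ τ = (O * X).trace := by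
  set B : S → Matrix (Fin D) (Fin D) ℂ := fun j =>
    if h : j ∈ Λ then Matrix.single (τ ⟨j, h⟩) (σ ⟨j, h⟩) 1 else 0 with hB
  have hBn : ∀ j, ‖B j‖ ≤ 1 := fun j => by
    simp only [hB]
    split_ifs with h
    · simpa using norm_single_le (τ ⟨j, h⟩) (σ ⟨j, h⟩) (1 : ℂ)
    · simp
  obtain ⟨h1, h2⟩ := tensorState_local Λ hBn
  refine ⟨_, h1, h2, fun X => ?_⟩
  set P : (S → Fin D) → (S → Fin D) → S → Prop := fun a b j =>
    if h : j ∈ Λ then τ ⟨j, h⟩ = a j ∧ σ ⟨j, h⟩ = b j else a j = b j with hP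
  have hO : ∀ a b, tensorState (fun j => if j ∈ Λ then B j else 1) a b
      = if ∀ j, P a b j then (1 : ℂ) else 0 := by
    classical
    intro a b
    have h3 : ∀ j, (if j ∈ Λ then B j else 1) (a j) (b j) = if P a b j then (1 : ℂ) else 0 := by
      intro j
      by_cases h : j ∈ Λ
      · simp only [hB, hP, h, if_true, dif_pos, Matrix.single_apply]
      · simp only [hP, h, if_false, dif_neg, Matrix.one_apply, not_false_eq_true]
    rw [tensorState]
    simp only [h3]
    split_ifs with h
    · exact Finset.prod_eq_one fun j _ => if_pos (h j)
    · obtain ⟨j, hj⟩ := not_forall.1 h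
      exact Finset.prod_eq_zero (Finset.mem_univ j) (if_neg hj)
  classical
  have h4 : ((tensorState fun j => if j ∈ Λ then B j else 1) * X).trace
      = ∑ p : (S → Fin D) × (S → Fin D), if ∀ j, P p.1 p.2 j then X p.2 p.1 else 0 := by
    simp only [Matrix.trace, Matrix.diag_apply, Matrix.mul_apply, hO, ite_mul, one_mul, zero_mul,
      Fintype.sum_prod_type]
  rw [h4, ← Finset.sum_filter, reduced]
  refine Finset.sum_nbij' (fun η => (glue Λ τ η, glue Λ σ η)) (fun p i => p.1 i.1) ?_ ?_ ?_ ?_ ?_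
  · intro η _
    simp only [Finset.mem_filter, Finset.mem_univ, true_and]
    intro j
    by_cases h : j ∈ Λ <;> simp [hP, glue, h]
  · exact fun _ _ => Finset.mem_univ _
  · intro η _
    funext i
    simp [glue, i.2]
  · rintro ⟨a, b⟩ hab
    simp only [Finset.mem_filter, Finset.mem_univ, true_and, hP] at hab
    refine Prod.ext (funext fun j => ?_) (funext fun j => ?_)
    · have := hab j
      by_cases h : j ∈ Λ
      · simp only [h, dif_pos] at this
        simp [glue, h, this.1]
      · simp [glue, h]
    · have := hab j
      by_cases h : j ∈ Λ
      · simp only [h, dif_pos] at this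
        simp [glue, h, this.2]
      · simp only [h, dif_neg, not_false_eq_true] at this
        simp [glue, h, this]
  · exact fun _ _ => rfl

lemma reduced_tensorState (Λ : Finset S) {ρ : S → Matrix (Fin D) (Fin D) ℂ}
    (hρ : ∀ j, (ρ j).trace = 1) :
    reduced Λ (tensorState ρ) = tensorState fun j : Λ => ρ j := by
  ext σ τ
  have h1 : ∀ η : {i // i ∉ Λ} → Fin D, tensorState ρ (glue Λ σ η) (glue Λ τ η)
      = (∏ j : Λ, ρ j (σ j) (τ j)) * ∏ j : {i // i ∉ Λ}, ρ j (η j) (η j) := by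
    intro η
    rw [tensorState, ← Fintype.prod_subtype_mul_prod_subtype (fun j => j ∈ Λ)]
    congr 1
    · exact Finset.prod_congr (Finset.ext fun _ => by simp) fun j _ => by simp [glue]
    · exact Finset.prod_congr (Finset.ext fun _ => by simp) fun j _ => by simp [glue, j.2]
  rw [reduced]
  simp only [h1, ← Finset.mul_sum]
  have h2 : ∑ η : {i // i ∉ Λ} → Fin D, ∏ j : {i // i ∉ Λ}, ρ j (η j) (η j) = 1 := by
    have h3 : ∏ j : {i // i ∉ Λ}, (ρ j).trace = 1 := Finset.prod_eq_one fun j _ => hρ j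
    rw [← h3]
    simp only [Matrix.trace, Matrix.diag_apply]
    rw [Finset.prod_univ_sum, Fintype.piFinset_univ]
  rw [h2, mul_one]
  rfl

/-- The trace distance of the reduced state from a product state, in terms of marginals. -/
lemma traceNorm_reduced_sub_le (hD : 1 ≤ D) {n : ℕ} {Λ : Finset S} (hΛ : Λ.card ≤ n) (X : Op S D)
    {ρ : S → Matrix (Fin D) (Fin D) ℂ} (hρ : ∀ j, (ρ j).trace = 1) :
    traceNorm (reduced Λ X - tensorState fun j : Λ => ρ j)
      ≤ ((D : ℝ) ^ n) ^ 2 * (2 * marginalNorm Λ D (X - tensorState ρ)) := by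
  have h0 : 0 ≤ marginalNorm Λ D (X - tensorState ρ) := apply_nonneg _ _
  have h1 : ∀ σ τ, ‖(reduced Λ X - tensorState fun j : Λ => ρ j) σ τ‖
      ≤ 2 * marginalNorm Λ D (X - tensorState ρ) := by
    intro σ τ
    obtain ⟨O, hO, hO1, hOX⟩ := exists_reduced_apply_eq Λ σ τ
    rw [← reduced_tensorState Λ hρ, Matrix.sub_apply, hOX, hOX, ← Matrix.trace_sub, ← mul_sub]
    exact (norm_trace_mul_le_two_mul _ hO).trans (mul_le_of_le_one_right (by positivity) hO1)
  refine (traceNorm_le_of_entry_le (by positivity) h1).trans ?_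
  have h2 : (Fintype.card (Λ → Fin D) : ℝ) ≤ (D : ℝ) ^ n := by
    have h3 : Fintype.card (Λ → Fin D) = D ^ Λ.card := by simp
    rw [h3]
    push_cast
    exact pow_le_pow_right₀ (by exact_mod_cast hD) hΛ
  gcongr

end Reduced

lemma traceNorm_nonneg {n : Type*} [Fintype n] [DecidableEq n] (A : Matrix n n ℂ) :
    0 ≤ traceNorm A :=
  Finset.sum_nonneg fun _ _ => Real.sqrt_nonneg _

/-! ### Global solutions of ordinary differential equations with a Lyapunov function -/

section GlobalSolution

variable {E : Type*} [NormedAddCommGroup E] [NormedSpace ℝ E] {F : E → E} {u : E → ℝ}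
  {u' : E → E →L[ℝ] ℝ} {c K : ℝ}

/-- A quadratic Lyapunov function bounds the solutions, also if the vector field is damped by a
factor `θ` between zero and one. -/
lemma norm_le_of_lyapunov (hu : ∀ x, HasFDerivAt u (u' x) x) (hc : 0 ≤ c) (hK : 0 < K)
    (hle : ∀ x, u' x (F x) ≤ c * u x) (hnorm : ∀ x, ‖x‖ ^ 2 ≤ K * u x) {θ : E → ℝ}
    (hθ0 : ∀ x, 0 ≤ θ x) (hθ1 : ∀ x, θ x ≤ 1) {x : ℝ → E} {T : ℝ}
    (hx : ∀ t ∈ Set.Icc 0 T, HasDerivWithinAt x (θ (x t) • F (x t)) (Set.Icc 0 T) t) :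
    ∀ t ∈ Set.Icc 0 T, ‖x t‖ ≤ √(K * (u (x 0) * Real.exp (c * T))) := by
  have hu0 : ∀ x, 0 ≤ u x := fun x =>
    nonneg_of_mul_nonneg_right ((sq_nonneg _).trans (hnorm x)) hK
  have hd : ∀ t ∈ Set.Icc 0 T, HasDerivWithinAt (fun t => u (x t))
      (u' (x t) (θ (x t) • F (x t))) (Set.Icc 0 T) t := fun t ht =>
    (hu (x t)).comp_hasDerivWithinAt t (hx t ht)
  have hg := le_gronwallBound_of_liminf_deriv_right_le (f := fun t => u (x t))
    (f' := fun t => u' (x t) (θ (x t) • F (x t))) (δ := u (x 0)) (K := c) (ε := 0) (a := 0) (b := T)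
    (fun t ht => (hd t ht).continuousWithinAt) (fun t ht r hr => by
      have h1 := ((hd t (Set.Ico_subset_Icc_self ht)).mono_of_mem_nhdsWithin
        (Icc_mem_nhdsGE_of_mem ht)).liminf_right_slope_le hr
      simpa [slope_def_field, div_eq_inv_mul] using h1) le_rfl (fun t _ => by
      rw [map_smul, smul_eq_mul, add_zero]
      have h1 : θ (x t) * u' (x t) (F (x t)) ≤ θ (x t) * (c * u (x t)) :=
        mul_le_mul_of_nonneg_left (hle _) (hθ0 _)
      have h2 : θ (x t) * (c * u (x t)) ≤ 1 * (c * u (x t)) :=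
        mul_le_mul_of_nonneg_right (hθ1 _) (mul_nonneg hc (hu0 _))
      linarith)
  intro t ht
  refine Real.le_sqrt_of_sq_le ((hnorm _).trans ?_)
  have h1 := hg t ht
  rw [gronwallBound_ε0, sub_zero] at h1
  have h2 : Real.exp (c * t) ≤ Real.exp (c * T) :=
    Real.exp_le_exp.2 (mul_le_mul_of_nonneg_left ht.2 hc)
  have h3 := mul_le_mul_of_nonneg_left h2 (hu0 (x 0))
  exact mul_le_mul_of_nonneg_left (h1.trans h3) hK.le

variable [FiniteDimensional ℝ E]

lemma exists_solution_Icc (hF : ContDiff ℝ 1 F) (hu : ∀ x, HasFDerivAt u (u' x) x) (hc : 0 ≤ c)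
    (hK : 0 < K) (hle : ∀ x, u' x (F x) ≤ c * u x) (hnorm : ∀ x, ‖x‖ ^ 2 ≤ K * u x) (x₀ : E)
    {T : ℝ} (hT : 0 ≤ T) : ∃ x : ℝ → E, x 0 = x₀ ∧
      ∀ t ∈ Set.Icc 0 T, HasDerivWithinAt x (F (x t)) (Set.Icc 0 T) t := by
  set R := √(K * (u x₀ * Real.exp (c * T))) with hR
  have hR0 : 0 ≤ R := Real.sqrt_nonneg _
  -- The cut-off field is bounded and Lipschitz, and the Lyapunov bound keeps its solution in the
  -- ball of radius `R`, where the cut-off is one.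
  let χ : ContDiffBump (0 : E) := ⟨R + 1, R + 2, by linarith, by linarith⟩
  have hG : ContDiff ℝ 1 fun x => χ x • F x := χ.contDiff.smul hF
  have hGs : HasCompactSupport fun x => χ x • F x := χ.hasCompactSupport.smul_right
  obtain ⟨k, hk⟩ := ContDiff.lipschitzWith_of_hasCompactSupport hGs hG one_ne_zero
  obtain ⟨B, hB⟩ := hGs.exists_bound_of_continuous hG.continuous
  have hB0 : 0 ≤ B := (norm_nonneg _).trans (hB 0)
  have hPL : IsPicardLindelof (fun _ x => χ x • F x) (tmin := 0) (tmax := T)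
      ⟨0, le_rfl, hT⟩ x₀ ⟨B * T, by positivity⟩ 0 ⟨B, hB0⟩ k := by
    refine IsPicardLindelof.of_time_independent (fun x _ => hB x) hk.lipschitzOnWith ?_
    simp only [sub_zero, sub_self, max_eq_left hT, NNReal.coe_zero]
    exact le_rfl
  obtain ⟨x, hx0, hx⟩ := hPL.exists_eq_forall_mem_Icc_hasDerivWithinAt₀
  refine ⟨x, hx0, fun t ht => ?_⟩
  have h1 := norm_le_of_lyapunov hu hc hK hle hnorm (θ := χ) (fun x => χ.nonneg)
    (fun x => χ.le_one) hx t ht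
  change x 0 = x₀ at hx0
  rw [hx0] at h1
  have h2 : χ (x t) = 1 := χ.one_of_mem_closedBall (by
    rw [mem_closedBall_zero_iff]
    change _ ≤ R + 1
    linarith)
  have h3 := hx t ht
  simp only [h2, one_smul] at h3
  exact h3

lemma solution_unique_Icc (hF : ContDiff ℝ 1 F) (hu : ∀ x, HasFDerivAt u (u' x) x) (hc : 0 ≤ c)
    (hK : 0 < K) (hle : ∀ x, u' x (F x) ≤ c * u x) (hnorm : ∀ x, ‖x‖ ^ 2 ≤ K * u x) {x y : ℝ → E}
    (hxy : x 0 = y 0) {T : ℝ}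
    (hx : ∀ t ∈ Set.Icc 0 T, HasDerivWithinAt x (F (x t)) (Set.Icc 0 T) t)
    (hy : ∀ t ∈ Set.Icc 0 T, HasDerivWithinAt y (F (y t)) (Set.Icc 0 T) t) :
    Set.EqOn x y (Set.Icc 0 T) := by
  set R := √(K * (u (x 0) * Real.exp (c * T))) with hR
  have hR0 : 0 ≤ R := Real.sqrt_nonneg _
  have hxR := norm_le_of_lyapunov hu hc hK hle hnorm (θ := fun _ => 1) (fun _ => zero_le_one)
    (fun _ => le_rfl) (by simpa using hx)
  have hyR := norm_le_of_lyapunov hu hc hK hle hnorm (θ := fun _ => 1) (fun _ => zero_le_one)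
    (fun _ => le_rfl) (by simpa using hy)
  rw [← hxy] at hyR
  obtain ⟨k, hk⟩ := hF.contDiffOn.exists_lipschitzOnWith (s := Metric.closedBall (0 : E) R)
    one_ne_zero (convex_closedBall 0 R) (isCompact_closedBall 0 R)
  exact ODE_solution_unique_of_mem_Icc_right (v := fun _ => F) (s := fun _ => Metric.closedBall 0 R)
    (fun t _ => hk) (fun t ht => (hx t ht).continuousWithinAt)
    (fun t ht => (hx t (Set.Ico_subset_Icc_self ht)).mono_of_mem_nhdsWithin
      (Icc_mem_nhdsGE_of_mem ht))
    (fun t ht => mem_closedBall_zero_iff.2 (hxR t (Set.Ico_subset_Icc_self ht)))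
    (fun t ht => (hy t ht).continuousWithinAt)
    (fun t ht => (hy t (Set.Ico_subset_Icc_self ht)).mono_of_mem_nhdsWithin
      (Icc_mem_nhdsGE_of_mem ht))
    (fun t ht => mem_closedBall_zero_iff.2 (hyR t (Set.Ico_subset_Icc_self ht))) hxy

/-- A smooth vector field with a quadratic Lyapunov function has global solutions. -/
lemma exists_solution_Ici (hF : ContDiff ℝ 1 F) (hu : ∀ x, HasFDerivAt u (u' x) x) (hc : 0 ≤ c)
    (hK : 0 < K) (hle : ∀ x, u' x (F x) ≤ c * u x) (hnorm : ∀ x, ‖x‖ ^ 2 ≤ K * u x) (x₀ : E) :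
    ∃ x : ℝ → E, x 0 = x₀ ∧
      ∀ t, 0 ≤ t → HasDerivWithinAt x (F (x t)) (Set.Ici 0) t := by
  choose x hx0 hx using fun n : ℕ => exists_solution_Icc hF hu hc hK hle hnorm x₀
    (T := (n : ℝ) + 1) (by positivity)
  have hagree : ∀ m n : ℕ, m ≤ n → Set.EqOn (x m) (x n) (Set.Icc 0 (m + 1)) := by
    intro m n hmn
    have hmn' : (m : ℝ) ≤ n := by exact_mod_cast hmn
    refine solution_unique_Icc hF hu hc hK hle hnorm (by rw [hx0, hx0]) (hx m) fun t ht => ?_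
    have hsub : Set.Icc (0 : ℝ) (m + 1) ⊆ Set.Icc 0 (n + 1) :=
      Set.Icc_subset_Icc_right (by linarith)
    exact (hx n t (hsub ht)).mono hsub
  have heq : ∀ (n : ℕ) (z : ℝ), 0 ≤ z → z < n + 1 → x ⌊z⌋₊ z = x n z := by
    intro n z hz hzn
    have h1 : ⌊z⌋₊ ≤ n := by
      have : ⌊z⌋₊ < n + 1 := (Nat.floor_lt hz).2 (by exact_mod_cast hzn)
      omega
    exact hagree _ _ h1 ⟨hz, (Nat.lt_floor_add_one z).le⟩
  refine ⟨fun t => x ⌊t⌋₊ t, by simp [hx0], fun t ht => ?_⟩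
  set n := ⌊t⌋₊ with hn
  have htn : t < n + 1 := Nat.lt_floor_add_one t
  have h1 : HasDerivWithinAt (x n) (F (x n t)) (Set.Ici 0) t := by
    refine (hx n t ⟨ht, htn.le⟩).mono_of_mem_nhdsWithin ?_
    filter_upwards [self_mem_nhdsWithin, nhdsWithin_le_nhds (Iio_mem_nhds htn)] with z hz hz'
    exact ⟨hz, (Set.mem_Iio.1 hz').le⟩
  refine h1.congr_of_eventuallyEq ?_ (heq n t ht htn)
  filter_upwards [self_mem_nhdsWithin, nhdsWithin_le_nhds (Iio_mem_nhds htn)] with z hz hz'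
  exact heq n z hz hz'

end GlobalSolution

/-! ### Existence of mean-field solutions -/

section PartialTrace

variable {D : ℕ}

lemma traceSecond_mul_kronecker_one (Z : Matrix (Fin D × Fin D) (Fin D × Fin D) ℂ)
    (A : Matrix (Fin D) (Fin D) ℂ) :
    traceSecond (Z * (A ⊗ₖ (1 : Matrix (Fin D) (Fin D) ℂ))) = traceSecond Z * A := by
  ext a b
  simp only [traceSecond, Matrix.mul_apply, Fintype.sum_prod_type, Matrix.kronecker_apply,
    Matrix.one_apply, mul_ite, mul_one, mul_zero, Finset.sum_ite_eq', Finset.mem_univ, if_true,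
    Finset.sum_mul]
  exact Finset.sum_comm

lemma traceSecond_kronecker_one_mul (Z : Matrix (Fin D × Fin D) (Fin D × Fin D) ℂ)
    (A : Matrix (Fin D) (Fin D) ℂ) :
    traceSecond ((A ⊗ₖ (1 : Matrix (Fin D) (Fin D) ℂ)) * Z) = A * traceSecond Z := by
  ext a b
  simp only [traceSecond, Matrix.mul_apply, Fintype.sum_prod_type, Matrix.kronecker_apply,
    Matrix.one_apply, mul_ite, mul_one, mul_zero, ite_mul, zero_mul, Finset.sum_ite_eq,
    Finset.mem_univ, if_true, Finset.mul_sum]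
  exact Finset.sum_comm

lemma traceSecond_one_kronecker_mul (Z : Matrix (Fin D × Fin D) (Fin D × Fin D) ℂ)
    (A : Matrix (Fin D) (Fin D) ℂ) :
    traceSecond (((1 : Matrix (Fin D) (Fin D) ℂ) ⊗ₖ A) * Z)
      = traceSecond (Z * ((1 : Matrix (Fin D) (Fin D) ℂ) ⊗ₖ A)) := by
  ext a b
  simp only [traceSecond, Matrix.mul_apply, Fintype.sum_prod_type, Matrix.kronecker_apply,
    Matrix.one_apply, mul_ite, one_mul, mul_zero, ite_mul, zero_mul]
  have h1 : ∀ c, ∑ x, ∑ y, (if a = x then A c y * Z (x, y) (b, c) else 0)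
      = ∑ y, A c y * Z (a, y) (b, c) := fun c => by
    rw [Finset.sum_comm]
    simp
  have h2 : ∀ c, ∑ x, ∑ y, (if x = b then Z (a, c) (x, y) * A y c else 0)
      = ∑ y, Z (a, c) (b, y) * A y c := fun c => by
    rw [Finset.sum_comm]
    simp
  simp only [h1, h2]
  rw [Finset.sum_comm]
  exact Finset.sum_congr rfl fun x _ => Finset.sum_congr rfl fun y _ => mul_comm _ _

lemma conjTranspose_traceSecond (Z : Matrix (Fin D × Fin D) (Fin D × Fin D) ℂ) :
    (traceSecond Z)ᴴ = traceSecond Zᴴ := by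
  ext a b
  simp [traceSecond, Matrix.conjTranspose_apply]

lemma traceSecond_commutator (W : Matrix (Fin D × Fin D) (Fin D × Fin D) ℂ)
    (ρ σ : Matrix (Fin D) (Fin D) ℂ) :
    traceSecond (commutator W (ρ ⊗ₖ σ))
      = traceSecond (W * ((1 : Matrix (Fin D) (Fin D) ℂ) ⊗ₖ σ)) * ρ
        - ρ * traceSecond (W * ((1 : Matrix (Fin D) (Fin D) ℂ) ⊗ₖ σ)) := by
  have h1 : ρ ⊗ₖ σ = ((1 : Matrix (Fin D) (Fin D) ℂ) ⊗ₖ σ) * (ρ ⊗ₖ 1) := by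
    rw [← Matrix.mul_kronecker_mul, one_mul, mul_one]
  have h2 : ρ ⊗ₖ σ = (ρ ⊗ₖ 1) * ((1 : Matrix (Fin D) (Fin D) ℂ) ⊗ₖ σ) := by
    rw [← Matrix.mul_kronecker_mul, one_mul, mul_one]
  have h3 : commutator W (ρ ⊗ₖ σ) = W * (ρ ⊗ₖ σ) - (ρ ⊗ₖ σ) * W := rfl
  rw [h3, ← traceSecondHom_apply, map_sub, traceSecondHom_apply, traceSecondHom_apply]
  congr 1
  · rw [h1, ← mul_assoc, traceSecond_mul_kronecker_one]
  · rw [h2, mul_assoc, traceSecond_kronecker_one_mul, traceSecond_one_kronecker_mul]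

lemma traceSecond_dissipator_left (L ρ σ : Matrix (Fin D) (Fin D) ℂ) :
    traceSecond (dissipator (L ⊗ₖ 1) (1 ⊗ₖ L) (ρ ⊗ₖ σ))
      = ((σ * Lᴴ).trace / 2) • (L * ρ - ρ * L) := by
  have h3 : dissipator (L ⊗ₖ 1) (1 ⊗ₖ L) (ρ ⊗ₖ σ)
      = (L * ρ) ⊗ₖ (σ * Lᴴ)
        - (1 / 2 : ℂ) • ((L * ρ) ⊗ₖ (Lᴴ * σ) + (ρ * L) ⊗ₖ (σ * Lᴴ)) := by
    simp only [dissipator, LinearMap.sub_apply, Module.End.mul_apply, LinearMap.mulLeft_apply,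
      LinearMap.mulRight_apply, LinearMap.smul_apply, LinearMap.add_apply,
      Matrix.conjTranspose_kronecker, Matrix.conjTranspose_one, ← Matrix.mul_kronecker_mul,
      one_mul, mul_one]
  rw [h3, ← traceSecondHom_apply]
  simp only [map_sub, map_smul, map_add, traceSecondHom_apply, traceSecond_kronecker,
    Matrix.trace_mul_comm Lᴴ σ]
  module

lemma traceSecond_dissipator_right (L ρ σ : Matrix (Fin D) (Fin D) ℂ) :
    traceSecond (dissipator (1 ⊗ₖ L) (L ⊗ₖ 1) (ρ ⊗ₖ σ))
      = -((L * σ).trace / 2) • (Lᴴ * ρ - ρ * Lᴴ) := by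
  have h3 : dissipator (1 ⊗ₖ L) (L ⊗ₖ 1) (ρ ⊗ₖ σ)
      = (ρ * Lᴴ) ⊗ₖ (L * σ)
        - (1 / 2 : ℂ) • ((Lᴴ * ρ) ⊗ₖ (L * σ) + (ρ * Lᴴ) ⊗ₖ (σ * L)) := by
    simp only [dissipator, LinearMap.sub_apply, Module.End.mul_apply, LinearMap.mulLeft_apply,
      LinearMap.mulRight_apply, LinearMap.smul_apply, LinearMap.add_apply,
      Matrix.conjTranspose_kronecker, Matrix.conjTranspose_one, ← Matrix.mul_kronecker_mul,
      one_mul, mul_one]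
  rw [h3, ← traceSecondHom_apply]
  simp only [map_sub, map_smul, map_add, traceSecondHom_apply, traceSecond_kronecker,
    Matrix.trace_mul_comm σ L]
  module

end PartialTrace

/-- The linear map `σ ↦ 1 ⊗ σ`. -/
def oneKronecker (D : ℕ) :
    Matrix (Fin D) (Fin D) ℂ →ₗ[ℂ] Matrix (Fin D × Fin D) (Fin D × Fin D) ℂ where
  toFun σ := 1 ⊗ₖ σ
  map_add' := Matrix.kronecker_add 1
  map_smul' c σ := Matrix.kronecker_smul c 1 σ

namespace Model

variable {S : Type*} {D : ℕ} {ι : Type*} [Fintype ι] (M : Model S D ι)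

/-- The operator `B(σ)` such that the interaction with a site `k` in the state `σ` acts on the site
`j` by the commutator with `B(σ)`. -/
def effective (j k : S) : Matrix (Fin D) (Fin D) ℂ →ₗ[ℂ] Matrix (Fin D) (Fin D) ℂ :=
  (-Complex.I / 2) • (traceSecondHom D ∘ₗ
      LinearMap.mulLeft ℂ (M.V j k + (M.V k j).submatrix Prod.swap Prod.swap) ∘ₗ
      oneKronecker D)
    + ∑ μ, ((M.w μ j k / 4) • (Matrix.traceLinearMap (Fin D) ℂ ℂ ∘ₗ
          LinearMap.mulRight ℂ (M.jump μ)ᴴ).smulRight (M.jump μ)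
        - (M.w μ k j / 4) • (Matrix.traceLinearMap (Fin D) ℂ ℂ ∘ₗ
          LinearMap.mulLeft ℂ (M.jump μ)).smulRight (M.jump μ)ᴴ)

lemma effective_apply (j k : S) (σ : Matrix (Fin D) (Fin D) ℂ) : M.effective j k σ
    = (-Complex.I / 2) • traceSecond ((M.V j k + (M.V k j).submatrix Prod.swap Prod.swap)
        * ((1 : Matrix (Fin D) (Fin D) ℂ) ⊗ₖ σ))
      + ∑ μ, ((M.w μ j k / 4) • (σ * (M.jump μ)ᴴ).trace • M.jump μ
        - (M.w μ k j / 4) • (M.jump μ * σ).trace • (M.jump μ)ᴴ) := by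
  simp only [effective, LinearMap.add_apply, LinearMap.smul_apply, LinearMap.sum_apply,
    LinearMap.sub_apply, LinearMap.smulRight_apply, LinearMap.comp_apply, traceSecondHom_apply,
    LinearMap.mulLeft_apply, LinearMap.mulRight_apply, Matrix.traceLinearMap_apply]
  rfl

lemma traceSecond_pairGen (j k : S) (ρ σ : Matrix (Fin D) (Fin D) ℂ) :
    traceSecond (M.pairGen j k (ρ ⊗ₖ σ)) = M.effective j k σ * ρ - ρ * M.effective j k σ := by
  rw [effective_apply, pairGen, ← traceSecondHom_apply]
  simp only [LinearMap.add_apply, LinearMap.smul_apply, LinearMap.sum_apply, map_add, map_smul,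
    map_sum, traceSecondHom_apply, traceSecond_commutator, traceSecond_dissipator_left,
    traceSecond_dissipator_right, add_mul, mul_add, smul_mul_assoc, mul_smul_comm, Finset.sum_mul,
    Finset.mul_sum, sub_mul, mul_sub]
  rw [add_sub_add_comm, ← smul_sub, ← Finset.sum_sub_distrib]
  congr 1
  refine Finset.sum_congr rfl fun μ _ => ?_
  module

lemma conjTranspose_effective {j k : S} (hjk : j ≠ k) {σ : Matrix (Fin D) (Fin D) ℂ}
    (hσ : σ.IsHermitian) : (M.effective j k σ)ᴴ = -M.effective j k σ := by
  have hW := M.V_herm j k hjk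
  have hw : ∀ μ, star (M.w μ j k) = M.w μ k j := fun μ => (M.w_herm μ).apply k j
  have hw' : ∀ μ, star (M.w μ k j) = M.w μ j k := fun μ => (M.w_herm μ).apply j k
  have ht : ∀ μ, star (σ * (M.jump μ)ᴴ).trace = (M.jump μ * σ).trace := fun μ => by
    rw [← Matrix.trace_conjTranspose, Matrix.conjTranspose_mul, Matrix.conjTranspose_conjTranspose,
      hσ.eq]
  have ht' : ∀ μ, star (M.jump μ * σ).trace = (σ * (M.jump μ)ᴴ).trace := fun μ => by
    rw [← ht, star_star]
  have h4 : star (4 : ℂ) = 4 := by simp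
  have hI : star (-Complex.I / 2) = -(-Complex.I / 2) := by simp [neg_div]
  rw [effective_apply]
  simp only [Matrix.conjTranspose_add, Matrix.conjTranspose_smul, Matrix.conjTranspose_sum,
    Matrix.conjTranspose_sub, Matrix.conjTranspose_conjTranspose, star_div₀, hw, hw', ht, ht', h4,
    conjTranspose_traceSecond, Matrix.conjTranspose_mul, Matrix.conjTranspose_kronecker,
    Matrix.conjTranspose_one, hσ.eq, hW.eq, hI, traceSecond_one_kronecker_mul, neg_add,
    ← Finset.sum_neg_distrib, neg_sub, neg_smul]

lemma isHermitian_siteGen (j : S) {ρ : Matrix (Fin D) (Fin D) ℂ} (hρ : ρ.IsHermitian) :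
    (M.siteGen j ρ).IsHermitian := by
  have h2 : star (1 / 2 : ℂ) = 1 / 2 := by simp
  have hκ : ∀ μ, star (M.κ μ j : ℂ) = M.κ μ j := fun μ => Complex.conj_ofReal _
  have hI : star (-Complex.I) = Complex.I := by simp
  rw [Matrix.IsHermitian]
  simp only [siteGen, commutator, dissipator, LinearMap.add_apply, LinearMap.smul_apply,
    LinearMap.sum_apply, LinearMap.sub_apply, Module.End.mul_apply, LinearMap.mulLeft_apply,
    LinearMap.mulRight_apply, Matrix.conjTranspose_add, Matrix.conjTranspose_smul,
    Matrix.conjTranspose_sum, Matrix.conjTranspose_sub, Matrix.conjTranspose_mul,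
    Matrix.conjTranspose_conjTranspose, hρ.eq, (M.h_herm j).eq, h2, hκ, hI]
  congr 1
  · module
  · refine Finset.sum_congr rfl fun μ _ => ?_
    rw [add_comm (ρ * _)]
    simp only [mul_assoc]

end Model

section HermitianPart

variable {D : ℕ}

/-- The Hermitian part of a matrix. -/
def hermPart (D : ℕ) : Matrix (Fin D) (Fin D) ℂ →ₗ[ℝ] Matrix (Fin D) (Fin D) ℂ where
  toFun X := (1 / 2 : ℝ) • (X + Xᴴ)
  map_add' X Y := by rw [Matrix.conjTranspose_add]; module
  map_smul' c X := by
    rw [Matrix.conjTranspose_smul, star_trivial, RingHom.id_apply]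
    module

lemma hermPart_apply (X : Matrix (Fin D) (Fin D) ℂ) : hermPart D X = (1 / 2 : ℝ) • (X + Xᴴ) := rfl

lemma isHermitian_hermPart (X : Matrix (Fin D) (Fin D) ℂ) : (hermPart D X).IsHermitian := by
  rw [hermPart_apply, Matrix.IsHermitian, Matrix.conjTranspose_smul, star_trivial,
    Matrix.conjTranspose_add, Matrix.conjTranspose_conjTranspose, add_comm]

lemma hermPart_of_isHermitian {X : Matrix (Fin D) (Fin D) ℂ} (hX : X.IsHermitian) :
    hermPart D X = X := by
  rw [hermPart_apply, hX.eq]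
  module

lemma norm_hermPart_le (X : Matrix (Fin D) (Fin D) ℂ) : ‖hermPart D X‖ ≤ ‖X‖ := by
  rw [hermPart_apply, norm_smul]
  have h1 : ‖Xᴴ‖ = ‖X‖ := Matrix.l2_opNorm_conjTranspose X
  have h2 := norm_add_le X Xᴴ
  have h3 : ‖(1 / 2 : ℝ)‖ = 1 / 2 := by norm_num
  rw [h1] at h2
  rw [h3]
  linarith

lemma re_trace_conjTranspose_mul (X : Matrix (Fin D) (Fin D) ℂ) {Y : Matrix (Fin D) (Fin D) ℂ}
    (hY : Y.IsHermitian) : (Xᴴ * Y).trace.re = (hermPart D X * Y).trace.re := by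
  have h1 : (Xᴴ * Y).trace.re = (X * Y).trace.re := by
    have h2 : star (X * Y).trace = (Xᴴ * Y).trace := by
      rw [← Matrix.trace_conjTranspose, Matrix.conjTranspose_mul, hY.eq, Matrix.trace_mul_comm]
    rw [← h2]
    exact Complex.conj_re _
  rw [hermPart_apply, smul_mul_assoc, Matrix.trace_smul, Complex.smul_re, add_mul,
    Matrix.trace_add, Complex.add_re, h1]
  simp only [smul_eq_mul]
  ring

end HermitianPart

namespace Model

variable {S : Type*} [Fintype S] [DecidableEq S] {D : ℕ} {ι : Type*} [Fintype ι]
  (M : Model S D ι) (a : S → S → ℝ)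

/-- The right-hand side of the mean-field equations, evaluated on the Hermitian parts. The Lyapunov
estimate needs Hermitian matrices; in this form it holds on the whole space, and solutions that
start from Hermitian matrices are the same. -/
def hermField (x : S → Matrix (Fin D) (Fin D) ℂ) (j : S) : Matrix (Fin D) (Fin D) ℂ :=
  M.coupledField a (fun k => hermPart D (x k)) j

lemma hermField_eq (x : S → Matrix (Fin D) (Fin D) ℂ) (j : S) : M.hermField a x j
    = M.siteGen j (hermPart D (x j)) + ∑ k ∈ Finset.univ.erase j, a j k •
      (M.effective j k (hermPart D (x k)) * hermPart D (x j)
        - hermPart D (x j) * M.effective j k (hermPart D (x k))) := by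
  simp only [hermField, coupledField, traceSecond_pairGen, Complex.coe_smul]

lemma isHermitian_hermField (x : S → Matrix (Fin D) (Fin D) ℂ) (j : S) :
    (M.hermField a x j).IsHermitian := by
  rw [hermField_eq]
  refine (M.isHermitian_siteGen j (isHermitian_hermPart _)).add
    (isHermitian_finset_sum _ fun k hk => ?_)
  have h1 := M.conjTranspose_effective (Finset.ne_of_mem_erase hk).symm
    (isHermitian_hermPart (x k))
  rw [Matrix.IsHermitian, Matrix.conjTranspose_smul, star_trivial, Matrix.conjTranspose_sub,
    Matrix.conjTranspose_mul, Matrix.conjTranspose_mul, h1, (isHermitian_hermPart (x j)).eq]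
  congr 1
  rw [mul_neg, neg_mul]
  abel

lemma contDiff_linear {E E' F : Type*} [NormedAddCommGroup E] [NormedSpace ℝ E]
    [NormedAddCommGroup E'] [NormedSpace ℝ E'] [FiniteDimensional ℝ E]
    [NormedAddCommGroup F] [NormedSpace ℝ F] (f : E →ₗ[ℝ] E') {g : F → E}
    (hg : ContDiff ℝ 1 g) : ContDiff ℝ 1 fun x => f (g x) :=
  (LinearMap.toContinuousLinearMap f).contDiff.comp hg

lemma contDiff_hermField : ContDiff ℝ 1 (M.hermField a) := by
  refine contDiff_pi.2 fun j => ?_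
  have h1 : ∀ k, ContDiff ℝ 1 fun x : S → Matrix (Fin D) (Fin D) ℂ => hermPart D (x k) := fun k =>
    contDiff_linear (hermPart D) (contDiff_apply ℝ (Matrix (Fin D) (Fin D) ℂ) k)
  simp only [hermField_eq]
  refine (contDiff_linear ((M.siteGen j).restrictScalars ℝ) (h1 j)).add
    (ContDiff.sum fun k _ => ContDiff.const_smul _ ?_)
  have h2 := contDiff_linear ((M.effective j k).restrictScalars ℝ) (h1 k)
  exact (h2.mul (h1 j)).sub ((h1 j).mul h2)

lemma re_trace_mul_hermField (x : S → Matrix (Fin D) (Fin D) ℂ) (j : S) :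
    ((x j)ᴴ * M.hermField a x j).trace.re
      = (hermPart D (x j) * M.siteGen j (hermPart D (x j))).trace.re := by
  rw [re_trace_conjTranspose_mul _ (M.isHermitian_hermField a x j), hermField_eq, mul_add,
    Matrix.trace_add, Finset.mul_sum, Matrix.trace_sum, Finset.sum_eq_zero, add_zero]
  intro k _
  rw [mul_smul_comm, Matrix.trace_smul, mul_sub, Matrix.trace_sub,
    Matrix.trace_mul_comm _ (hermPart D (x j) * _), mul_assoc, sub_self, smul_zero]

/-- The sum of the squares of all matrix entries. -/
def entrySq (x : S → Matrix (Fin D) (Fin D) ℂ) : ℝ :=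
  ∑ p : S × Fin D × Fin D, ‖x p.1 p.2.1 p.2.2‖ ^ 2

omit [DecidableEq S] in
lemma norm_sq_le_entrySq (x : S → Matrix (Fin D) (Fin D) ℂ) (j : S) :
    ‖x j‖ ^ 2 ≤ (D : ℝ) ^ 2 * entrySq x := by
  have h1 : ‖x j‖ ^ 2 = ‖(x j)ᴴ * x j‖ := by
    rw [Matrix.l2_opNorm_conjTranspose_mul_self, sq]
  have h2 := norm_le_trace_of_posSemidef (Matrix.posSemidef_conjTranspose_mul_self (x j))
  have h3 : ((x j)ᴴ * x j).trace.re = ∑ b, ∑ a, ‖x j a b‖ ^ 2 := by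
    simp only [Matrix.trace, Matrix.diag_apply, Matrix.mul_apply, Matrix.conjTranspose_apply,
      Complex.re_sum]
    refine Finset.sum_congr rfl fun b _ => Finset.sum_congr rfl fun a _ => ?_
    rw [RCLike.star_def, Complex.conj_mul', ← Complex.ofReal_pow, Complex.ofReal_re]
  have h4 : ∑ b, ∑ a, ‖x j a b‖ ^ 2 ≤ entrySq x := by
    rw [entrySq, Fintype.sum_prod_type, Finset.sum_comm]
    simp only [Fintype.sum_prod_type]
    exact Finset.single_le_sum (f := fun j => ∑ a, ∑ b, ‖x j a b‖ ^ 2)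
      (fun _ _ => by positivity) (Finset.mem_univ j)
  rw [h1]
  refine h2.trans ?_
  rw [h3, Fintype.card_fin]
  gcongr

/-- The entry of a tuple of matrices as a continuous linear map. -/
def entryCLM (p : S × Fin D × Fin D) : (S → Matrix (Fin D) (Fin D) ℂ) →L[ℝ] ℂ where
  toFun x := x p.1 p.2.1 p.2.2
  map_add' _ _ := rfl
  map_smul' _ _ := rfl
  cont := (continuous_apply p.1).matrix_elem p.2.1 p.2.2

omit [DecidableEq S] in
lemma hasFDerivAt_entrySq (x : S → Matrix (Fin D) (Fin D) ℂ) :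
    HasFDerivAt entrySq (∑ p : S × Fin D × Fin D,
      2 • (innerSL ℝ (entryCLM p x)).comp (entryCLM p)) x :=
  HasFDerivAt.fun_sum fun p _ => (entryCLM p).hasFDerivAt.norm_sq

omit [DecidableEq S] in
lemma sum_inner_entry (x y : S → Matrix (Fin D) (Fin D) ℂ) :
    (∑ p : S × Fin D × Fin D, 2 • (innerSL ℝ (entryCLM p x)).comp (entryCLM p)) y
      = 2 * ∑ j, ((x j)ᴴ * y j).trace.re := by
  simp only [_root_.sum_apply, _root_.smul_apply,
    ContinuousLinearMap.comp_apply, innerSL_apply_apply, nsmul_eq_mul, ← Finset.mul_sum]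
  congr 1
  rw [Fintype.sum_prod_type]
  refine Finset.sum_congr rfl fun j _ => ?_
  rw [Fintype.sum_prod_type, Finset.sum_comm]
  simp only [Matrix.trace, Matrix.diag_apply, Matrix.mul_apply, Matrix.conjTranspose_apply,
    Complex.re_sum]
  refine Finset.sum_congr rfl fun b _ => Finset.sum_congr rfl fun a _ => ?_
  rw [Complex.inner, mul_comm]
  rfl

lemma exists_lyapunov_bound : ∃ c, 0 ≤ c ∧ ∀ x : S → Matrix (Fin D) (Fin D) ℂ,
    2 * ∑ j, ((x j)ᴴ * M.hermField a x j).trace.re ≤ c * entrySq x := by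
  have hb : ∀ j, ∃ c, 0 ≤ c ∧ ∀ X, ‖M.siteGen j X‖ ≤ c * ‖X‖ := fun j =>
    ⟨‖LinearMap.toContinuousLinearMap (M.siteGen j)‖, norm_nonneg _, fun X =>
      (LinearMap.toContinuousLinearMap (M.siteGen j)).le_opNorm X⟩
  choose c hc0 hc using hb
  refine ⟨2 * ∑ j, D * (c j * (D : ℝ) ^ 2), by
    have := Finset.sum_nonneg fun j (_ : j ∈ Finset.univ) => hc0 j
    refine mul_nonneg zero_le_two (Finset.sum_nonneg fun j _ => ?_)
    have := hc0 j
    positivity, fun x => ?_⟩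
  rw [mul_assoc, Finset.sum_mul]
  refine mul_le_mul_of_nonneg_left (Finset.sum_le_sum fun j _ => ?_) zero_le_two
  have hcj := hc0 j
  rw [re_trace_mul_hermField]
  calc (hermPart D (x j) * M.siteGen j (hermPart D (x j))).trace.re
      ≤ ‖(hermPart D (x j) * M.siteGen j (hermPart D (x j))).trace‖ := Complex.re_le_norm _
    _ ≤ D * ‖hermPart D (x j) * M.siteGen j (hermPart D (x j))‖ := by
        simpa using norm_trace_le (hermPart D (x j) * M.siteGen j (hermPart D (x j)))
    _ ≤ D * (‖x j‖ * (c j * ‖x j‖)) := by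
        have h1 := norm_hermPart_le (x j)
        have h2 := hc j (hermPart D (x j))
        have h3 : c j * ‖hermPart D (x j)‖ ≤ c j * ‖x j‖ := by gcongr
        have h4 := h2.trans h3
        refine mul_le_mul_of_nonneg_left ((norm_mul_le _ _).trans ?_) (Nat.cast_nonneg D)
        gcongr
    _ = D * (c j * ‖x j‖ ^ 2) := by ring
    _ ≤ D * (c j * ((D : ℝ) ^ 2 * entrySq x)) := by
        have := norm_sq_le_entrySq x j
        gcongr
    _ = _ := by ring

/-- Global existence for the mean-field equations. The interaction acts on the Hermitian state of
each site by a commutator, and therefore does not change the sum of the `tr (ρ_j ^ 2)`. -/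
lemma exists_coupledField_solution {ρ₀ : S → Matrix (Fin D) (Fin D) ℂ}
    (hρ₀ : ∀ j, (ρ₀ j).IsHermitian) : ∃ ρ : S → ℝ → Matrix (Fin D) (Fin D) ℂ,
      (∀ j, ρ j 0 = ρ₀ j) ∧ ∀ j, ∀ t : ℝ, 0 ≤ t →
        HasDerivWithinAt (ρ j) (M.coupledField a (fun k => ρ k t) j) (Set.Ici 0) t := by
  obtain ⟨c, hc0, hc⟩ := M.exists_lyapunov_bound a
  obtain ⟨x, hx0, hx⟩ := exists_solution_Ici (F := M.hermField a) (u := entrySq)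
    (K := (D : ℝ) ^ 2 + 1) (M.contDiff_hermField a) hasFDerivAt_entrySq hc0 (by positivity)
    (fun x => by
      rw [sum_inner_entry]
      exact hc x) (fun x => by
      have h0 : 0 ≤ entrySq x := Finset.sum_nonneg fun _ _ => by positivity
      have h1 : ‖x‖ ≤ √(((D : ℝ) ^ 2 + 1) * entrySq x) := by
        refine (pi_norm_le_iff_of_nonneg (Real.sqrt_nonneg _)).2 fun j => Real.le_sqrt_of_sq_le ?_
        exact (norm_sq_le_entrySq x j).trans (by nlinarith)
      calc ‖x‖ ^ 2 ≤ √(((D : ℝ) ^ 2 + 1) * entrySq x) ^ 2 := by gcongr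
        _ = _ := Real.sq_sqrt (by positivity)) ρ₀
  have hxj : ∀ j, ∀ t : ℝ, 0 ≤ t →
      HasDerivWithinAt (fun t => x t j) (M.hermField a (x t) j) (Set.Ici 0) t := fun j t ht =>
    hasDerivWithinAt_pi.1 (hx t ht) j
  have hherm : ∀ j, ∀ t : ℝ, 0 ≤ t → (x t j).IsHermitian := by
    intro j t ht
    have hd : ∀ s : ℝ, 0 ≤ s →
        HasDerivWithinAt (fun s => x s j - star (x s j)) 0 (Set.Ici 0) s := by
      intro s hs
      have h1 := (hxj j s hs).sub (hxj j s hs).star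
      have h2 : star (M.hermField a (x s) j) = M.hermField a (x s) j :=
        M.isHermitian_hermField a (x s) j
      rwa [h2, sub_self] at h1
    have hconst := constant_of_has_deriv_right_zero (f := fun s => x s j - star (x s j)) (a := 0)
      (b := t) (fun s hs => ((hd s hs.1).continuousWithinAt).mono fun z hz => hz.1)
      (fun s hs => (hd s hs.1).mono (Set.Ici_subset_Ici.2 hs.1)) t ⟨ht, le_rfl⟩
    have h0 : star (x 0 j) = x 0 j := by rw [hx0]; exact hρ₀ j
    simp only [h0, sub_self] at hconst
    exact (sub_eq_zero.1 hconst).symm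
  refine ⟨fun j t => x t j, fun j => congrFun hx0 j, fun j t ht => ?_⟩
  have h1 := hxj j t ht
  have h2 : M.hermField a (x t) j = M.coupledField a (fun k => x t k) j := by
    rw [hermField]
    congr 1
    funext k
    exact hermPart_of_isHermitian (hherm k t ht)
  rwa [h2] at h1

/-- Mean-field solutions preserve the traces. -/
lemma isNormalizedSolution {ρ : S → ℝ → Matrix (Fin D) (Fin D) ℂ}
    (hρ₀ : ∀ j, (ρ j 0).trace = 1) (hρ : ∀ j, ∀ t : ℝ, 0 ≤ t →
      HasDerivWithinAt (ρ j) (M.coupledField a (fun k => ρ k t) j) (Set.Ici 0) t) :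
    M.IsNormalizedSolution a ρ where
  hasDeriv := hρ
  trace_eq j t ht := by
    have hd : ∀ s : ℝ, 0 ≤ s → HasDerivWithinAt (fun s => (ρ j s).trace) 0 (Set.Ici 0) s := by
      intro s hs
      have h1 := (LinearMap.toContinuousLinearMap
        ((Matrix.traceLinearMap (Fin D) ℂ ℂ).restrictScalars ℝ)).hasFDerivAt.comp_hasDerivWithinAt
          s (hρ j s hs)
      have h2 : (M.coupledField a (fun k => ρ k s) j).trace = 0 := trace_coupledField M a _ j
      have h3 : LinearMap.toContinuousLinearMap
        ((Matrix.traceLinearMap (Fin D) ℂ ℂ).restrictScalars ℝ)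
          (M.coupledField a (fun k => ρ k s) j) = 0 := h2
      rw [h3] at h1
      exact h1
    have hconst := constant_of_has_deriv_right_zero (f := fun s => (ρ j s).trace) (a := 0)
      (b := t) (fun s hs => ((hd s hs.1).continuousWithinAt).mono fun z hz => hz.1)
      (fun s hs => (hd s hs.1).mono (Set.Ici_subset_Ici.2 hs.1)) t ⟨ht, le_rfl⟩
    rw [hconst, hρ₀]

end Model

end LongRange

end

theorem theorem1 {ι : Type*} [Fintype ι] (d D : ℕ) (hd : 1 ≤ d)
    (bc : LongRange.Boundary) (α : ℝ) (hα0 : 0 ≤ α) (hαd : α ≤ d)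
    -- for each linear size `L`: the parameters of the model and the initial single-site states
    (M : ∀ L : ℕ, LongRange.Model (LongRange.Site d L) D ι)
    (ρ₀ : ∀ L : ℕ, LongRange.Site d L → Matrix (Fin D) (Fin D) ℂ)
    (hρ₀ : ∀ L j, LongRange.IsState (ρ₀ L j))
    -- the many-body dynamics is completely positive
    (hCP : ∀ L : ℕ, ∀ t : ℝ, 0 ≤ t →
      LongRange.IsCompletelyPositive (LongRange.evolve ((M L).generator bc α) t))
    -- the long-range couplings are bounded uniformly in the system size
    (hC : ∃ C : ℝ, ∀ L : ℕ, ∀ j k : LongRange.Site d L, (M L).strength j k ≤ C) :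
    (∀ L : ℕ, ∃ ρ : LongRange.Site d L → ℝ → Matrix (Fin D) (Fin D) ℂ,
      (M L).IsMeanFieldSolution bc α (ρ₀ L) ρ) ∧
    ∀ ρ : ∀ L : ℕ, LongRange.Site d L → ℝ → Matrix (Fin D) (Fin D) ℂ,
      (∀ L, (M L).IsMeanFieldSolution bc α (ρ₀ L) (ρ L)) →
      ∀ (n : ℕ) (Λ : ∀ L : ℕ, Finset (LongRange.Site d L)), (∀ L, (Λ L).card ≤ n) →
      ∀ t : ℝ, 0 ≤ t →
        Tendsto (fun L : ℕ => LongRange.traceNorm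
          (LongRange.reduced (Λ L)
              (LongRange.evolve ((M L).generator bc α) t (LongRange.tensorState (ρ₀ L)))
            - LongRange.tensorState (fun j : Λ L => ρ L j t)))
          atTop (𝓝 0) := by
  obtain ⟨C, hC⟩ := hC
  -- By definition, the mean-field equations are those of `coupledField` for the couplings
  -- `coupling bc α`.
  refine ⟨fun L => (M L).exists_coupledField_solution (LongRange.coupling bc α)
    fun j => (hρ₀ L j).1.isHermitian, fun ρ hρ n Λ hΛ t ht => ?_⟩
  -- For `D = 0` there is no state, since the trace of an empty matrix vanishes.
  have hD : 1 ≤ D := by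
    by_contra h
    obtain rfl : D = 0 := by omega
    have h1 := (hρ₀ 1 fun _ => 0).2
    simp [Matrix.trace] at h1
  have hkac := LongRange.tendsto_kac bc hd hα0 hαd
  have hscale : ∀ᶠ L in atTop, (M L).MeanFieldScaling (LongRange.coupling bc α)
      (1 / (2 * LongRange.kac bc α d L)) (1 / LongRange.kac bc α d L)
      (√(2 + 2 * d) ^ α * (4 ^ d * 2)) (max C 0) := by
    filter_upwards [hkac.eventually_ge_atTop 1] with L hL
    exact LongRange.meanFieldScaling_lattice (M L) bc hd hα0 (le_max_right _ _)
      (fun j k => (hC L j k).trans (le_max_left _ _)) hD (hCP L) hL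
  have hη : Tendsto (fun L => 1 / LongRange.kac bc α d L) atTop (𝓝 0) := by
    simp only [one_div]
    exact tendsto_inv_atTop_zero.comp hkac
  have hsol : ∀ L, (M L).IsNormalizedSolution (LongRange.coupling bc α) (ρ L) := fun L =>
    (M L).isNormalizedSolution _ (fun j => by rw [(hρ L).1 j]; exact (hρ₀ L j).2) (hρ L).2
  have hpos : ∀ L j, (ρ L j 0).PosSemidef := fun L j => by
    rw [(hρ L).1 j]
    exact (hρ₀ L j).1
  have hinit : ∀ L, (fun k => ρ L k 0) = ρ₀ L := fun L => funext (hρ L).1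
  have hmain := LongRange.Model.eventually_marginalNorm_sub_le hscale hη hsol hpos t ht n
  have hDn : 0 < ((D : ℝ) ^ n) ^ 2 := by
    have : (0 : ℝ) < D := by exact_mod_cast hD
    positivity
  refine (Metric.tendsto_nhds (α := ℝ)).2 fun ε hε => ?_
  filter_upwards [hmain (ε / (4 * ((D : ℝ) ^ n) ^ 2)) (by positivity)] with L hL
  have h1 := hL (Λ L) (hΛ L)
  rw [hinit, ← LongRange.generator_eq] at h1
  have h2 := LongRange.traceNorm_reduced_sub_le hD (hΛ L)
    (LongRange.evolve ((M L).generator bc α) t (LongRange.tensorState (ρ₀ L)))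
    (fun j => (hsol L).trace_eq j t ht)
  rw [dist_zero_right, Real.norm_of_nonneg (LongRange.traceNorm_nonneg _)]
  refine h2.trans_lt ?_
  calc ((D : ℝ) ^ n) ^ 2 * (2 * _) ≤ ((D : ℝ) ^ n) ^ 2 * (2 * (ε / (4 * ((D : ℝ) ^ n) ^ 2))) := by
        gcongr
    _ = ε / 2 := by field_simp; norm_num
    _ < ε := by linarith
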